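/- Let $X$ be a smooth separated scheme of finite type over $\mathbb C$. Let $\nu(\mathcal O_X)=\mathrm{Pro}(\mathrm{Coh}(\mathcal O_X))$ be the category of Pro-coherent $\mathcal O_X$-modules: its objects are the small filtering projective systems $\{\mathcal F_i\}_{I}$ of coherent $\mathcal O_X$-modules, and $\mathrm{Hom}(\{\mathcal F_i\}_I,\{\mathcal G_j\}_J)=\varprojlim_J\varinjlim_I\mathrm{Hom}_{\mathcal O_X}(\mathcal F_i,\mathcal G_j)$. For $m\ge 0$ let $\mathcal P^m_X=\Delta^{-1}(\mathcal O_{X\times_{\mathbb C} X}/\mathcal I^{m+1})$ be the sheaf of principal parts of order $m$, where $\mathcal I$ is the ideal of the diagonal $\Delta:X\to X\times_{\mathbb C}X$, with transition maps $\mathcal P^r_X\to\mathcal P^m_X$ ($m\le r$), the augmentation $q_m:\mathcal P^m_X\to\mathcal O_X$, and $\delta^{m,n}:\mathcal P^{m+n}_X\to\mathcal P^m_X\otimes_{\mathcal O_X}\mathcal P^n_X$, $a\otimes b\mapsto(a\otimes 1)\otimes(1\otimes b)$. For an $\mathcal O_X$-module $\mathcal F$ the tensor product $\mathcal P^m_X\otimes_{\mathcal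 O_X}\mathcal F$ is formed with the right structure of $\mathcal P^m_X$ (second projection) and is an $\mathcal O_X$-module through the left structure (first projection); for a pro-object, $\{\mathcal P^m_X\}\otimes\{\mathcal F_i\}_I:=\{\mathcal P^m_X\otimes_{\mathcal O_X}\mathcal F_i\}_{\mathbb N\times I}$. Let $\nu(\mathcal P^{\cdot}_X)$ be the category of stratified Pro-coherent modules. Its objects are the $\mathcal F\in\nu(\mathcal O_X)$ endowed with a morphism of pro-objects $s:\mathcal F\to\{\mathcal P^m_X\}\otimes\mathcal F$ such that $(\{q_m\}\otimes\mathrm{id})\circ s=\mathrm{id}_{\mathcal F}$ and $(\mathrm{id}\otimes s)\circ s=(\{\delta^{m,n}\}\otimes\mathrm{id})\circ s$. Its morphisms are the morphisms $f$ of $\nu(\mathcal O_X)$ with $(\mathrm{id}\otimes f)\circ s=s\circ f$. An object of $\nu(\mathcal P^{\cdot}_X)$ is called induced if it is isomorphic to $\{\mathcal P^m_X\}\otimes\mathcal L$, with the stratification $\{\delta^{m,n}\}\otimes\mathrm{id}$, for some $\mathcal L\in\nu(\mathcal O_X)$. Then: 1. the category $\nu(\mathcal P^{\cdot}_X)$ is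 abelian; 2. small filtering projective limits in $\nu(\mathcal P^{\cdot}_X)$ exist and are exact; 3. $\mathcal P^m_X\otimes_{\mathcal O_X}\mathcal F$ is coherent for every coherent $\mathcal F$ and every $m\ge 0$, and the forgetful functor $\nu(\mathcal P^{\cdot}_X)\to\nu(\mathcal O_X)$ has as right adjoint the functor $$\mathrm Q^0_X=\{\mathcal P^m_X\}\otimes_{\mathcal O_X}(-):\nu(\mathcal O_X)\to\nu(\mathcal P^{\cdot}_X),\qquad \mathcal F\mapsto\bigl(\{\mathcal P^m_X\}\otimes_{\mathcal O_X}\mathcal F,\ \{\delta^{m,n}\}\otimes\mathrm{id}\bigr),$$ and every object $\mathrm Q^0_X(\mathcal F)$ is induced. -/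

import Mathlib

universe u v w u' v'

open CategoryTheory Opposite

namespace StratPro

section Algebra

open scoped TensorProduct

/-- The ring of principal parts of order `m` of the `k`-algebra `A`:
`(A ⊗[k] A) ⧸ I ^ (m + 1)`, where `I` is the kernel of the multiplication map. -/
def PrincipalParts (k A : Type u) [CommRing k] [CommRing A] [Algebra k A] (m : ℕ) : Type u :=
  (A ⊗[k] A) ⧸ (KaehlerDifferential.ideal k A) ^ (m + 1)

namespace PrincipalParts

noncomputable instance (k A : Type u) [CommRing k] [CommRing A] [Algebra k A] (m : ℕ) :
    CommRing (PrincipalParts k A m) :=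
  inferInstanceAs (CommRing ((A ⊗[k] A) ⧸ (KaehlerDifferential.ideal k A) ^ (m + 1)))

variable (k : Type u) {A B : Type u} [CommRing k] [CommRing A] [CommRing B] [Algebra k A]

variable (A) in
/-- The class of an element of `A ⊗[k] A`. -/
noncomputable def mk (m : ℕ) : A ⊗[k] A →+* PrincipalParts k A m :=
  Ideal.Quotient.mk ((KaehlerDifferential.ideal k A) ^ (m + 1))

/-- The left structure `a ↦ a ⊗ 1`, induced by the first projection. -/
noncomputable def d₀ (m : ℕ) : A →+* PrincipalParts k A m :=
  (mk k A m).comp (Algebra.TensorProduct.includeLeft : A →ₐ[k] A ⊗[k] A).toRingHom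

/-- The right structure `a ↦ 1 ⊗ a`, induced by the second projection. -/
noncomputable def d₁ (m : ℕ) : A →+* PrincipalParts k A m :=
  (mk k A m).comp (Algebra.TensorProduct.includeRight : A →ₐ[k] A ⊗[k] A).toRingHom

theorem mk_surjective (m : ℕ) : Function.Surjective (mk k A m) :=
  Ideal.Quotient.mk_surjective

theorem mk_tmul (m : ℕ) (a b : A) : mk k A m (a ⊗ₜ b) = d₀ k m a * d₁ k m b := by
  change _ = mk k A m _ * mk k A m _
  rw [← map_mul]
  congr 1
  simp

theorem d₀_algebraMap (m : ℕ) (c : k) :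
    d₀ k m (algebraMap k A c) = d₁ k m (algebraMap k A c) := by
  change mk k A m ((algebraMap k A c) ⊗ₜ 1) = mk k A m (1 ⊗ₜ (algebraMap k A c))
  rw [Algebra.algebraMap_eq_smul_one, TensorProduct.smul_tmul]

/-- The principal parts are additively generated by the classes of the `a ⊗ b`. -/
theorem induction_on {m : ℕ} {motive : PrincipalParts k A m → Prop}
    (p : PrincipalParts k A m) (zero : motive 0)
    (mul : ∀ a b, motive (d₀ k m a * d₁ k m b))
    (add : ∀ p q, motive p → motive q → motive (p + q)) : motive p := by
  obtain ⟨t, rfl⟩ := mk_surjective k m p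
  induction t using TensorProduct.induction_on with
  | zero => rw [map_zero]; exact zero
  | tmul a b => rw [mk_tmul]; exact mul a b
  | add x y hx hy => rw [map_add]; exact add _ _ hx hy

/-- Universal property of the ring of principal parts. -/
theorem exists_lift (m : ℕ) (f g : A →+* B)
    (hσ : ∀ c : k, f (algebraMap k A c) = g (algebraMap k A c))
    (hI : (Ideal.span (Set.range fun a : A ↦ g a - f a)) ^ (m + 1) = ⊥) :
    ∃ φ : PrincipalParts k A m →+* B,
      (∀ a, φ (d₀ k m a) = f a) ∧ ∀ a, φ (d₁ k m a) = g a := by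
  let _ : Algebra k B := (f.comp (algebraMap k A)).toAlgebra
  let f' : A →ₐ[k] B := { f with commutes' := fun c ↦ rfl }
  let g' : A →ₐ[k] B := { g with commutes' := fun c ↦ (hσ c).symm }
  let ψ : A ⊗[k] A →ₐ[k] B := Algebra.TensorProduct.lift f' g' fun _ _ ↦ Commute.all _ _
  have h0 : ∀ a, ψ (a ⊗ₜ 1) = f a := fun a ↦ by
    have : ψ (a ⊗ₜ 1) = f a * g 1 := rfl
    rw [this, map_one, mul_one]
  have h1 : ∀ a, ψ (1 ⊗ₜ a) = g a := fun a ↦ by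
    have : ψ (1 ⊗ₜ a) = f 1 * g a := rfl
    rw [this, map_one, one_mul]
  have hker : ∀ t ∈ (KaehlerDifferential.ideal k A) ^ (m + 1), ψ.toRingHom t = 0 := by
    intro t ht
    have h2 : (KaehlerDifferential.ideal k A).map ψ.toRingHom ≤
        Ideal.span (Set.range fun a : A ↦ g a - f a) := by
      rw [← KaehlerDifferential.span_range_eq_ideal, Ideal.map_span, Ideal.span_le]
      rintro _ ⟨_, ⟨a, rfl⟩, rfl⟩
      refine Ideal.subset_span ⟨a, ?_⟩
      change _ = ψ _
      rw [map_sub, h0, h1]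
    have h3 := Ideal.mem_map_of_mem ψ.toRingHom ht
    rw [Ideal.map_pow] at h3
    have h4 := Ideal.pow_right_mono h2 (m + 1) h3
    rwa [hI, Ideal.mem_bot] at h4
  exact ⟨Ideal.Quotient.lift _ ψ.toRingHom hker, fun a ↦ h0 a, fun a ↦ h1 a⟩

/-- The ring homomorphism out of the principal parts with given composites with `d₀`, `d₁`. -/
noncomputable def lift (m : ℕ) (f g : A →+* B)
    (hσ : ∀ c : k, f (algebraMap k A c) = g (algebraMap k A c))
    (hI : (Ideal.span (Set.range fun a : A ↦ g a - f a)) ^ (m + 1) = ⊥) :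
    PrincipalParts k A m →+* B :=
  (exists_lift k m f g hσ hI).choose

@[simp]
theorem lift_d₀ (m : ℕ) (f g : A →+* B)
    (hσ : ∀ c : k, f (algebraMap k A c) = g (algebraMap k A c))
    (hI : (Ideal.span (Set.range fun a : A ↦ g a - f a)) ^ (m + 1) = ⊥) (a : A) :
    lift k m f g hσ hI (d₀ k m a) = f a :=
  (exists_lift k m f g hσ hI).choose_spec.1 a

@[simp]
theorem lift_d₁ (m : ℕ) (f g : A →+* B)
    (hσ : ∀ c : k, f (algebraMap k A c) = g (algebraMap k A c))
    (hI : (Ideal.span (Set.range fun a : A ↦ g a - f a)) ^ (m + 1) = ⊥) (a : A) :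
    lift k m f g hσ hI (d₁ k m a) = g a :=
  (exists_lift k m f g hσ hI).choose_spec.2 a

/-- The augmentation ideal of the principal parts of order `m` is nilpotent. -/
theorem span_pow_eq_bot (m : ℕ) :
    (Ideal.span (Set.range fun a : A ↦ d₁ k m a - d₀ k m a)) ^ (m + 1) = ⊥ := by
  have h : Ideal.span (Set.range fun a : A ↦ d₁ k m a - d₀ k m a) =
      (KaehlerDifferential.ideal k A).map (mk k A m) := by
    rw [← KaehlerDifferential.span_range_eq_ideal, Ideal.map_span, ← Set.range_comp]
    congr 2
  rw [h, ← Ideal.map_pow]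
  exact Ideal.map_quotient_self _

theorem span_pow_le {m r : ℕ} (h : m ≤ r) (g : PrincipalParts k A m →+* B) :
    (Ideal.span (Set.range fun a : A ↦ g (d₁ k m a) - g (d₀ k m a))) ^ (r + 1) = ⊥ := by
  have h1 : Ideal.span (Set.range fun a : A ↦ g (d₁ k m a) - g (d₀ k m a)) =
      (Ideal.span (Set.range fun a : A ↦ d₁ k m a - d₀ k m a)).map g := by
    rw [Ideal.map_span, ← Set.range_comp]
    congr 2
    funext a
    exact (map_sub g _ _).symm
  rw [eq_bot_iff]
  refine (Ideal.pow_le_pow_right (Nat.succ_le_succ h)).trans ?_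
  rw [Nat.succ_eq_add_one, h1, ← Ideal.map_pow, span_pow_eq_bot, Ideal.map_bot]

/-- The transition map from principal parts of order `r` to principal parts of order `m ≤ r`. -/
noncomputable def trans {m r : ℕ} (h : m ≤ r) : PrincipalParts k A r →+* PrincipalParts k A m :=
  Ideal.Quotient.factor (Ideal.pow_le_pow_right (Nat.succ_le_succ h))

@[simp]
theorem trans_d₀ {m r : ℕ} (h : m ≤ r) (a : A) : trans k h (d₀ k r a) = d₀ k m a := rfl

@[simp]
theorem trans_d₁ {m r : ℕ} (h : m ≤ r) (a : A) : trans k h (d₁ k r a) = d₁ k m a := rfl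

/-- The augmentation, induced by multiplication `A ⊗[k] A → A` (restriction to the diagonal). -/
noncomputable def aug (m : ℕ) : PrincipalParts k A m →+* A :=
  lift k m (RingHom.id A) (RingHom.id A) (fun _ ↦ rfl) (by
    rw [eq_bot_iff]
    refine (Ideal.pow_le_self (Nat.succ_ne_zero m)).trans ?_
    rw [Ideal.span_le]
    rintro _ ⟨a, rfl⟩
    simp)

@[simp]
theorem aug_d₀ (m : ℕ) (a : A) : aug k m (d₀ k m a) = a := lift_d₀ ..

@[simp]
theorem aug_d₁ (m : ℕ) (a : A) : aug k m (d₁ k m a) = a := lift_d₁ ..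

theorem sup_pow_eq_bot {B : Type u} [CommRing B] {I J : Ideal B} {m n r : ℕ} (h : m + n ≤ r)
    (hI : I ^ (m + 1) = ⊥) (hJ : J ^ (n + 1) = ⊥) : (I ⊔ J) ^ (r + 1) = ⊥ := by
  rw [← Ideal.add_eq_sup, add_pow, Ideal.sum_eq_sup, eq_bot_iff]
  refine Finset.sup_le fun i _ ↦ ?_
  by_cases hi : m + 1 ≤ i
  · have h1 : I ^ i = ⊥ := eq_bot_iff.2 ((Ideal.pow_le_pow_right hi).trans hI.le)
    rw [h1]
    simp
  · have h2 : n + 1 ≤ r + 1 - i := by omega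
    have h1 : J ^ (r + 1 - i) = ⊥ := eq_bot_iff.2 ((Ideal.pow_le_pow_right h2).trans hJ.le)
    rw [h1]
    simp

/-- Composition of two principal parts: ring homomorphisms `β`, `γ` which agree on the inner
copies of `A` induce a ring homomorphism on the principal parts of order `r ≥ m + n`. -/
noncomputable def glue {m n r : ℕ} (h : m + n ≤ r) (β : PrincipalParts k A m →+* B)
    (γ : PrincipalParts k A n →+* B) (hβγ : ∀ a, β (d₁ k m a) = γ (d₀ k n a)) :
    PrincipalParts k A r →+* B :=
  lift k r (β.comp (d₀ k m)) (γ.comp (d₁ k n))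
    (fun c ↦ by
      simp only [RingHom.comp_apply]
      rw [d₀_algebraMap, hβγ, d₀_algebraMap]) (by
    have hl := span_pow_le k le_rfl β
    have hr := span_pow_le k le_rfl γ
    set I := Ideal.span (Set.range fun a : A ↦ β (d₁ k m a) - β (d₀ k m a))
    set J := Ideal.span (Set.range fun a : A ↦ γ (d₁ k n a) - γ (d₀ k n a))
    have hle : Ideal.span (Set.range fun a : A ↦
        (γ.comp (d₁ k n)) a - (β.comp (d₀ k m)) a) ≤ I ⊔ J := by
      rw [Ideal.span_le]
      rintro _ ⟨a, rfl⟩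
      have e : (γ.comp (d₁ k n)) a - (β.comp (d₀ k m)) a =
          (β (d₁ k m a) - β (d₀ k m a)) + (γ (d₁ k n a) - γ (d₀ k n a)) := by
        rw [hβγ]
        simp
      simp only [SetLike.mem_coe]
      rw [e]
      exact Submodule.add_mem_sup (Ideal.subset_span ⟨a, rfl⟩) (Ideal.subset_span ⟨a, rfl⟩)
    rw [eq_bot_iff]
    exact (Ideal.pow_right_mono hle _).trans (sup_pow_eq_bot h hl hr).le)

theorem glue_d₀ {m n r : ℕ} (h : m + n ≤ r) (β : PrincipalParts k A m →+* B)
    (γ : PrincipalParts k A n →+* B) (hβγ : ∀ a, β (d₁ k m a) = γ (d₀ k n a)) (a : A) :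
    glue k h β γ hβγ (d₀ k r a) = β (d₀ k m a) := lift_d₀ ..

theorem glue_d₁ {m n r : ℕ} (h : m + n ≤ r) (β : PrincipalParts k A m →+* B)
    (γ : PrincipalParts k A n →+* B) (hβγ : ∀ a, β (d₁ k m a) = γ (d₀ k n a)) (a : A) :
    glue k h β γ hβγ (d₁ k r a) = γ (d₁ k n a) := lift_d₁ ..

variable [Algebra k B]

variable {k} in
/-- Functoriality of the principal parts in the algebra. -/
noncomputable def map (m : ℕ) (φ : A →+* B)
    (hφ : ∀ c : k, φ (algebraMap k A c) = algebraMap k B c) :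
    PrincipalParts k A m →+* PrincipalParts k B m :=
  lift k m ((d₀ k m).comp φ) ((d₁ k m).comp φ)
    (fun c ↦ by simp only [RingHom.comp_apply, hφ, d₀_algebraMap]) (by
      rw [eq_bot_iff, ← span_pow_eq_bot k (A := B) m]
      refine Ideal.pow_right_mono (Ideal.span_mono ?_) _
      rintro _ ⟨a, rfl⟩
      exact ⟨φ a, rfl⟩)

@[simp]
theorem map_d₀ (m : ℕ) (φ : A →+* B)
    (hφ : ∀ c : k, φ (algebraMap k A c) = algebraMap k B c) (a : A) :
    map m φ hφ (d₀ k m a) = d₀ k m (φ a) := lift_d₀ ..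

@[simp]
theorem map_d₁ (m : ℕ) (φ : A →+* B)
    (hφ : ∀ c : k, φ (algebraMap k A c) = algebraMap k B c) (a : A) :
    map m φ hφ (d₁ k m a) = d₁ k m (φ a) := lift_d₁ ..

end PrincipalParts

/-- `PrincipalParts k A m` as an `A`-algebra through the right structure `d₁`. -/
noncomputable instance PrincipalParts.rightAlgebra (k A : Type u) [CommRing k] [CommRing A]
    [Algebra k A] (m : ℕ) : Algebra A (PrincipalParts k A m) :=
  (PrincipalParts.d₁ k m).toAlgebra

theorem PrincipalParts.smul_def (k : Type u) {A : Type u} [CommRing k] [CommRing A]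
    [Algebra k A] (m : ℕ) (a : A) (p : PrincipalParts k A m) :
    a • p = p * PrincipalParts.d₁ k m a := by
  rw [Algebra.smul_def, mul_comm]
  rfl

/-- `𝒫ᵐ ⊗_A M`: the tensor product is formed with the right structure `d₁` of the principal
parts, and the result is regarded as an `A`-module through the left structure `d₀`. -/
def PPTensor (k A : Type u) [CommRing k] [CommRing A] [Algebra k A] (m : ℕ)
    (M : Type u) [AddCommGroup M] [Module A M] : Type u :=
  PrincipalParts k A m ⊗[A] M

namespace PPTensor

open PrincipalParts

section Inst

variable (k A : Type u) [CommRing k] [CommRing A] [Algebra k A] (m : ℕ)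
    (M : Type u) [AddCommGroup M] [Module A M]

noncomputable instance : AddCommGroup (PPTensor k A m M) :=
  inferInstanceAs (AddCommGroup (PrincipalParts k A m ⊗[A] M))

noncomputable instance : Module (PrincipalParts k A m) (PPTensor k A m M) :=
  inferInstanceAs (Module (PrincipalParts k A m) (PrincipalParts k A m ⊗[A] M))

noncomputable instance : Module A (PPTensor k A m M) :=
  Module.compHom _ (d₀ k m)

end Inst

variable {k A B : Type u} [CommRing k] [CommRing A] [CommRing B] [Algebra k A] [Algebra k B]
  {m : ℕ} {M N W : Type u} [AddCommGroup M] [Module A M] [AddCommGroup N] [Module A N]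
  [AddCommGroup W]

theorem smul_def (a : A) (t : PPTensor k A m M) : a • t = d₀ k m a • t := rfl

/-- Pure tensors. -/
noncomputable def tmul (p : PrincipalParts k A m) (x : M) : PPTensor k A m M := p ⊗ₜ[A] x

theorem smul_tmul (p q : PrincipalParts k A m) (x : M) : p • tmul q x = tmul (p * q) x := rfl

theorem tmul_smul (p : PrincipalParts k A m) (a : A) (x : M) :
    tmul p (a • x) = tmul (p * d₁ k m a) x := by
  rw [← PrincipalParts.smul_def]
  exact (TensorProduct.smul_tmul a p x).symm

variable (k A m) in
/-- The map `x ↦ 1 ⊗ x`. -/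
noncomputable def j : M →+ PPTensor k A m M where
  toFun x := tmul 1 x
  map_zero' := TensorProduct.tmul_zero _ _
  map_add' _ _ := TensorProduct.tmul_add _ _ _

theorem j_smul (a : A) (x : M) : j k A m (a • x) = d₁ k m a • j k A m x := by
  change tmul 1 (a • x) = d₁ k m a • tmul 1 x
  rw [tmul_smul, smul_tmul, mul_comm]

theorem tmul_induction {motive : PPTensor k A m M → Prop} (t : PPTensor k A m M)
    (zero : motive 0) (tmul : ∀ p x, motive (tmul p x))
    (add : ∀ s t, motive s → motive t → motive (s + t)) : motive t :=
  TensorProduct.induction_on t zero tmul add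

theorem zero_tmul (x : M) : tmul (0 : PrincipalParts k A m) x = 0 :=
  TensorProduct.zero_tmul _ _

theorem add_tmul (p q : PrincipalParts k A m) (x : M) :
    tmul (p + q) x = tmul p x + tmul q x :=
  TensorProduct.add_tmul _ _ _

theorem tmul_eq (a b : A) (x : M) :
    tmul (d₀ k m a * d₁ k m b) x = a • j k A m (b • x) := by
  change _ = d₀ k m a • tmul 1 (b • x)
  rw [tmul_smul, one_mul, smul_tmul]

theorem induction_on {motive : PPTensor k A m M → Prop} (t : PPTensor k A m M)
    (smul : ∀ (a : A) (x : M), motive (a • j k A m x))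
    (add : ∀ s t, motive s → motive t → motive (s + t)) : motive t := by
  have zero : motive 0 := by
    have h := smul (0 : A) (0 : M)
    rwa [zero_smul] at h
  induction t using tmul_induction with
  | zero => exact zero
  | tmul p x =>
    refine PrincipalParts.induction_on k (motive := fun p ↦ motive (tmul p x)) p ?_ ?_ ?_
    · rw [zero_tmul]; exact zero
    · intro a b
      rw [tmul_eq]
      exact smul a _
    · intro p q hp hq
      rw [add_tmul]
      exact add _ _ hp hq
  | add s t hs ht => exact add s t hs ht

/-- Additive maps out of `𝒫ᵐ ⊗ M` agree when they agree on the `a • (1 ⊗ x)`. -/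
theorem addHom_ext {f g : PPTensor k A m M →+ W}
    (h : ∀ (a : A) (x : M), f (a • j k A m x) = g (a • j k A m x)) : f = g := by
  ext t
  induction t using induction_on with
  | smul a x => exact h a x
  | add s t hs ht => rw [map_add, map_add, hs, ht]

/-- The additive map `p ⊗ x ↦ g p • h x`. -/
noncomputable def lift {S : Type u} [CommRing S] [Module S W]
    (g : PrincipalParts k A m →+* S) (h : M →+ W)
    (hh : ∀ (a : A) (x : M), h (a • x) = g (d₁ k m a) • h x) : PPTensor k A m M →+ W :=
  TensorProduct.liftAddHom
    (AddMonoidHom.mk' (fun p ↦ AddMonoidHom.mk' (fun x ↦ g p • h x) fun _ _ ↦ by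
      rw [map_add, smul_add]) fun p q ↦ by
        ext x
        change g (p + q) • h x = g p • h x + g q • h x
        rw [map_add, add_smul])
    (fun a p x ↦ by
      change g (a • p) • h x = g p • h (a • x)
      rw [PrincipalParts.smul_def, map_mul, hh, mul_smul])

theorem lift_tmul {S : Type u} [CommRing S] [Module S W]
    (g : PrincipalParts k A m →+* S) (h : M →+ W)
    (hh : ∀ (a : A) (x : M), h (a • x) = g (d₁ k m a) • h x) (p : PrincipalParts k A m) (x : M) :
    lift g h hh (tmul p x) = g p • h x := rfl

theorem lift_smul {S : Type u} [CommRing S] [Module S W]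
    (g : PrincipalParts k A m →+* S) (h : M →+ W)
    (hh : ∀ (a : A) (x : M), h (a • x) = g (d₁ k m a) • h x) (a : A) (t : PPTensor k A m M) :
    lift g h hh (a • t) = g (d₀ k m a) • lift g h hh t := by
  induction t using tmul_induction with
  | zero => rw [smul_zero, map_zero, smul_zero]
  | tmul p x => rw [smul_def, smul_tmul, lift_tmul, lift_tmul, map_mul, mul_smul]
  | add s t hs ht => rw [smul_add, map_add, map_add, smul_add, hs, ht]

@[simp]
theorem lift_j {S : Type u} [CommRing S] [Module S W]
    (g : PrincipalParts k A m →+* S) (h : M →+ W)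
    (hh : ∀ (a : A) (x : M), h (a • x) = g (d₁ k m a) • h x) (x : M) :
    lift g h hh (j k A m x) = h x := by
  change lift g h hh (tmul 1 x) = _
  rw [lift_tmul, map_one, one_smul]

/-- Linear maps out of `𝒫ᵐ ⊗ M` agree when they agree on the `1 ⊗ x`. -/
theorem linearMap_ext [Module A W] {f g : PPTensor k A m M →ₗ[A] W}
    (h : ∀ x : M, f (j k A m x) = g (j k A m x)) : f = g := by
  ext t
  induction t using induction_on with
  | smul a x => rw [map_smul, map_smul, h]
  | add s t hs ht => rw [map_add, map_add, hs, ht]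

theorem map_aux (f : M →ₗ[A] N) (a : A) (x : M) :
    ((j k A m).comp f.toAddMonoidHom) (a • x) =
      (RingHom.id (PrincipalParts k A m)) (d₁ k m a) • ((j k A m).comp f.toAddMonoidHom) x := by
  change j k A m (f (a • x)) = _
  rw [map_smul, j_smul]
  rfl

variable (k m) in
/-- `id ⊗ f`. -/
noncomputable def map (f : M →ₗ[A] N) : PPTensor k A m M →ₗ[A] PPTensor k A m N where
  __ := lift (RingHom.id (PrincipalParts k A m)) ((j k A m).comp f.toAddMonoidHom) (map_aux f)
  map_smul' a t := lift_smul _ _ _ a t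

@[simp]
theorem map_j (f : M →ₗ[A] N) (x : M) : map k m f (j k A m x) = j k A m (f x) :=
  lift_j _ _ (map_aux f) x

theorem trans_aux {m r : ℕ} (h : m ≤ r) (a : A) (x : M) :
    j k A m (a • x) = (PrincipalParts.trans k h) (d₁ k r a) • j k A m x := by
  rw [j_smul, trans_d₁]

variable (k M) in
/-- `q ⊗ id`, for the transition map `q` of the principal parts. -/
noncomputable def trans {m r : ℕ} (h : m ≤ r) : PPTensor k A r M →ₗ[A] PPTensor k A m M where
  __ := lift (PrincipalParts.trans k h) (j k A m) (trans_aux h)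
  map_smul' a t := (lift_smul _ _ _ a t).trans (by rw [trans_d₀]; rfl)

@[simp]
theorem trans_j {m r : ℕ} (h : m ≤ r) (x : M) :
    trans k M h (j k A r x) = j k A m x :=
  lift_j _ _ (trans_aux h) x

theorem aug_aux (a : A) (x : M) : (AddMonoidHom.id M) (a • x) =
    (PrincipalParts.aug k m) (d₁ k m a) • (AddMonoidHom.id M) x := by
  rw [aug_d₁]
  rfl

variable (k m M) in
/-- `q ⊗ id`, for the augmentation `q` of the principal parts. -/
noncomputable def aug : PPTensor k A m M →ₗ[A] M where
  __ := lift (PrincipalParts.aug k m) (AddMonoidHom.id M) aug_aux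
  map_smul' a t := (lift_smul _ _ _ a t).trans (by rw [aug_d₀]; rfl)

@[simp]
theorem aug_j (x : M) : aug k m M (j k A m x) = x :=
  lift_j _ _ aug_aux x

theorem res_aux {M' : Type u} [AddCommGroup M'] [Module B M'] (φ : A →+* B)
    (hφ : ∀ c : k, φ (algebraMap k A c) = algebraMap k B c) (ρ : M →ₛₗ[φ] M') (a : A) (x : M) :
    ((j k B m).comp ρ.toAddMonoidHom) (a • x) =
      (PrincipalParts.map m φ hφ) (d₁ k m a) • ((j k B m).comp ρ.toAddMonoidHom) x := by
  change j k B m (ρ (a • x)) = _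
  rw [map_smulₛₗ, j_smul, map_d₁]
  rfl

variable (m) in
/-- Restriction maps of `𝒫ᵐ ⊗ M` along a homomorphism of algebras `φ : A → B`
and a `φ`-semilinear map. -/
noncomputable def res {M' : Type u} [AddCommGroup M'] [Module B M'] (φ : A →+* B)
    (hφ : ∀ c : k, φ (algebraMap k A c) = algebraMap k B c) (ρ : M →ₛₗ[φ] M') :
    PPTensor k A m M →ₛₗ[φ] PPTensor k B m M' where
  __ := lift (PrincipalParts.map m φ hφ) ((j k B m).comp ρ.toAddMonoidHom) (res_aux φ hφ ρ)
  map_smul' a t := (lift_smul _ _ _ a t).trans (by rw [map_d₀]; rfl)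

@[simp]
theorem res_j {M' : Type u} [AddCommGroup M'] [Module B M'] (φ : A →+* B)
    (hφ : ∀ c : k, φ (algebraMap k A c) = algebraMap k B c) (ρ : M →ₛₗ[φ] M') (x : M) :
    res m φ hφ ρ (j k A m x) = j k B m (ρ x) :=
  lift_j _ _ (res_aux φ hφ ρ) x

section Comul

/-- `PrincipalParts k A m` as an `A`-algebra through the left structure `d₀`. -/
def LeftPP (k A : Type u) [CommRing k] [CommRing A] [Algebra k A] (m : ℕ) : Type u :=
  PrincipalParts k A m

noncomputable instance (k A : Type u) [CommRing k] [CommRing A] [Algebra k A] (m : ℕ) :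
    CommRing (LeftPP k A m) :=
  inferInstanceAs (CommRing (PrincipalParts k A m))

noncomputable instance (k A : Type u) [CommRing k] [CommRing A] [Algebra k A] (m : ℕ) :
    Algebra A (LeftPP k A m) :=
  (PrincipalParts.d₀ k m).toAlgebra

/-- The ring `𝒫ᵐ ⊗_A 𝒫ⁿ`, formed with the right structure of the first
and the left structure of the second factor. -/
abbrev PPProd (k A : Type u) [CommRing k] [CommRing A] [Algebra k A] (m n : ℕ) : Type u :=
  PrincipalParts k A m ⊗[A] LeftPP k A n

noncomputable instance leftModule (n : ℕ) : Module (LeftPP k A n) (PPTensor k A n M) :=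
  inferInstanceAs (Module (PrincipalParts k A n) (PPTensor k A n M))

instance leftTower (n : ℕ) : IsScalarTower A (LeftPP k A n) (PPTensor k A n M) where
  smul_assoc a p t := by
    rw [Algebra.smul_def, mul_smul]
    rfl

/-- The action of the second factor on `𝒫ᵐ ⊗ (𝒫ⁿ ⊗ M)`. -/
noncomputable instance innerModule (m n : ℕ) :
    Module (LeftPP k A n) (PrincipalParts k A m ⊗[A] PPTensor k A n M) :=
  Module.compHom _ (((Module.End.lTensorAlgHom A (PPTensor k A n M)
    (PrincipalParts k A m)).comp (Algebra.lsmul A A (PPTensor k A n M))).toRingHom :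
      LeftPP k A n →+* Module.End A (PrincipalParts k A m ⊗[A] PPTensor k A n M))

theorem inner_smul_tmul (m n : ℕ) (q : LeftPP k A n) (p : PrincipalParts k A m)
    (y : PPTensor k A n M) : q • (p ⊗ₜ[A] y) = p ⊗ₜ[A] (q • y) := rfl

instance innerTower (m n : ℕ) :
    IsScalarTower A (LeftPP k A n) (PrincipalParts k A m ⊗[A] PPTensor k A n M) where
  smul_assoc a q t := by
    induction t using TensorProduct.induction_on with
    | zero => rw [smul_zero, smul_zero, smul_zero]
    | tmul p y => rw [inner_smul_tmul, inner_smul_tmul, smul_assoc, TensorProduct.tmul_smul]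
    | add s t hs ht => rw [smul_add, smul_add, smul_add, hs, ht]

instance innerComm (m n : ℕ) : SMulCommClass (PrincipalParts k A m) (LeftPP k A n)
    (PrincipalParts k A m ⊗[A] PPTensor k A n M) where
  smul_comm p q t := by
    induction t using TensorProduct.induction_on with
    | zero => simp only [smul_zero]
    | tmul p' y => rfl
    | add s t hs ht => rw [smul_add, smul_add, smul_add, smul_add, hs, ht]

/-- `𝒫ᵐ ⊗ (𝒫ⁿ ⊗ M)` as a module over the ring `𝒫ᵐ ⊗ 𝒫ⁿ`. -/
noncomputable instance prodModule (m n : ℕ) :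
    Module (PPProd k A m n) (PrincipalParts k A m ⊗[A] PPTensor k A n M) :=
  TensorProduct.Algebra.module

theorem prod_smul (m n : ℕ) (p : PrincipalParts k A m) (q : LeftPP k A n)
    (t : PrincipalParts k A m ⊗[A] PPTensor k A n M) :
    (p ⊗ₜ[A] q : PPProd k A m n) • t = p • q • t :=
  TensorProduct.Algebra.smul_def p q t

variable (k A) in
/-- `p ↦ p ⊗ 1`. -/
noncomputable def inl (m n : ℕ) : PrincipalParts k A m →+* PPProd k A m n :=
  (Algebra.TensorProduct.includeLeft : PrincipalParts k A m →ₐ[A] PPProd k A m n).toRingHom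

variable (k A) in
/-- `p ↦ 1 ⊗ p`. -/
noncomputable def inr (m n : ℕ) : PrincipalParts k A n →+* PPProd k A m n :=
  (Algebra.TensorProduct.includeRight : LeftPP k A n →ₐ[A] PPProd k A m n).toRingHom

theorem inl_d₁ (m n : ℕ) (a : A) : inl k A m n (d₁ k m a) = inr k A m n (d₀ k n a) :=
  ((Algebra.TensorProduct.includeLeft : PrincipalParts k A m →ₐ[A] PPProd k A m n).commutes a).trans
    ((Algebra.TensorProduct.includeRight : LeftPP k A n →ₐ[A] PPProd k A m n).commutes a).symm

theorem inl_smul (m n : ℕ) (p : PrincipalParts k A m)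
    (t : PrincipalParts k A m ⊗[A] PPTensor k A n M) : inl k A m n p • t = p • t :=
  (prod_smul m n p 1 t).trans (by rw [one_smul])

theorem inr_smul (m n : ℕ) (q : PrincipalParts k A n) (p : PrincipalParts k A m)
    (y : PPTensor k A n M) : inr k A m n q • (p ⊗ₜ[A] y) = p ⊗ₜ[A] (q • y) :=
  (prod_smul m n 1 q (p ⊗ₜ[A] y)).trans (by rw [one_smul]; rfl)

variable (k A) in
/-- The comultiplication `a ⊗ b ↦ (a ⊗ 1) ⊗ (1 ⊗ b)` from the principal parts of order `r`
to `𝒫ᵐ ⊗_A 𝒫ⁿ`, for `m + n ≤ r`. -/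
noncomputable def comulRing {m n r : ℕ} (h : m + n ≤ r) :
    PrincipalParts k A r →+* PPProd k A m n :=
  PrincipalParts.glue k h (inl k A m n) (inr k A m n) (inl_d₁ m n)

@[simp]
theorem comulRing_d₀ {m n r : ℕ} (h : m + n ≤ r) (a : A) :
    comulRing k A h (d₀ k r a) = inl k A m n (d₀ k m a) := PrincipalParts.glue_d₀ ..

@[simp]
theorem comulRing_d₁ {m n r : ℕ} (h : m + n ≤ r) (a : A) :
    comulRing k A h (d₁ k r a) = inr k A m n (d₁ k n a) := PrincipalParts.glue_d₁ ..

variable (k M) in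
/-- The comultiplication as an additive map. -/
noncomputable def comulAux {m n r : ℕ} (h : m + n ≤ r) :
    PPTensor k A r M →+ PrincipalParts k A m ⊗[A] PPTensor k A n M :=
  lift (comulRing k A h) ((show PPTensor k A n M →+ PrincipalParts k A m ⊗[A] PPTensor k A n M
    from j k A m).comp (j k A n)) (fun a x ↦ by
    rw [comulRing_d₁]
    change (1 : PrincipalParts k A m) ⊗ₜ[A] j k A n (a • x) =
      inr k A m n (d₁ k n a) • ((1 : PrincipalParts k A m) ⊗ₜ[A] j k A n x)
    rw [inr_smul, j_smul])

theorem comulAux_smul {m n r : ℕ} (h : m + n ≤ r) (a : A) (t : PPTensor k A r M) :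
    comulAux k M h (a • t) = d₀ k m a • comulAux k M h t :=
  (lift_smul _ _ _ a t).trans (by rw [comulRing_d₀, inl_smul]; rfl)

theorem comulAux_j {m n r : ℕ} (h : m + n ≤ r) (x : M) :
    comulAux k M h (j k A r x) = (1 : PrincipalParts k A m) ⊗ₜ[A] j k A n x :=
  lift_j _ _ _ x

variable (k M) in
/-- The comultiplication `δ ⊗ id : 𝒫ʳ ⊗ M → 𝒫ᵐ ⊗ (𝒫ⁿ ⊗ M)` for `m + n ≤ r`,
given by `(a ⊗ b) ⊗ x ↦ (a ⊗ 1) ⊗ ((1 ⊗ b) ⊗ x)`. -/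
noncomputable def comul {m n r : ℕ} (h : m + n ≤ r) :
    PPTensor k A r M →ₗ[A] PPTensor k A m (PPTensor k A n M) where
  toFun t := comulAux k M h t
  map_add' := map_add (comulAux k M h)
  map_smul' := comulAux_smul h

@[simp]
theorem comul_j {m n r : ℕ} (h : m + n ≤ r) (x : M) :
    comul k M h (j k A r x) = j k A m (j k A n x) :=
  comulAux_j h x

end Comul

end PPTensor

end Algebra

section Presheaf

/-- The presheaf of commutative rings `O` is a presheaf of `k`-algebras. -/
class AlgPresheaf (k : Type u) [CommRing k] {C : Type u'} [Category.{v'} C]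
    (O : Cᵒᵖ ⥤ CommRingCat.{u}) [∀ U, Algebra k (O.obj U)] : Prop where
  map_algebraMap {U V : Cᵒᵖ} (f : U ⟶ V) (c : k) :
    (O.map f).hom (algebraMap k (O.obj U) c) = algebraMap k (O.obj V) c

variable (k : Type u) [CommRing k] {C : Type u'} [Category.{v'} C]
  (O : Cᵒᵖ ⥤ CommRingCat.{u}) [∀ U, Algebra k (O.obj U)] [AlgPresheaf k O]

/-- Presheaves of modules over a presheaf of commutative rings. -/
abbrev PMod : Type _ := PresheafOfModules.{u} (O ⋙ forget₂ CommRingCat.{u} RingCat.{u})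

namespace PMod

variable {O}

/-- The restriction maps as semilinear maps. -/
noncomputable def rho (M : PMod O) {U V : Cᵒᵖ} (f : U ⟶ V) :
    M.obj U →ₛₗ[(O.map f).hom] M.obj V where
  toFun x := M.map f x
  map_add' := map_add (M.map f).hom
  map_smul' r x := M.map_smul f r x

theorem rho_id (M : PMod O) (U : Cᵒᵖ) (x : M.obj U) : rho M (𝟙 U) x = x := by
  change M.map (𝟙 U) x = x
  rw [M.map_id]
  rfl

theorem rho_comp (M : PMod O) {U V W : Cᵒᵖ} (f : U ⟶ V) (g : V ⟶ W) (x : M.obj U) :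
    rho M (f ≫ g) x = rho M g (rho M f x) :=
  M.map_comp_apply f g x

/-- The components of a morphism as linear maps. -/
noncomputable def lin {M N : PMod O} (φ : M ⟶ N) (U : Cᵒᵖ) : M.obj U →ₗ[O.obj U] N.obj U where
  toFun x := φ.app U x
  map_add' := map_add (φ.app U).hom
  map_smul' r x := (φ.app U).hom.map_smul r x

theorem lin_rho {M N : PMod O} (φ : M ⟶ N) {U V : Cᵒᵖ} (f : U ⟶ V) (x : M.obj U) :
    lin φ V (rho M f x) = rho N f (lin φ U x) :=
  PresheafOfModules.naturality_apply φ f x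

theorem hom_ext {M N : PMod O} {φ ψ : M ⟶ N} (h : ∀ U, lin φ U = lin ψ U) : φ = ψ := by
  ext U x
  exact LinearMap.congr_fun (h U) x

/-- Construct a presheaf of modules from modules and semilinear restriction maps. -/
noncomputable def ofRho (M : Cᵒᵖ → Type u) [∀ U, AddCommGroup (M U)] [iM : ∀ U, Module (O.obj U) (M U)]
    (ρ : ∀ {U V : Cᵒᵖ} (f : U ⟶ V), M U →ₛₗ[(O.map f).hom] M V)
    (ρ_id : ∀ U x, ρ (𝟙 U) x = x)
    (ρ_comp : ∀ {U V W : Cᵒᵖ} (f : U ⟶ V) (g : V ⟶ W) (x : M U), ρ (f ≫ g) x = ρ g (ρ f x)) :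
    PMod O :=
  @PresheafOfModules.ofPresheaf C _ (O ⋙ forget₂ CommRingCat.{u} RingCat.{u})
    { obj := fun U ↦ AddCommGrpCat.of (M U)
      map := fun f ↦ AddCommGrpCat.ofHom (ρ f).toAddMonoidHom
      map_id := fun U ↦ by ext x; exact ρ_id U x
      map_comp := fun f g ↦ by ext x; exact ρ_comp f g x }
    (fun U ↦ iM U) (fun _ _ f r x ↦ map_smulₛₗ (ρ f) r x)

/-- Construct a morphism from linear maps compatible with the restriction maps. -/
noncomputable def homOfLin {M N : PMod O} (φ : ∀ U, M.obj U →ₗ[O.obj U] N.obj U)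
    (h : ∀ {U V : Cᵒᵖ} (f : U ⟶ V) (x : M.obj U), φ V (rho M f x) = rho N f (φ U x)) : M ⟶ N where
  app U := ModuleCat.ofHom (X := M.obj U) (Y := N.obj U)
    (show M.obj U →ₗ[(O ⋙ forget₂ CommRingCat.{u} RingCat.{u}).obj U] N.obj U from
      { toFun := φ U, map_add' := (φ U).map_add', map_smul' := (φ U).map_smul' })
  naturality f := by
    ext x
    exact h f x

theorem lin_homOfLin {M N : PMod O} (φ : ∀ U, M.obj U →ₗ[O.obj U] N.obj U)
    (h : ∀ {U V : Cᵒᵖ} (f : U ⟶ V) (x : M.obj U), φ V (rho M f x) = rho N f (φ U x)) (U : Cᵒᵖ) :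
    lin (homOfLin φ h) U = φ U := rfl

theorem lin_id (M : PMod O) (U : Cᵒᵖ) (x : M.obj U) : lin (𝟙 M) U x = x := rfl

theorem lin_comp {M N P : PMod O} (f : M ⟶ N) (g : N ⟶ P) (U : Cᵒᵖ) (x : M.obj U) :
    lin (f ≫ g) U x = lin g U (lin f U x) := rfl

end PMod

open PMod PPTensor

variable {O}

/-- The presheaf of modules `U ↦ 𝒫ᵐ(O(U)) ⊗_{O(U)} M(U)`. -/
noncomputable def ppObj (m : ℕ) (M : PMod O) : PMod O :=
  ofRho (fun U ↦ PPTensor k (O.obj U) m (M.obj U))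
    (fun {U V} f ↦ PPTensor.res m (O.map f).hom (AlgPresheaf.map_algebraMap f) (rho M f))
    (fun U t ↦ by
      induction t using PPTensor.induction_on with
      | smul a x =>
        rw [map_smulₛₗ, res_j, rho_id]
        congr 1
        rw [O.map_id]
        rfl
      | add s t hs ht => rw [map_add, hs, ht])
    (fun {U V W} f g t ↦ by
      induction t using PPTensor.induction_on with
      | smul a x =>
        rw [map_smulₛₗ, res_j, rho_comp, map_smulₛₗ, map_smulₛₗ, res_j, res_j]
        congr 1
        rw [O.map_comp]
        rfl
      | add s t hs ht => rw [map_add, map_add, map_add, hs, ht])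

variable (O) in
/-- The sections `1 ⊗ x`. -/
noncomputable def jj (m : ℕ) (M : PMod O) (U : Cᵒᵖ) : M.obj U →+ (ppObj k m M).obj U :=
  j k (O.obj U) m

variable {k}

theorem rho_jj {m : ℕ} {M : PMod O} {U V : Cᵒᵖ} (f : U ⟶ V) (x : M.obj U) :
    rho (ppObj k m M) f (jj k O m M U x) = jj k O m M V (rho M f x) :=
  res_j (O.map f).hom (AlgPresheaf.map_algebraMap f) (rho M f) x

theorem jj_induction {m : ℕ} {M : PMod O} {U : Cᵒᵖ} {motive : (ppObj k m M).obj U → Prop}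
    (t : (ppObj k m M).obj U)
    (smul : ∀ (a : O.obj U) (x : M.obj U), motive (a • jj k O m M U x))
    (add : ∀ s t, motive s → motive t → motive (s + t)) : motive t :=
  PPTensor.induction_on (k := k) (A := O.obj U) (m := m) (M := M.obj U) t smul add

/-- Morphisms out of `𝒫ᵐ ⊗ M` from linear maps compatible with restriction on the `1 ⊗ x`. -/
noncomputable def ppDesc {m : ℕ} {M N : PMod O}
    (φ : ∀ U, (ppObj k m M).obj U →ₗ[O.obj U] N.obj U)
    (h : ∀ {U V : Cᵒᵖ} (f : U ⟶ V) (x : M.obj U),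
      φ V (jj k O m M V (rho M f x)) = rho N f (φ U (jj k O m M U x))) :
    ppObj k m M ⟶ N :=
  homOfLin φ (fun {U V} f t ↦ by
    induction t using jj_induction with
    | smul a x => rw [map_smulₛₗ (rho (ppObj k m M) f), (φ U).map_smul, map_smulₛₗ (rho N f), rho_jj,
        (φ V).map_smul, h]
    | add s t hs ht => rw [map_add, map_add, map_add, map_add, hs, ht])

theorem pp_hom_ext {m : ℕ} {M N : PMod O} {φ ψ : ppObj k m M ⟶ N}
    (h : ∀ U (x : M.obj U), lin φ U (jj k O m M U x) = lin ψ U (jj k O m M U x)) : φ = ψ :=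
  PMod.hom_ext fun U ↦
    PPTensor.linearMap_ext (k := k) (A := O.obj U) (m := m) (M := M.obj U) (h U)

variable (k)

/-- The morphism `id ⊗ φ`. -/
noncomputable def ppMap (m : ℕ) {M N : PMod O} (φ : M ⟶ N) : ppObj k m M ⟶ ppObj k m N :=
  ppDesc (fun U ↦ PPTensor.map k m (lin φ U)) (fun f x ↦
    (map_j (lin φ _) (rho M f x)).trans (((congrArg (j k (O.obj _) m) (lin_rho φ f x)).trans
      (rho_jj f (lin φ _ x)).symm).trans
        (congrArg (rho (ppObj k m N) f) (map_j (k := k) (m := m) (lin φ _) x).symm)))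

theorem lin_ppMap (m : ℕ) {M N : PMod O} (φ : M ⟶ N) (U : Cᵒᵖ) (x : M.obj U) :
    lin (ppMap k m φ) U (jj k O m M U x) = jj k O m N U (lin φ U x) :=
  map_j _ _

/-- The transition map `q ⊗ id : 𝒫ʳ ⊗ M ⟶ 𝒫ᵐ ⊗ M` for `m ≤ r`. -/
noncomputable def ppTrans {m r : ℕ} (h : m ≤ r) (M : PMod O) : ppObj k r M ⟶ ppObj k m M :=
  ppDesc (fun U ↦ PPTensor.trans k (M.obj U) h) (fun f x ↦
    (trans_j h (rho M f x)).trans ((rho_jj f x).symm.trans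
      (congrArg (rho (ppObj k m M) f) (trans_j (k := k) h x).symm)))

theorem lin_ppTrans {m r : ℕ} (h : m ≤ r) (M : PMod O) (U : Cᵒᵖ) (x : M.obj U) :
    lin (ppTrans k h M) U (jj k O r M U x) = jj k O m M U x :=
  trans_j _ _

/-- The augmentation `𝒫ᵐ ⊗ M ⟶ M`. -/
noncomputable def ppAug (m : ℕ) (M : PMod O) : ppObj k m M ⟶ M :=
  ppDesc (fun U ↦ PPTensor.aug k m (M.obj U)) (fun f x ↦
    (aug_j (rho M f x)).trans (congrArg (rho M f) (aug_j (k := k) (m := m) x).symm))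

theorem lin_ppAug (m : ℕ) (M : PMod O) (U : Cᵒᵖ) (x : M.obj U) :
    lin (ppAug k m M) U (jj k O m M U x) = x :=
  aug_j _

/-- The comultiplication `δ ⊗ id : 𝒫ʳ ⊗ M ⟶ 𝒫ᵐ ⊗ (𝒫ⁿ ⊗ M)` for `m + n ≤ r`. -/
noncomputable def ppComul {m n r : ℕ} (h : m + n ≤ r) (M : PMod O) :
    ppObj k r M ⟶ ppObj k m (ppObj k n M) :=
  ppDesc (fun U ↦ PPTensor.comul k (M.obj U) h) (fun f x ↦
    (comul_j h (rho M f x)).trans (((congrArg (jj k O m (ppObj k n M) _) (rho_jj f x).symm).trans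
      (rho_jj f (jj k O n M _ x)).symm).trans
        (congrArg (rho (ppObj k m (ppObj k n M)) f) (comul_j (k := k) h x).symm)))

theorem lin_ppComul {m n r : ℕ} (h : m + n ≤ r) (M : PMod O) (U : Cᵒᵖ) (x : M.obj U) :
    lin (ppComul k h M) U (jj k O r M U x) = jj k O m (ppObj k n M) U (jj k O n M U x) :=
  comul_j _ _

end Presheaf

/-- A pro-object of `C`: a small filtering projective system in `C`. -/
structure Pro (C : Type u) [Category.{v} C] where
  /-- The index category. -/
  I : Type v
  [cat : SmallCategory I]
  [cofiltered : IsCofiltered I]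
  /-- The projective system. -/
  F : I ⥤ C

namespace Pro

attribute [instance] Pro.cat Pro.cofiltered

variable {C : Type u} [Category.{v} C] {D : Type u'} [Category.{v} D]

/-- Two morphisms `X.F i ⟶ c`, `X.F i' ⟶ c` are identified when they agree on some common
refinement `i''`. -/
def germSetoid (X : Pro C) (c : C) : Setoid (Σ i : X.I, (X.F.obj i ⟶ c)) where
  r s t := ∃ (i : X.I) (a : i ⟶ s.1) (b : i ⟶ t.1), X.F.map a ≫ s.2 = X.F.map b ≫ t.2
  iseqv :=
    { refl := fun s ↦ ⟨s.1, 𝟙 _, 𝟙 _, rfl⟩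
      symm := fun ⟨i, a, b, h⟩ ↦ ⟨i, b, a, h.symm⟩
      trans := by
        rintro s t r ⟨i, a, b, h⟩ ⟨i', a', b', h'⟩
        obtain ⟨z, p, q, e⟩ := IsCofiltered.cospan b a'
        refine ⟨z, p ≫ a, q ≫ b', ?_⟩
        rw [CategoryTheory.Functor.map_comp, Category.assoc, h, ← Category.assoc, ← CategoryTheory.Functor.map_comp, e,
          CategoryTheory.Functor.map_comp, Category.assoc, h', ← Category.assoc, ← CategoryTheory.Functor.map_comp] }

/-- The filtered colimit of the sets `X.F i ⟶ c` over the indices `i` of `X`. -/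
def Germ (X : Pro C) (c : C) : Type v := Quotient (germSetoid X c)

/-- The class of a morphism `X.F i ⟶ c`. -/
def germ (X : Pro C) {c : C} (i : X.I) (f : X.F.obj i ⟶ c) : Germ X c :=
  Quotient.mk (germSetoid X c) ⟨i, f⟩

theorem germ_eq {X : Pro C} {c : C} {i i' : X.I} {f : X.F.obj i ⟶ c} {f' : X.F.obj i' ⟶ c}
    (z : X.I) (a : z ⟶ i) (b : z ⟶ i') (h : X.F.map a ≫ f = X.F.map b ≫ f') :
    germ X i f = germ X i' f' :=
  Quotient.sound ⟨z, a, b, h⟩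

theorem germ_map {X : Pro C} {c : C} {i i' : X.I} (a : i' ⟶ i) (f : X.F.obj i ⟶ c) :
    germ X i' (X.F.map a ≫ f) = germ X i f :=
  germ_eq i' (𝟙 _) a (by rw [X.F.map_id, Category.id_comp])

theorem germ_ind {X : Pro C} {c : C} {motive : Germ X c → Prop}
    (h : ∀ i f, motive (germ X i f)) (s : Germ X c) : motive s :=
  Quotient.ind (fun ⟨i, f⟩ ↦ h i f) s

/-- Postcomposition. -/
def Germ.post {X : Pro C} {c d : C} (s : Germ X c) (g : c ⟶ d) : Germ X d :=
  Quotient.map (fun t ↦ ⟨t.1, t.2 ≫ g⟩) (by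
    rintro s t ⟨i, a, b, h⟩
    exact ⟨i, a, b, by
      change X.F.map a ≫ s.2 ≫ g = X.F.map b ≫ t.2 ≫ g
      rw [← Category.assoc, h, Category.assoc]⟩) s

theorem post_germ {X : Pro C} {c d : C} (i : X.I) (f : X.F.obj i ⟶ c) (g : c ⟶ d) :
    (germ X i f).post g = germ X i (f ≫ g) := rfl

theorem post_id {X : Pro C} {c : C} (s : Germ X c) : s.post (𝟙 c) = s := by
  induction s using germ_ind with
  | h i f => rw [post_germ, Category.comp_id]

theorem post_post {X : Pro C} {c d e : C} (s : Germ X c) (g : c ⟶ d) (g' : d ⟶ e) :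
    (s.post g).post g' = s.post (g ≫ g') := by
  induction s using germ_ind with
  | h i f => rw [post_germ, post_germ, post_germ, Category.assoc]

/-- A morphism of pro-objects: an element of `lim_j colim_i (X.F i ⟶ Y.F j)`. -/
@[ext]
structure Hom (X Y : Pro C) where
  /-- The components. -/
  app (j : Y.I) : Germ X (Y.F.obj j)
  compat {j j' : Y.I} (u : j ⟶ j') : (app j).post (Y.F.map u) = app j'

/-- Precomposition of germs with a morphism of pro-objects. -/
def Germ.pre {X Y : Pro C} (φ : Hom X Y) {c : C} (s : Germ Y c) : Germ X c :=
  Quotient.lift (fun t : Σ j : Y.I, (Y.F.obj j ⟶ c) ↦ (φ.app t.1).post t.2) (by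
    rintro s t ⟨j, a, b, h⟩
    rw [← φ.compat a, ← φ.compat b, post_post, post_post, h]) s

theorem pre_germ {X Y : Pro C} (φ : Hom X Y) {c : C} (j : Y.I) (g : Y.F.obj j ⟶ c) :
    (germ Y j g).pre φ = (φ.app j).post g := rfl

theorem pre_post {X Y : Pro C} (φ : Hom X Y) {c d : C} (s : Germ Y c) (g : c ⟶ d) :
    (s.post g).pre φ = (s.pre φ).post g := by
  induction s using germ_ind with
  | h i f => rw [post_germ, pre_germ, pre_germ, post_post]

/-- The identity. -/
def Hom.id (X : Pro C) : Hom X X where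
  app i := germ X i (𝟙 _)
  compat u := by
    rw [post_germ, Category.id_comp, ← germ_map u (𝟙 _), Category.comp_id]

/-- Composition of morphisms of pro-objects. -/
def Hom.comp {X Y Z : Pro C} (φ : Hom X Y) (ψ : Hom Y Z) : Hom X Z where
  app l := (ψ.app l).pre φ
  compat u := by rw [← pre_post, ψ.compat]

theorem pre_id {X : Pro C} {c : C} (s : Germ X c) : s.pre (Hom.id X) = s := by
  induction s using germ_ind with
  | h i f =>
    change (germ X i (𝟙 _)).post f = _
    rw [post_germ, Category.id_comp]

theorem pre_comp {X Y Z : Pro C} (φ : Hom X Y) (ψ : Hom Y Z) {c : C} (s : Germ Z c) :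
    s.pre (φ.comp ψ) = (s.pre ψ).pre φ := by
  induction s using germ_ind with
  | h i f =>
    rw [pre_germ, pre_germ, pre_post]
    rfl

/-- The category `Pro(C)`. -/
instance : Category.{v} (Pro C) where
  Hom := Hom
  id := Hom.id
  comp := Hom.comp
  id_comp φ := Hom.ext (funext fun j ↦ pre_id _)
  comp_id φ := Hom.ext (funext fun j ↦ by
    change (germ _ j (𝟙 _)).pre φ = _
    rw [pre_germ, post_id])
  assoc φ ψ χ := Hom.ext (funext fun j ↦ pre_comp φ ψ (χ.app j))

theorem hom_ext {X Y : Pro C} {φ ψ : X ⟶ Y} (h : ∀ j, Hom.app φ j = Hom.app ψ j) : φ = ψ :=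
  Hom.ext (funext h)

theorem id_app (X : Pro C) (i : X.I) : Hom.app (𝟙 X) i = germ X i (𝟙 _) := rfl

theorem comp_app {X Y Z : Pro C} (φ : X ⟶ Y) (ψ : Y ⟶ Z) (l : Z.I) :
    Hom.app (φ ≫ ψ) l = (Hom.app ψ l).pre φ := rfl

/-- A morphism given by morphisms `X.F (σ j) ⟶ Y.F j` for indices `σ j`. -/
def homMk {X Y : Pro C} (σ : Y.I → X.I) (f : ∀ j, X.F.obj (σ j) ⟶ Y.F.obj j)
    (h : ∀ {j j' : Y.I} (u : j ⟶ j'), ∃ a : σ j ⟶ σ j', f j ≫ Y.F.map u = X.F.map a ≫ f j') :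
    X ⟶ Y where
  app j := germ X (σ j) (f j)
  compat u := by
    obtain ⟨a, e⟩ := h u
    rw [post_germ, e, germ_map]

theorem homMk_app {X Y : Pro C} (σ : Y.I → X.I) (f : ∀ j, X.F.obj (σ j) ⟶ Y.F.obj j)
    (h : ∀ {j j' : Y.I} (u : j ⟶ j'), ∃ a : σ j ⟶ σ j', f j ≫ Y.F.map u = X.F.map a ≫ f j')
    (j : Y.I) : Hom.app (homMk σ f h) j = germ X (σ j) (f j) := rfl

/-- Apply a functor `T : C ⥤ D` to a projective system. -/
abbrev mapObj (T : C ⥤ D) (X : Pro C) : Pro.{u', v} D where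
  I := X.I
  F := X.F ⋙ T

/-- Apply a functor to germs. -/
def Germ.map (T : C ⥤ D) {X : Pro C} {c : C} (s : Germ X c) : Germ (mapObj T X) (T.obj c) :=
  Quotient.map (fun t ↦ ⟨t.1, T.map t.2⟩) (by
    rintro s t ⟨i, a, b, h⟩
    refine ⟨i, a, b, ?_⟩
    change T.map (X.F.map a) ≫ T.map s.2 = T.map (X.F.map b) ≫ T.map t.2
    rw [← T.map_comp, h, T.map_comp]) s

theorem map_germ (T : C ⥤ D) {X : Pro C} {c : C} (i : X.I) (f : X.F.obj i ⟶ c) :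
    (germ X i f).map T = germ (mapObj T X) i (T.map f) := rfl

theorem map_post (T : C ⥤ D) {X : Pro C} {c d : C} (s : Germ X c) (g : c ⟶ d) :
    (s.map T).post (T.map g) = (s.post g).map T := by
  induction s using germ_ind with
  | h i f => rw [post_germ, map_germ, map_germ, post_germ, T.map_comp]

/-- Apply a functor to morphisms of pro-objects. -/
def mapHom (T : C ⥤ D) {X Y : Pro C} (φ : X ⟶ Y) : mapObj T X ⟶ mapObj T Y where
  app j := (Hom.app φ j).map T
  compat u := (map_post T _ _).trans (congrArg (Germ.map T) (Hom.compat φ u))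

theorem map_pre (T : C ⥤ D) {X Y : Pro C} (φ : X ⟶ Y) {c : C} (s : Germ Y c) :
    (s.map T).pre (mapHom T φ) = (s.pre φ).map T := by
  induction s using germ_ind with
  | h j g =>
    rw [pre_germ, map_germ, pre_germ]
    exact map_post T _ _

/-- The functor `Pro(C) ⥤ Pro(D)` induced by `T : C ⥤ D`, termwise on projective systems. -/
@[simps]
def map (T : C ⥤ D) : Pro C ⥤ Pro D where
  obj := mapObj T
  map := mapHom T
  map_id X := hom_ext fun j ↦
    congrArg (germ (mapObj T X) j) (T.map_id (X.F.obj j))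
  map_comp φ ψ := hom_ext fun l ↦ (map_pre T φ (Hom.app ψ l)).symm

end Pro

/-- A sequence of endofunctors with transition maps, a counit and comultiplications, subject to
the evident compatibilities; the structure carried by `(𝒫ᵐ ⊗ -)ₘ`, constructed below. -/
structure Tower (C : Type u) [Category.{v} C] where
  /-- The functors `𝒫ᵐ ⊗ -`. -/
  T : ℕ → C ⥤ C
  /-- The transition maps `𝒫ʳ → 𝒫ᵐ`. -/
  q {m r : ℕ} (h : m ≤ r) : T r ⟶ T m
  /-- The augmentation `𝒫⁰ → 𝒪`. -/
  ε : T 0 ⟶ 𝟭 C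
  /-- The comultiplications `𝒫ʳ → 𝒫ᵐ ⊗ 𝒫ⁿ`. -/
  δ {m n r : ℕ} (h : m + n ≤ r) : T r ⟶ T n ⋙ T m
  q_refl (m : ℕ) (F : C) : (q (le_refl m)).app F = 𝟙 _
  q_comp {l m r : ℕ} (h : l ≤ m) (h' : m ≤ r) (F : C) :
    (q h').app F ≫ (q h).app F = (q (h.trans h')).app F
  q_δ {m n r s : ℕ} (h : m + n ≤ r) (h' : r ≤ s) (F : C) :
    (q h').app F ≫ (δ h).app F = (δ (h.trans h')).app F
  δ_q {m n m' n' r : ℕ} (h : m + n ≤ r) (hm : m' ≤ m) (hn : n' ≤ n) (F : C) :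
    (δ h).app F ≫ (T m).map ((q hn).app F) ≫ (q hm).app ((T n').obj F) =
      (δ ((add_le_add hm hn).trans h)).app F
  δ_ε_left {n r : ℕ} (h : 0 + n ≤ r) (F : C) :
    (δ h).app F ≫ ε.app ((T n).obj F) = (q ((zero_add n).symm.trans_le h)).app F
  δ_ε_right {m r : ℕ} (h : m + 0 ≤ r) (F : C) :
    (δ h).app F ≫ (T m).map (ε.app F) = (q (m := m) h).app F
  coassoc {l m n s t r : ℕ} (h₁ : l + s ≤ r) (h₂ : m + n ≤ s) (h₃ : t + n ≤ r)
    (h₄ : l + m ≤ t) (F : C) :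
    (δ h₁).app F ≫ (T l).map ((δ h₂).app F) = (δ h₃).app F ≫ (δ h₄).app ((T n).obj F)

namespace Tower

open Pro

variable {C : Type u} [Category.{v} C] (t : Tower C)

/-- The pro-object `{Tₘ(Fᵢ)}`, indexed by the pairs `(m, i)`. -/
abbrev proObj (X : Pro C) : Pro C where
  I := ℕᵒᵖ × X.I
  F :=
    { obj := fun p ↦ (t.T p.1.unop).obj (X.F.obj p.2)
      map := fun u ↦ (t.q (leOfHom u.1.unop)).app _ ≫ (t.T _).map (X.F.map u.2)
      map_id := fun p ↦ by
        dsimp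
        rw [t.q_refl, CategoryTheory.Functor.map_id, CategoryTheory.Functor.map_id, Category.comp_id]
      map_comp := fun u v ↦ by
        dsimp
        rw [X.F.map_comp, CategoryTheory.Functor.map_comp, Category.assoc,
          NatTrans.naturality_assoc,
          ← t.q_comp (leOfHom v.1.unop) (leOfHom u.1.unop), Category.assoc] }

variable {t}

/-- Apply `Tₘ` to germs. -/
def germ (m : ℕ) {X : Pro C} {c : C} (s : Germ X c) : Germ (t.proObj X) ((t.T m).obj c) :=
  Quotient.map (fun p ↦ ⟨(op m, p.1), (t.T m).map p.2⟩) (by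
    rintro s s' ⟨i, a, b, h⟩
    refine ⟨(op m, i), (𝟙 _, a), (𝟙 _, b), ?_⟩
    dsimp
    rw [t.q_refl, Category.id_comp, Category.id_comp, ← CategoryTheory.Functor.map_comp, h,
      CategoryTheory.Functor.map_comp]) s

theorem germ_germ (m : ℕ) {X : Pro C} {c : C} (i : X.I) (f : X.F.obj i ⟶ c) :
    germ (t := t) m (Pro.germ X i f) = Pro.germ (t.proObj X) (op m, i) ((t.T m).map f) := rfl

theorem germ_post (m : ℕ) {X : Pro C} {c d : C} (s : Germ X c) (g : c ⟶ d) :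
    (germ (t := t) m s).post ((t.T m).map g) = germ m (s.post g) := by
  induction s using germ_ind with
  | h i f =>
    rw [post_germ, germ_germ, germ_germ, post_germ, CategoryTheory.Functor.map_comp]

theorem germ_map_eq {X : Pro C} {c : C} {m r : ℕ} (h : m ≤ r) (i : X.I)
    (f : (t.T m).obj (X.F.obj i) ⟶ c) :
    Pro.germ (t.proObj X) (op r, i) ((t.q h).app _ ≫ f) = Pro.germ (t.proObj X) (op m, i) f := by
  refine germ_eq (op r, i) (𝟙 _, 𝟙 _) ((homOfLE h).op, 𝟙 _) ?_
  dsimp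
  rw [t.q_refl, X.F.map_id, CategoryTheory.Functor.map_id, CategoryTheory.Functor.map_id,
    Category.comp_id, Category.id_comp, Category.comp_id]

theorem germ_q {m r : ℕ} (h : m ≤ r) {X : Pro C} {c : C} (s : Germ X c) :
    (germ (t := t) r s).post ((t.q h).app c) = germ m s := by
  induction s using germ_ind with
  | h i f =>
    rw [germ_germ, germ_germ, post_germ, NatTrans.naturality, germ_map_eq]

variable (t)

/-- The extension of a tower to morphisms of pro-objects. -/
def proMap {X Y : Pro C} (φ : X ⟶ Y) : t.proObj X ⟶ t.proObj Y where
  app p := germ p.1.unop (Hom.app φ p.2)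
  compat {p p'} u := by
    rw [← post_post, germ_q, germ_post, Hom.compat]

theorem germ_pre (m : ℕ) {X Y : Pro C} (φ : X ⟶ Y) {c : C} (s : Germ Y c) :
    (germ m s).pre (t.proMap φ) = germ m (s.pre φ) := by
  induction s using germ_ind with
  | h j g =>
    rw [pre_germ, germ_germ, pre_germ]
    exact germ_post _ _ _

/-- The extension `{Fᵢ} ↦ {Tₘ(Fᵢ)}` to pro-objects. -/
@[simps]
def pro : Pro C ⥤ Pro C where
  obj := t.proObj
  map := t.proMap
  map_id X := hom_ext fun p ↦ congrArg (Pro.germ (t.proObj X) p)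
    ((t.T p.1.unop).map_id (X.F.obj p.2))
  map_comp φ ψ := hom_ext fun p ↦ (t.germ_pre p.1.unop φ (Hom.app ψ p.2)).symm

/-- The counit on pro-objects. -/
def proCounit (X : Pro C) : t.proObj X ⟶ X :=
  homMk (fun i ↦ (op 0, i)) (fun i ↦ t.ε.app (X.F.obj i)) (fun {i i'} u ↦ ⟨(𝟙 _, u), by
    dsimp
    rw [t.q_refl, Category.id_comp]
    exact (t.ε.naturality (X.F.map u)).symm⟩)

theorem pre_proCounit {X : Pro C} {c : C} (s : Germ X c) :
    s.pre (t.proCounit X) = (germ 0 s).post (t.ε.app c) := by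
  induction s using germ_ind with
  | h i f =>
    exact congrArg (Pro.germ (t.proObj X) (op 0, i)) (t.ε.naturality f).symm

/-- The comultiplication on pro-objects: its component `(m, (n, i))` is the class of
`T_{m+n}(Fᵢ) ⟶ Tₘ(Tₙ(Fᵢ))`. -/
def proComul (X : Pro C) : t.proObj X ⟶ t.proObj (t.proObj X) :=
  homMk (fun p ↦ (op (p.1.unop + p.2.1.unop), p.2.2))
    (fun p ↦ (t.δ (le_refl (p.1.unop + p.2.1.unop))).app (X.F.obj p.2.2))
    (fun {p p'} u ↦
      ⟨((homOfLE (add_le_add (leOfHom u.1.unop) (leOfHom u.2.1.unop))).op, u.2.2), by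
        have h1 := (t.δ (le_refl (p'.1.unop + p'.2.1.unop))).naturality (X.F.map u.2.2)
        dsimp at h1 ⊢
        rw [Category.assoc, h1, reassoc_of% (t.q_δ (le_refl (p'.1.unop + p'.2.1.unop))
          (add_le_add (leOfHom u.1.unop) (leOfHom u.2.1.unop)) _),
          ← t.δ_q (le_refl (p.1.unop + p.2.1.unop)) (leOfHom u.1.unop) (leOfHom u.2.1.unop),
          CategoryTheory.Functor.map_comp]
        simp only [Category.assoc, NatTrans.naturality]⟩)

theorem pre_proComul {X : Pro C} {c : C} {m n r : ℕ} (h : m + n ≤ r) (s : Germ X c) :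
    (germ m (germ n s)).pre (t.proComul X) = (germ r s).post ((t.δ h).app c) := by
  induction s using germ_ind with
  | h i f =>
    refine ((congrArg (Pro.germ (t.proObj X) (op (m + n), i))
      ((t.δ (le_refl (m + n))).naturality f).symm).trans (germ_map_eq h i _).symm).trans ?_
    refine congrArg (Pro.germ (t.proObj X) (op r, i)) ?_
    rw [← NatTrans.naturality_assoc, t.q_δ]

theorem germ_q_eq {X : Pro C} {m r : ℕ} (h : m ≤ r) (i : X.I) :
    Pro.germ (t.proObj X) (op r, i) ((t.q h).app (X.F.obj i)) =
      Pro.germ (t.proObj X) (op m, i) (𝟙 _) := by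
  rw [← germ_map_eq h, Category.comp_id]

/-- The comonad `{Fᵢ} ↦ {Tₘ(Fᵢ)}` on pro-objects. -/
def proComonad : Comonad (Pro C) where
  toFunctor := t.pro
  ε :=
    { app := t.proCounit
      naturality := fun _ _ φ ↦ hom_ext fun j ↦ (t.pre_proCounit (Hom.app φ j)).symm }
  δ :=
    { app := t.proComul
      naturality := fun _ _ φ ↦ hom_ext fun p ↦
        (t.pre_proComul (le_refl (p.1.unop + p.2.1.unop)) (Hom.app φ p.2.2)).symm }
  left_counit X := hom_ext fun p ↦
    (congrArg (Pro.germ (t.proObj X) (op (0 + p.1.unop), p.2))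
      (t.δ_ε_left (le_refl (0 + p.1.unop)) (X.F.obj p.2))).trans (t.germ_q_eq _ p.2)
  right_counit X := hom_ext fun p ↦
    (congrArg (Pro.germ (t.proObj X) (op (p.1.unop + 0), p.2))
      (t.δ_ε_right (le_refl (p.1.unop + 0)) (X.F.obj p.2))).trans (t.germ_q_eq _ p.2)
  coassoc X := hom_ext fun p ↦ by
    obtain ⟨l, m, n, i⟩ := p
    have h := (add_assoc l.unop m.unop n.unop).le
    refine (congrArg (Pro.germ (t.proObj X) (op (l.unop + (m.unop + n.unop)), i))
      (t.coassoc le_rfl le_rfl h le_rfl (X.F.obj i))).trans ?_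
    rw [← t.q_δ le_rfl h, Category.assoc]
    exact t.germ_map_eq h i _

end Tower

section PresheafTower

open PMod

variable (k : Type u) [CommRing k] {C : Type u'} [Category.{v'} C]
  (O : Cᵒᵖ ⥤ CommRingCat.{u}) [∀ U, Algebra k (O.obj U)] [AlgPresheaf k O]

section Laws

variable {O} {M N : PMod O} (f : M ⟶ N)

theorem ppTrans_nat {m r : ℕ} (h : m ≤ r) :
    ppMap k r f ≫ ppTrans k h N = ppTrans k h M ≫ ppMap k m f :=
  pp_hom_ext fun U x ↦ by simp only [lin_comp, lin_ppMap, lin_ppTrans]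

theorem ppAug_nat (m : ℕ) : ppMap k m f ≫ ppAug k m N = ppAug k m M ≫ f :=
  pp_hom_ext fun U x ↦ by simp only [lin_comp, lin_ppMap, lin_ppAug]

theorem ppComul_nat {m n r : ℕ} (h : m + n ≤ r) :
    ppMap k r f ≫ ppComul k h N = ppComul k h M ≫ ppMap k m (ppMap k n f) :=
  pp_hom_ext fun U x ↦ by simp only [lin_comp, lin_ppMap, lin_ppComul]

theorem ppTrans_refl (m : ℕ) : ppTrans k (le_refl m) M = 𝟙 _ :=
  pp_hom_ext fun U x ↦ by simp only [lin_ppTrans, lin_id]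

theorem ppTrans_comp {l m r : ℕ} (h : l ≤ m) (h' : m ≤ r) :
    ppTrans k h' M ≫ ppTrans k h M = ppTrans k (h.trans h') M :=
  pp_hom_ext fun U x ↦ by simp only [lin_comp, lin_ppTrans]

theorem ppTrans_comul {m n r s : ℕ} (h : m + n ≤ r) (h' : r ≤ s) :
    ppTrans k h' M ≫ ppComul k h M = ppComul k (h.trans h') M :=
  pp_hom_ext fun U x ↦ by simp only [lin_comp, lin_ppTrans, lin_ppComul]

theorem ppComul_trans {m n m' n' r : ℕ} (h : m + n ≤ r) (hm : m' ≤ m) (hn : n' ≤ n) :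
    ppComul k h M ≫ ppMap k m (ppTrans k hn M) ≫ ppTrans k hm (ppObj k n' M) =
      ppComul k ((add_le_add hm hn).trans h) M :=
  pp_hom_ext fun U x ↦ by simp only [lin_comp, lin_ppTrans, lin_ppComul, lin_ppMap]

theorem ppComul_aug_left {n r : ℕ} (h : 0 + n ≤ r) :
    ppComul k h M ≫ ppAug k 0 (ppObj k n M) = ppTrans k ((zero_add n).symm.trans_le h) M :=
  pp_hom_ext fun U x ↦ by simp only [lin_comp, lin_ppTrans, lin_ppComul, lin_ppAug]

theorem ppComul_aug_right {m r : ℕ} (h : m + 0 ≤ r) :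
    ppComul k h M ≫ ppMap k m (ppAug k 0 M) = ppTrans k (m := m) h M :=
  pp_hom_ext fun U x ↦ by
    simp only [lin_comp, lin_ppTrans, lin_ppComul, lin_ppMap, lin_ppAug]

theorem ppComul_coassoc {l m n s t r : ℕ} (h₁ : l + s ≤ r) (h₂ : m + n ≤ s) (h₃ : t + n ≤ r)
    (h₄ : l + m ≤ t) :
    ppComul k h₁ M ≫ ppMap k l (ppComul k h₂ M) =
      ppComul k h₃ M ≫ ppComul k h₄ (ppObj k n M) :=
  pp_hom_ext fun U x ↦ by simp only [lin_comp, lin_ppComul, lin_ppMap]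

end Laws

/-- The functor `M ↦ 𝒫ᵐ ⊗ M` on presheaves of modules. -/
@[simps]
noncomputable def ppFunctor (m : ℕ) : PMod O ⥤ PMod O where
  obj := ppObj k m
  map := ppMap k m
  map_id M := pp_hom_ext fun U x ↦ lin_ppMap k m (𝟙 M) U x
  map_comp f g := pp_hom_ext fun U x ↦ by
    rw [lin_ppMap, lin_comp, lin_comp, lin_ppMap, lin_ppMap]

/-- The tower `(𝒫ᵐ ⊗ -)ₘ` on presheaves of modules. -/
noncomputable def ppTower : Tower (PMod O) where
  T := ppFunctor k O
  q h := { app := ppTrans k h, naturality := fun _ _ f ↦ ppTrans_nat k f h }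
  ε := { app := ppAug k 0, naturality := fun _ _ f ↦ ppAug_nat k f 0 }
  δ {m n r} h :=
    { app := fun M ↦ ppComul (m := m) (n := n) (r := r) k h M
      naturality := fun _ _ f ↦ ppComul_nat k f h }
  q_refl m _ := ppTrans_refl k m
  q_comp h h' _ := ppTrans_comp k h h'
  q_δ h h' _ := ppTrans_comul k h h'
  δ_q h hm hn _ := ppComul_trans k h hm hn
  δ_ε_left h _ := ppComul_aug_left k h
  δ_ε_right h _ := ppComul_aug_right k h
  coassoc h₁ h₂ h₃ h₄ _ := ppComul_coassoc k h₁ h₂ h₃ h₄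

end PresheafTower

namespace Tower

variable {C : Type u} [Category.{v} C] {D : Type u'} [Category.{v'} D]

/-- Transport of a tower along an adjunction `L ⊣ R` (which will be sheafification). -/
def transport (t : Tower C) {L : C ⥤ D} {R : D ⥤ C} (adj : L ⊣ R) : Tower D where
  T m := R ⋙ t.T m ⋙ L
  q h :=
    { app := fun F ↦ L.map ((t.q h).app (R.obj F))
      naturality := fun F G f ↦ by
        dsimp
        rw [← L.map_comp, ← L.map_comp, NatTrans.naturality] }
  ε :=
    { app := fun F ↦ L.map (t.ε.app (R.obj F)) ≫ adj.counit.app F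
      naturality := fun F G f ↦ by
        dsimp
        rw [← L.map_comp_assoc, NatTrans.naturality, L.map_comp_assoc]
        simp }
  δ {m n r} h :=
    { app := fun F ↦ L.map ((t.δ h).app (R.obj F) ≫
        (t.T m).map (adj.unit.app ((t.T n).obj (R.obj F)))) 
      naturality := fun F G f ↦ by
        dsimp
        rw [← L.map_comp, ← L.map_comp, NatTrans.naturality_assoc]
        congr 1
        rw [Category.assoc]
        congr 1
        dsimp
        rw [← CategoryTheory.Functor.map_comp, ← CategoryTheory.Functor.map_comp]
        congr 1
        exact adj.unit.naturality ((t.T n).map (R.map f)) }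
  q_refl m F := by
    dsimp
    rw [t.q_refl, L.map_id]
  q_comp h h' F := by
    dsimp
    rw [← L.map_comp, t.q_comp]
  q_δ h h' F := by
    dsimp
    rw [← L.map_comp, reassoc_of% (t.q_δ h h' (R.obj F))]
  δ_q {m n m' n' r} h hm hn F := by
    dsimp
    rw [← L.map_comp, ← L.map_comp]
    congr 1
    have h1 := adj.unit.naturality ((t.q hn).app (R.obj F))
    dsimp at h1
    rw [Category.assoc, ← CategoryTheory.Functor.map_comp_assoc, ← h1,
      CategoryTheory.Functor.map_comp_assoc, NatTrans.naturality, ← t.δ_q h hm hn (R.obj F)]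
    simp only [Category.assoc]
  δ_ε_left h F := by
    dsimp
    rw [← t.δ_ε_left h (R.obj F), ← L.map_comp_assoc, Category.assoc, NatTrans.naturality,
      L.map_comp, L.map_comp, Category.assoc, Category.assoc]
    dsimp
    rw [adj.left_triangle_components, Category.comp_id, L.map_comp]
  δ_ε_right {m r} h F := by
    dsimp
    rw [← t.δ_ε_right h (R.obj F), ← L.map_comp, Category.assoc,
      ← CategoryTheory.Functor.map_comp, R.map_comp]
    have h1 := adj.unit.naturality (t.ε.app (R.obj F))
    dsimp at h1
    rw [← reassoc_of% h1, adj.right_triangle_components, Category.comp_id]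
  coassoc {l m n s t' r} h₁ h₂ h₃ h₄ F := by
    dsimp
    rw [← L.map_comp, ← L.map_comp]
    congr 1
    have h1 := adj.unit.naturality ((t.δ h₂).app (R.obj F) ≫
        (t.T m).map (adj.unit.app ((t.T n).obj (R.obj F))))
    dsimp at h1
    rw [Category.assoc, ← CategoryTheory.Functor.map_comp, ← h1, Category.assoc,
      Category.assoc, NatTrans.naturality_assoc, ← reassoc_of% (t.coassoc h₁ h₂ h₃ h₄)]
    simp

end Tower

namespace Tower

open Pro

variable {C : Type u} [Category.{v} C] (t : Tower C)

/-- Restriction of a tower to a full subcategory which it preserves. -/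
def restrict (P : ObjectProperty C) (h : ∀ m F, P F → P ((t.T m).obj F)) :
    Tower P.FullSubcategory where
  T m := P.lift (P.ι ⋙ t.T m) fun F ↦ h m F.obj F.property
  q h' :=
    { app := fun F ↦ P.homMk ((t.q h').app F.obj)
      naturality := fun F G f ↦ by ext; exact (t.q h').naturality f.hom }
  ε :=
    { app := fun F ↦ P.homMk (t.ε.app F.obj)
      naturality := fun F G f ↦ by ext; exact t.ε.naturality f.hom }
  δ h' :=
    { app := fun F ↦ P.homMk ((t.δ h').app F.obj)
      naturality := fun F G f ↦ by ext; exact (t.δ h').naturality f.hom }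
  q_refl m F := by ext; exact t.q_refl m F.obj
  q_comp h h' F := by ext; exact t.q_comp h h' F.obj
  q_δ h h' F := by ext; exact t.q_δ h h' F.obj
  δ_q h hm hn F := by ext; exact t.δ_q h hm hn F.obj
  δ_ε_left h F := by ext; exact t.δ_ε_left h F.obj
  δ_ε_right h F := by ext; exact t.δ_ε_right h F.obj
  coassoc h₁ h₂ h₃ h₄ F := by ext; exact t.coassoc h₁ h₂ h₃ h₄ F.obj

/-- Pro-objects of the full subcategory `P`, regarded as pro-objects of `C`. -/
abbrev incl (P : ObjectProperty C) : Pro P.FullSubcategory ⥤ Pro C := Pro.map P.ι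

theorem restrict_nat (P : ObjectProperty C) (h : ∀ m F, P F → P ((t.T m).obj F))
    {X Y : Pro P.FullSubcategory} (φ : X ⟶ Y) :
    (incl P).map ((t.restrict P h).proMap φ) = t.proMap ((incl P).map φ) :=
  Pro.hom_ext fun p ↦ by
    change (germ (t := t.restrict P h) p.1.unop (Hom.app φ p.2)).map P.ι =
      germ (t := t) p.1.unop ((Hom.app φ p.2).map P.ι)
    generalize Hom.app φ p.2 = s
    induction s using germ_ind with
    | h i g => rfl

end Tower

/-- Given a comonad `G` on `E` and a functor `ι : D ⥤ E`: an object of `D` together with the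
structure of a `G`-comodule on its image in `E`. -/
structure Comod {D : Type u'} [Category.{v'} D] {E : Type u} [Category.{v} E] (G : Comonad E)
    (ι : D ⥤ E) where
  /-- The underlying object. -/
  obj : D
  /-- The coaction. -/
  str : ι.obj obj ⟶ G.obj (ι.obj obj)
  coid : str ≫ G.ε.app (ι.obj obj) = 𝟙 (ι.obj obj)
  coassoc : str ≫ G.δ.app (ι.obj obj) = str ≫ G.map str

namespace Comod

variable {D : Type u'} [Category.{v'} D] {E : Type u} [Category.{v} E] {G : Comonad E}
  {ι : D ⥤ E}

/-- The morphisms compatible with the coactions. -/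
@[ext]
structure Hom (M N : Comod G ι) where
  /-- The underlying morphism. -/
  hom : M.obj ⟶ N.obj
  comm : M.str ≫ G.map (ι.map hom) = ι.map hom ≫ N.str

instance : Category.{v'} (Comod G ι) where
  Hom := Hom
  id M := ⟨𝟙 _, by simp⟩
  comp f g := ⟨f.hom ≫ g.hom, by
    rw [ι.map_comp, CategoryTheory.Functor.map_comp, reassoc_of% f.comm, g.comm, Category.assoc]⟩
  id_comp f := Hom.ext (Category.id_comp f.hom)
  comp_id f := Hom.ext (Category.comp_id f.hom)
  assoc f g h := Hom.ext (Category.assoc f.hom g.hom h.hom)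

/-- Forget the coaction. -/
@[simps]
def forget (G : Comonad E) (ι : D ⥤ E) : Comod G ι ⥤ D where
  obj M := M.obj
  map f := Hom.hom f

end Comod

/-- The functor sending `{Fᵢ}` to `{Tₘ(Fᵢ)}` with its canonical coaction. -/
def Tower.cofree {C : Type u} [Category.{v} C] (t : Tower C) (P : ObjectProperty C)
    (h : ∀ m F, P F → P ((t.T m).obj F)) :
    Pro P.FullSubcategory ⥤ Comod t.proComonad (Tower.incl P) where
  obj F :=
    { obj := (t.restrict P h).proObj F
      str := t.proComul ((Tower.incl P).obj F)
      coid := t.proComonad.left_counit ((Tower.incl P).obj F)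
      coassoc := (t.proComonad.coassoc ((Tower.incl P).obj F)).symm }
  map {F G} φ :=
    { hom := (t.restrict P h).proMap φ
      comm := by
        have h1 := t.proComonad.δ.naturality ((Tower.incl P).map φ)
        have h2 := t.restrict_nat P h φ
        have h3 : t.proComul ((Tower.incl P).obj F) ≫ t.proMap (t.proMap ((Tower.incl P).map φ)) =
          t.proMap ((Tower.incl P).map φ) ≫ t.proComul ((Tower.incl P).obj G) := h1.symm
        rw [← h2] at h3
        exact h3 }
  map_id F := Comod.Hom.ext ((t.restrict P h).pro.map_id F)
  map_comp φ ψ := Comod.Hom.ext ((t.restrict P h).pro.map_comp φ ψ)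

/-- A comodule is induced when it is isomorphic to `G(ι(L))`, with the coaction given by the
comultiplication of `G`, for some object `L`. -/
def Comod.IsInduced {D : Type u'} [Category.{v'} D] {E : Type u} [Category.{v} E] {G : Comonad E}
    {ι : D ⥤ E} (M : Comod G ι) : Prop :=
  ∃ (L : D) (e : ι.obj M.obj ≅ G.obj (ι.obj L)),
    M.str ≫ G.map e.hom = e.hom ≫ G.δ.app (ι.obj L)

section Scheme

open AlgebraicGeometry Limits

variable {k : Type u} [CommRing k] {X : Scheme.{u}} (f : X ⟶ Spec (CommRingCat.of k))

/-- The structure map `k → 𝒪_X(U)` of a scheme over `k`. -/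
noncomputable def structMap (U : X.Opensᵒᵖ) : k →+* X.presheaf.obj U :=
  ((Scheme.ΓSpecIso (CommRingCat.of k)).inv ≫ f.appTop ≫
    X.presheaf.map (homOfLE (le_top : U.unop ≤ ⊤)).op).hom

/-- `𝒪_X(U)` as a `k`-algebra. -/
@[reducible]
noncomputable def structAlgebra (U : X.Opensᵒᵖ) : Algebra k (X.presheaf.obj U) :=
  (structMap f U).toAlgebra

theorem structMap_comp {U V : X.Opensᵒᵖ} (i : U ⟶ V) (c : k) :
    (X.presheaf.map i).hom (structMap f U c) = structMap f V c := by
  have h : ((Scheme.ΓSpecIso (CommRingCat.of k)).inv ≫ f.appTop ≫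
      X.presheaf.map (homOfLE (le_top : U.unop ≤ ⊤)).op) ≫ X.presheaf.map i =
    (Scheme.ΓSpecIso (CommRingCat.of k)).inv ≫ f.appTop ≫
      X.presheaf.map (homOfLE (le_top : V.unop ≤ ⊤)).op := by
    rw [Category.assoc, Category.assoc, ← Functor.map_comp]
    rfl
  exact congrArg (fun φ ↦ CommRingCat.Hom.hom φ c) h

theorem algPresheaf :
    @AlgPresheaf k _ X.Opens _ X.presheaf (structAlgebra f) :=
  @AlgPresheaf.mk k _ X.Opens _ X.presheaf (structAlgebra f) fun i c ↦ structMap_comp f i c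

/-- Sheafification of presheaves of `𝒪_X`-modules. -/
noncomputable def sheafificationAdj (X : Scheme.{u}) :
    PresheafOfModules.sheafification.{u} (𝟙 X.ringCatSheaf.obj) ⊣
      Scheme.Modules.toPresheafOfModules X :=
  PresheafOfModules.sheafificationAdjunction (𝟙 X.ringCatSheaf.obj)

/-- The sequence of functors `M ↦ 𝒫ᵐ_X ⊗ M` on `𝒪_X`-modules, where `𝒫ᵐ_X ⊗ M` is the sheaf
associated with `U ↦ 𝒫ᵐ(𝒪_X(U)) ⊗ M(U)`. -/
noncomputable def modTower : Tower X.Modules :=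
  Tower.transport (@ppTower k _ X.Opens _ X.presheaf (structAlgebra f) (algPresheaf f))
    (sheafificationAdj X)

/-- Coherent modules on a locally noetherian scheme: quasi-coherent modules whose sections over
affine open subsets are finitely generated. -/
def IsCoherent (X : Scheme.{u}) : ObjectProperty X.Modules := fun M ↦
  SheafOfModules.IsQuasicoherent.{u} M ∧
    ∀ U : X.Opens, IsAffineOpen U → Module.Finite Γ(X, U) Γ(M, U)

/-- The category `ν(𝒪_X)` of pro-coherent modules. -/
abbrev NuO (X : Scheme.{u}) : Type (u + 1) := Pro (IsCoherent X).FullSubcategory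

/-- The comonad `{Fᵢ} ↦ {𝒫ᵐ_X ⊗ Fᵢ}` on the pro-objects of the category of `𝒪_X`-modules. -/
noncomputable abbrev ppComonad : Comonad (Pro X.Modules) := (modTower f).proComonad

/-- The category `ν(𝒫˙_X)` of stratified pro-coherent modules: pro-coherent modules `F` with a
stratification `F ⟶ {𝒫ᵐ_X} ⊗ F`. -/
abbrev NuP : Type (u + 1) := Comod (ppComonad f) (Tower.incl (IsCoherent X))

/-- The forgetful functor `ν(𝒫˙_X) ⥤ ν(𝒪_X)`. -/
noncomputable abbrev forgetStrat : NuP f ⥤ NuO X := Comod.forget _ _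

/-- The sheaves `𝒫ᵐ_X ⊗ F` are coherent for coherent `F`. -/
def PreservesCoherent : Prop :=
  ∀ (m : ℕ) (F : X.Modules), IsCoherent X F → IsCoherent X (((modTower f).T m).obj F)

/-- The functor `Q⁰_X = {𝒫ᵐ_X} ⊗ -` from `ν(𝒪_X)` to `ν(𝒫˙_X)`. -/
noncomputable def coextension (h : PreservesCoherent f) : NuO X ⥤ NuP f :=
  (modTower f).cofree (IsCoherent X) h

end Scheme

end StratPro

open CategoryTheory.Limits AlgebraicGeometry StratPro

/-!
The principal parts define a tower of functors `Tₘ = 𝒫ᵐ ⊗ -` on the modules over `X`, with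
counit `T₀ ⟶ 𝟭` and comultiplications `Tₘ₊ₙ ⟶ Tₘ Tₙ`, which extends to a comonad on the pro-objects.
A stratified pro-coherent module is a coalgebra over the restriction of this comonad to
`Pro (Coh X)` (`Tower.toComod`), so that the three assertions follow from formal properties of
coalgebras once this comonad is known to be exact and to commute with cofiltered limits.

* The pro-objects of an abelian category form an abelian category: a morphism of pro-objects is
  isomorphic to a morphism of projective systems over a common index category
  (`Pro.exists_arrow_iso_lev`), and kernels and cokernels are computed levelwise there
  (`Pro.isLimitLevMap`, `Pro.isColimitLevMap`). Cofiltered limits exist and are exact, because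
  the germs `colim Hom(F i, c)` of a cofiltered limit are the colimit of the germs
  (`Pro.nonempty_isLimit_iff`, `Pro.hasExactLimitsOfShape`).
* A tower extends to an exact functor on pro-objects under the conditions `Tower.IsExact`: its terms
  are right exact, and for a monomorphism `u : F ⟶ G` the kernels of the `Tᵣ(u)` form a null
  system. The extension also preserves cofiltered limits (`Tower.pro_isGermLimit`).
* The forgetful functor from the coalgebras over a comonad `G` creates colimits, and those limits
  which `G` preserves, and the cofree coalgebras give its right adjoint. Hence the coalgebras over an
  exact comonad form an abelian category (`nonempty_abelian_coalgebra`), with exact cofiltered limits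
  if they are exact in the base and preserved by the comonad (`coalgebra_hasExactLimits`).

It remains to see that the coherent modules form an abelian category stable under `𝒫ᵐ ⊗ -`, and that
the principal parts form an exact tower on them. All this is reduced to algebra over the affine open
subsets. Quasi-coherence means that the sections over affine open subsets `U` satisfy
`M(D(f)) = M(U)_f` (`IsAffineLocalizing`), and a presheaf of modules with this property has the same
sections over the affine open subsets as the associated sheaf
(`IsLocallyBijective.isAffineLocalizing`). This applies to the presheaf `U ↦ 𝒫ᵐ ⊗ M(U)`, as principal
parts commute with localization (`PPTensor.isAway_res`), and to presheaf cokernels. Over a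
`k`-algebra `A` of finite type, the principal parts are finite over `A`, tensor products are right
exact, and the condition on kernels is the Artin–Rees lemma for the ideal of the diagonal in the
noetherian ring `A ⊗ A`, which is flat over `A` (`PPTensor.artinRees`); as `X` is quasi-compact, the
Artin–Rees constants can be bounded uniformly (`restrict_isExact`). This replaces the local freeness
of the `𝒫ᵐ` on a smooth scheme.
-/

/-! ### Germs, level morphisms and the additive structure of pro-objects -/

namespace StratPro

namespace Pro

open Limits

section Germs

variable {A : Type u} [Category.{v} A]

theorem germ_eq_iff {X : Pro A} {c : A} {i i' : X.I} {f : X.F.obj i ⟶ c} {f' : X.F.obj i' ⟶ c} :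
    germ X i f = germ X i' f' ↔
      ∃ (z : X.I) (a : z ⟶ i) (b : z ⟶ i'), X.F.map a ≫ f = X.F.map b ≫ f' :=
  ⟨fun h ↦ Quotient.exact h, fun ⟨z, a, b, h⟩ ↦ germ_eq z a b h⟩

theorem germ_eq_iff_same {X : Pro A} {c : A} {i : X.I} {f f' : X.F.obj i ⟶ c} :
    germ X i f = germ X i f' ↔ ∃ (z : X.I) (a : z ⟶ i), X.F.map a ≫ f = X.F.map a ≫ f' := by
  refine ⟨fun h ↦ ?_, fun ⟨z, a, h⟩ ↦ germ_eq z a a h⟩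
  obtain ⟨z, a, b, h⟩ := germ_eq_iff.1 h
  refine ⟨IsCofiltered.eq a b, IsCofiltered.eqHom a b ≫ a, ?_⟩
  rw [X.F.map_comp, Category.assoc, h, ← Category.assoc, ← X.F.map_comp,
    ← IsCofiltered.eq_condition, X.F.map_comp, Category.assoc]

theorem germ_surj {X : Pro A} {c : A} (s : Germ X c) : ∃ i f, germ X i f = s := by
  induction s using germ_ind with
  | h i f => exact ⟨i, f, rfl⟩

/-- Two germs with values in `c`, `d` have representatives with the same source. -/
theorem germ_surj₂ {X : Pro A} {c d : A} (s : Germ X c) (t : Germ X d) :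
    ∃ i f g, germ X i f = s ∧ germ X i g = t := by
  obtain ⟨i, f, rfl⟩ := germ_surj s
  obtain ⟨j, g, rfl⟩ := germ_surj t
  exact ⟨IsCofiltered.min i j, _, _, germ_map (IsCofiltered.minToLeft i j) f,
    germ_map (IsCofiltered.minToRight i j) g⟩

theorem germ_surj₃ {X : Pro A} {c d e : A} (s : Germ X c) (t : Germ X d) (r : Germ X e) :
    ∃ i f g h, germ X i f = s ∧ germ X i g = t ∧ germ X i h = r := by
  obtain ⟨i, f, g, rfl, rfl⟩ := germ_surj₂ s t
  obtain ⟨j, h, rfl⟩ := germ_surj r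
  exact ⟨IsCofiltered.min i j, _, _, _, germ_map (IsCofiltered.minToLeft i j) f,
    germ_map (IsCofiltered.minToLeft i j) g, germ_map (IsCofiltered.minToRight i j) h⟩

/-- A germ `s` has a representative defined on any prescribed refinement. -/
theorem germ_surj_over {X : Pro A} {c : A} (s : Germ X c) (i : X.I) :
    ∃ (z : X.I) (_ : z ⟶ i) (f : X.F.obj z ⟶ c), germ X z f = s := by
  obtain ⟨j, g, rfl⟩ := germ_surj s
  exact ⟨IsCofiltered.min i j, IsCofiltered.minToLeft i j, _,
    germ_map (IsCofiltered.minToRight i j) g⟩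

theorem pre_app_id {X Y : Pro A} (φ : X ⟶ Y) (j : Y.I) :
    (germ Y j (𝟙 _)).pre φ = Hom.app φ j := by
  rw [pre_germ, post_id]

theorem germ_post_injective {X : Pro A} {c d : A} (u : c ⟶ d) [Mono u] {s t : Germ X c}
    (h : s.post u = t.post u) : s = t := by
  obtain ⟨i, f, g, rfl, rfl⟩ := germ_surj₂ s t
  rw [post_germ, post_germ, germ_eq_iff_same] at h
  obtain ⟨z, a, h⟩ := h
  refine germ_eq_iff_same.2 ⟨z, a, ?_⟩
  rwa [← Category.assoc, ← Category.assoc, cancel_mono] at h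

/-- A morphism of pro-objects inducing bijections on germs is an isomorphism. -/
theorem isIso_of_bijective {X Y : Pro A} (φ : X ⟶ Y)
    (h : ∀ c : A, Function.Bijective (fun s : Germ Y c ↦ s.pre φ)) : IsIso φ := by
  choose ψ hψ using fun i : X.I ↦ (h (X.F.obj i)).2 (germ X i (𝟙 _))
  have hc {c : A} (s : Germ X c) : ∃ t : Germ Y c, t.pre φ = s := (h c).2 s
  let ψ' : Y ⟶ X :=
    { app := ψ
      compat := fun {i i'} u ↦ (h _).1 (by
        change (Germ.post (ψ i) _).pre φ = (ψ i').pre φ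
        rw [pre_post]
        have h1 := hψ i
        have h2 := hψ i'
        dsimp only at h1 h2
        rw [h1, h2, post_germ, Category.id_comp, ← germ_map u (𝟙 _), Category.comp_id]) }
  have h1 : φ ≫ ψ' = 𝟙 X := hom_ext fun i ↦ hψ i
  have h2 : ψ' ≫ φ = 𝟙 Y := hom_ext fun j ↦ (h _).1 (by
    change (Hom.app (ψ' ≫ φ) j).pre φ = (Hom.app (𝟙 Y) j).pre φ
    rw [← comp_app, ← comp_app, ← Category.assoc, h1, Category.id_comp, Category.comp_id])
  exact ⟨ψ', h1, h2⟩

/-- A morphism of pro-objects is an epimorphism as soon as it is injective on germs. -/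
theorem epi_of_injective {X Y : Pro A} (φ : X ⟶ Y)
    (h : ∀ c : A, Function.Injective (fun s : Germ Y c ↦ s.pre φ)) : Epi φ where
  left_cancellation _ _ e := hom_ext fun j ↦ h _ (congrArg (fun ψ ↦ Hom.app ψ j) e)

/-- The pro-object given by a single object. -/
def const (c : A) : Pro A where
  I := Discrete PUnit
  F := Functor.fromPUnit c

/-- A germ with values in `c` is a morphism to the constant pro-object `c`. -/
def homConst {X : Pro A} {c : A} (s : Germ X c) : X ⟶ const c where
  app _ := s
  compat _ := post_id s

/-- The converse of `epi_of_injective`: two germs with values in `c` which agree after composition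
with `φ` are morphisms to the constant pro-object `c` coequalized by `φ`. -/
theorem injective_of_epi {X Y : Pro A} (φ : X ⟶ Y) [Epi φ] (c : A) :
    Function.Injective (fun s : Germ Y c ↦ s.pre φ) := fun s t h ↦ by
  have h1 : φ ≫ homConst s = φ ≫ homConst t := hom_ext fun _ ↦ h
  exact congrArg (fun ψ ↦ Hom.app (Y := const c) ψ (Discrete.mk PUnit.unit)) ((cancel_epi φ).1 h1)

end Germs

section Level

variable {A : Type u} [Category.{v} A]

/-- The pro-object defined by a projective system indexed by `K`. -/
abbrev levObj {K : Type v} [SmallCategory K] [IsCofiltered K] (F : K ⥤ A) : Pro A := ⟨K, F⟩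

/-- The morphism of pro-objects defined by a morphism of projective systems with the same index
category. -/
def levMap {K : Type v} [SmallCategory K] [IsCofiltered K] {F G : K ⥤ A} (α : F ⟶ G) :
    levObj F ⟶ levObj G :=
  homMk (X := levObj F) (Y := levObj G) (fun k ↦ k) (fun k ↦ α.app k)
    (fun u ↦ ⟨u, (α.naturality u).symm⟩)

theorem pre_levMap {K : Type v} [SmallCategory K] [IsCofiltered K] {F G : K ⥤ A} (α : F ⟶ G)
    {c : A} (k : K) (g : G.obj k ⟶ c) :
    (germ (levObj G) k g).pre (levMap α) = germ (levObj F) k (α.app k ≫ g) := rfl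

variable (A) in
/-- The functor sending a projective system indexed by `K` to the pro-object it defines. -/
def lev (K : Type v) [SmallCategory K] [IsCofiltered K] : (K ⥤ A) ⥤ Pro A where
  obj := levObj
  map := levMap
  map_id _ := rfl
  map_comp _ _ := rfl

/-- The morphism from a pro-object to its reindexing along a functor. -/
def reindex (X : Pro A) {K : Type v} [SmallCategory K] [IsCofiltered K] (p : K ⥤ X.I) :
    X ⟶ levObj (p ⋙ X.F) :=
  homMk (X := X) (Y := levObj (p ⋙ X.F)) (fun k ↦ p.obj k) (fun k ↦ 𝟙 _)
    (fun u ↦ ⟨p.map u, by simp⟩)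

theorem pre_reindex (X : Pro A) {K : Type v} [SmallCategory K] [IsCofiltered K] (p : K ⥤ X.I)
    {c : A} (k : K) (f : X.F.obj (p.obj k) ⟶ c) :
    (germ (levObj (p ⋙ X.F)) k f).pre (X.reindex p) = germ X (p.obj k) f := by
  rw [pre_germ]
  change (germ X (p.obj k) (𝟙 _)).post f = _
  rw [post_germ, Category.id_comp]

/-- Reindexing along an initial functor, in the elementary form of initiality for cofiltered index
categories, does not change a pro-object. -/
theorem isIso_reindex (X : Pro A) {K : Type v} [SmallCategory K] [IsCofiltered K] (p : K ⥤ X.I)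
    (h₁ : ∀ i, ∃ k, Nonempty (p.obj k ⟶ i))
    (h₂ : ∀ {i : X.I} {k : K} (s s' : p.obj k ⟶ i), ∃ (k' : K) (t : k' ⟶ k),
      p.map t ≫ s = p.map t ≫ s') : IsIso (X.reindex p) := by
  refine isIso_of_bijective _ fun c ↦ ⟨fun s t h ↦ ?_, fun s ↦ ?_⟩
  · obtain ⟨k, f, g, rfl, rfl⟩ := germ_surj₂ s t
    have h := (pre_reindex X p k f).symm.trans (h.trans (pre_reindex X p k g))
    rw [germ_eq_iff_same] at h
    obtain ⟨i, a, h⟩ := h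
    obtain ⟨k₁, ⟨b⟩⟩ := h₁ i
    obtain ⟨k₃, t, ht⟩ := h₂
      (p.map (IsCofiltered.minToLeft k₁ k) ≫ b ≫ a) (p.map (IsCofiltered.minToRight k₁ k))
    refine germ_eq_iff_same.2 ⟨k₃, t ≫ IsCofiltered.minToRight k₁ k, ?_⟩
    change X.F.map (p.map _) ≫ f = X.F.map (p.map _) ≫ g
    rw [p.map_comp, ← ht]
    simp only [X.F.map_comp, Category.assoc, h]
  · obtain ⟨i, f, rfl⟩ := germ_surj s
    obtain ⟨k, ⟨a⟩⟩ := h₁ i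
    exact ⟨germ _ k (X.F.map a ≫ f), (pre_reindex ..).trans (germ_map a f)⟩

/-- The indices for a presentation of a morphism of pro-objects by a morphism of projective
systems: the representatives of its components. -/
structure Rep {X Y : Pro A} (φ : X ⟶ Y) : Type v where
  /-- The index of the source. -/
  i : X.I
  /-- The index of the target. -/
  j : Y.I
  /-- The representative. -/
  g : X.F.obj i ⟶ Y.F.obj j
  germ_eq : germ X i g = Hom.app φ j

namespace Rep

variable {X Y : Pro A} {φ : X ⟶ Y}

/-- Morphisms of representatives are the commutative squares. -/
@[ext]
structure Hom' (k k' : Rep φ) : Type v where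
  /-- The morphism of indices of the source. -/
  a : k.i ⟶ k'.i
  /-- The morphism of indices of the target. -/
  b : k.j ⟶ k'.j
  comm : X.F.map a ≫ k'.g = k.g ≫ Y.F.map b

instance : SmallCategory (Rep φ) where
  Hom := Hom'
  id k := ⟨𝟙 _, 𝟙 _, by simp⟩
  comp f f' := ⟨f.a ≫ f'.a, f.b ≫ f'.b, by
    rw [X.F.map_comp, Y.F.map_comp, Category.assoc, f'.comm, reassoc_of% f.comm]⟩
  id_comp f := Hom'.ext (Category.id_comp f.a) (Category.id_comp f.b)
  comp_id f := Hom'.ext (Category.comp_id f.a) (Category.comp_id f.b)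
  assoc f g h := Hom'.ext (Category.assoc f.a g.a h.a) (Category.assoc f.b g.b h.b)

theorem exists_over (φ : X ⟶ Y) (i : X.I) (j : Y.I) :
    ∃ k : Rep φ, k.j = j ∧ Nonempty (k.i ⟶ i) := by
  obtain ⟨z, a, f, h⟩ := germ_surj_over (Hom.app φ j) i
  exact ⟨⟨z, j, f, h⟩, rfl, ⟨a⟩⟩

/-- A representative can be refined to one lying over given arrows of the source and target index
categories. -/
theorem refine_to (k : Rep φ) {i : X.I} (α : i ⟶ k.i) {j : Y.I} (β : j ⟶ k.j) :
    ∃ (i' : X.I) (γ : i' ⟶ i) (g : X.F.obj i' ⟶ Y.F.obj j)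
      (_ : germ X i' g = Hom.app φ j), X.F.map (γ ≫ α) ≫ k.g = g ≫ Y.F.map β := by
  obtain ⟨z, a, f, h⟩ := germ_surj_over (Hom.app φ j) i
  have h1 : germ X z (X.F.map (a ≫ α) ≫ k.g) = germ X z (f ≫ Y.F.map β) := by
    rw [germ_map, k.germ_eq, ← Hom.compat φ β, ← h, post_germ]
  obtain ⟨w, b, e⟩ := germ_eq_iff_same.1 h1
  refine ⟨w, b ≫ a, X.F.map b ≫ f, by rw [germ_map, h], ?_⟩
  rw [Category.assoc, X.F.map_comp, Category.assoc, e, Category.assoc]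

instance : IsCofiltered (Rep φ) where
  cone_objs k k' := by
    let j := IsCofiltered.min k.j k'.j
    obtain ⟨i₁, γ₁, g₁, h₁, e₁⟩ := k.refine_to (𝟙 _) (IsCofiltered.minToLeft k.j k'.j)
    obtain ⟨i₂, γ₂, g₂, h₂, e₂⟩ := k'.refine_to (𝟙 _) (IsCofiltered.minToRight k.j k'.j)
    obtain ⟨z, a, b, e⟩ := germ_eq_iff.1 (h₁.trans h₂.symm)
    refine ⟨⟨z, j, X.F.map a ≫ g₁, by rw [germ_map, h₁]⟩,
      ⟨a ≫ γ₁ ≫ 𝟙 _, IsCofiltered.minToLeft k.j k'.j, ?_⟩,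
      ⟨b ≫ γ₂ ≫ 𝟙 _, IsCofiltered.minToRight k.j k'.j, ?_⟩, trivial⟩
    · rw [X.F.map_comp, Category.assoc, e₁, Category.assoc]
    · dsimp only
      rw [X.F.map_comp, Category.assoc, e₂, e, Category.assoc]
  cone_maps k k' f f' := by
    obtain ⟨i, γ, g, h, e⟩ := k.refine_to (IsCofiltered.eqHom f.a f'.a)
      (IsCofiltered.eqHom f.b f'.b)
    refine ⟨⟨i, _, g, h⟩, ⟨_, _, e⟩, Hom'.ext ?_ ?_⟩
    · change (γ ≫ _) ≫ f.a = (γ ≫ _) ≫ f'.a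
      rw [Category.assoc, Category.assoc, IsCofiltered.eq_condition]
    · exact IsCofiltered.eq_condition _ _
  nonempty := by
    obtain ⟨k, -⟩ := exists_over φ (IsCofiltered.nonempty (C := X.I)).some
      (IsCofiltered.nonempty (C := Y.I)).some
    exact ⟨k⟩

variable (φ) in
/-- The functor sending a representative to the index of its source. -/
def src : Rep φ ⥤ X.I where
  obj k := k.i
  map f := f.a

variable (φ) in
/-- The functor sending a representative to the index of its target. -/
def tgt : Rep φ ⥤ Y.I where
  obj k := k.j
  map f := f.b

variable (φ) in
/-- The morphism of projective systems given by the representatives. -/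
def nat : src φ ⋙ X.F ⟶ tgt φ ⋙ Y.F where
  app k := k.g
  naturality _ _ f := f.comm

variable (φ) in
theorem isIso_src : IsIso (X.reindex (src φ)) := by
  refine isIso_reindex X _ (fun i ↦ ?_) fun {i k} s s' ↦ ?_
  · obtain ⟨k, -, ha⟩ := exists_over φ i (IsCofiltered.nonempty (C := Y.I)).some
    exact ⟨k, ha⟩
  · obtain ⟨i', γ, g, h, e⟩ := k.refine_to (IsCofiltered.eqHom s s') (𝟙 _)
    refine ⟨⟨i', _, g, h⟩, ⟨_, _, e⟩, ?_⟩
    change (γ ≫ _) ≫ s = (γ ≫ _) ≫ s'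
    rw [Category.assoc, Category.assoc, IsCofiltered.eq_condition]

variable (φ) in
theorem isIso_tgt : IsIso (Y.reindex (tgt φ)) := by
  refine isIso_reindex Y _ (fun j ↦ ?_) fun {i k} s s' ↦ ?_
  · obtain ⟨k, rfl, -⟩ := exists_over φ (IsCofiltered.nonempty (C := X.I)).some j
    exact ⟨k, ⟨𝟙 _⟩⟩
  · obtain ⟨i', γ, g, h, e⟩ := k.refine_to (𝟙 _) (IsCofiltered.eqHom s s')
    exact ⟨⟨i', _, g, h⟩, ⟨_, _, e⟩, IsCofiltered.eq_condition _ _⟩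

end Rep

/-- Every morphism of pro-objects is isomorphic to one given by a morphism of projective systems
with the same index category. -/
theorem exists_arrow_iso_lev {X Y : Pro A} (φ : X ⟶ Y) :
    ∃ (K : Type v) (_ : SmallCategory K) (_ : IsCofiltered K) (F G : K ⥤ A) (α : F ⟶ G),
      Nonempty (Arrow.mk φ ≅ Arrow.mk (levMap α)) := by
  have := Rep.isIso_src φ
  have := Rep.isIso_tgt φ
  refine ⟨Rep φ, inferInstance, inferInstance, _, _, Rep.nat φ,
    ⟨Arrow.isoMk (asIso (X.reindex (Rep.src φ))) (asIso (Y.reindex (Rep.tgt φ)))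
      (hom_ext fun k ↦ ?_)⟩⟩
  refine (pre_reindex X (Rep.src φ) k k.g).trans (k.germ_eq.trans ?_)
  exact (pre_app_id φ k.j).symm

end Level

section Preadditive

variable {A : Type u} [Category.{v} A] [Preadditive A] {X Y : Pro A}

theorem germ_add_congr {c : A} {i i' j j' z z' : X.I} {f : X.F.obj i ⟶ c} {f' : X.F.obj i' ⟶ c}
    {g : X.F.obj j ⟶ c} {g' : X.F.obj j' ⟶ c} (hf : germ X i f = germ X i' f')
    (hg : germ X j g = germ X j' g') (a : z ⟶ i) (b : z ⟶ j) (a' : z' ⟶ i') (b' : z' ⟶ j') :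
    germ X z (X.F.map a ≫ f + X.F.map b ≫ g) =
      germ X z' (X.F.map a' ≫ f' + X.F.map b' ≫ g') := by
  rw [← germ_map a f, ← germ_map a' f'] at hf
  rw [← germ_map b g, ← germ_map b' g'] at hg
  rw [← germ_map (IsCofiltered.minToLeft z z'),
    ← germ_map (IsCofiltered.minToRight z z')] at hf hg ⊢
  obtain ⟨w, u, hu⟩ := germ_eq_iff_same.1 hf
  obtain ⟨w', u', hu'⟩ := germ_eq_iff_same.1 hg
  obtain ⟨x, p, q, e⟩ := IsCofiltered.cospan u u'
  refine germ_eq_iff_same.2 ⟨x, p ≫ u, ?_⟩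
  simp only [Preadditive.comp_add]
  congr 1
  · rw [X.F.map_comp, Category.assoc, hu, Category.assoc]
  · rw [e, X.F.map_comp, Category.assoc, hu', Category.assoc]

/-- Addition of germs, on a common refinement. -/
noncomputable instance (c : A) : Add (Germ X c) where
  add := Quotient.map₂ (fun p q ↦ ⟨IsCofiltered.min p.1 q.1,
    X.F.map (IsCofiltered.minToLeft p.1 q.1) ≫ p.2 +
      X.F.map (IsCofiltered.minToRight p.1 q.1) ≫ q.2⟩) (by
    intro p p' hp q q' hq
    exact Quotient.exact (germ_add_congr (Quotient.sound hp) (Quotient.sound hq) _ _ _ _))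

theorem germ_add {c : A} (i : X.I) (f g : X.F.obj i ⟶ c) :
    germ X i (f + g) = germ X i f + germ X i g := by
  have h := germ_add_congr (X := X) (i := i) (f := f) (g := g) rfl rfl (𝟙 i) (𝟙 i)
    (IsCofiltered.minToLeft i i) (IsCofiltered.minToRight i i)
  rw [X.F.map_id, Category.id_comp, Category.id_comp] at h
  exact h

noncomputable instance (c : A) : Zero (Germ X c) where
  zero := germ X (IsCofiltered.nonempty (C := X.I)).some 0

theorem germ_zero {c : A} (i : X.I) : germ X i (0 : X.F.obj i ⟶ c) = 0 :=
  germ_eq (IsCofiltered.min _ _) (IsCofiltered.minToLeft _ _) (IsCofiltered.minToRight _ _) (by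
    rw [Limits.comp_zero, Limits.comp_zero])

/-- The negative of a germ. -/
noncomputable instance (c : A) : Neg (Germ X c) where
  neg s := Quotient.map (fun p ↦ ⟨p.1, -p.2⟩) (by
    rintro p q ⟨z, a, b, h⟩
    exact ⟨z, a, b, by rw [Preadditive.comp_neg, Preadditive.comp_neg, h]⟩) s

theorem germ_neg {c : A} (i : X.I) (f : X.F.obj i ⟶ c) : germ X i (-f) = -germ X i f := rfl

noncomputable instance (c : A) : AddCommGroup (Germ X c) where
  add_assoc s t r := by
    obtain ⟨i, f, g, h, rfl, rfl, rfl⟩ := germ_surj₃ s t r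
    simp only [← germ_add, add_assoc]
  zero_add s := by
    obtain ⟨i, f, rfl⟩ := germ_surj s
    rw [← germ_zero i, ← germ_add, zero_add]
  add_zero s := by
    obtain ⟨i, f, rfl⟩ := germ_surj s
    rw [← germ_zero i, ← germ_add, add_zero]
  nsmul := nsmulRec
  zsmul := zsmulRec
  neg_add_cancel s := by
    obtain ⟨i, f, rfl⟩ := germ_surj s
    rw [← germ_neg, ← germ_add, neg_add_cancel, germ_zero]
  add_comm s t := by
    obtain ⟨i, f, g, rfl, rfl⟩ := germ_surj₂ s t
    rw [← germ_add, ← germ_add, add_comm]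

theorem add_post {c d : A} (s t : Germ X c) (g : c ⟶ d) :
    (s + t).post g = s.post g + t.post g := by
  obtain ⟨i, f, f', rfl, rfl⟩ := germ_surj₂ s t
  rw [← germ_add, post_germ, post_germ, post_germ, ← germ_add, Preadditive.add_comp]

theorem zero_post {c d : A} (g : c ⟶ d) : (0 : Germ X c).post g = 0 := by
  rw [← germ_zero (IsCofiltered.nonempty (C := X.I)).some, post_germ, Limits.zero_comp, germ_zero]

theorem neg_post {c d : A} (s : Germ X c) (g : c ⟶ d) : (-s).post g = -s.post g := by
  obtain ⟨i, f, rfl⟩ := germ_surj s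
  rw [← germ_neg, post_germ, post_germ, ← germ_neg, Preadditive.neg_comp]

theorem post_add {c d : A} (s : Germ X c) (g g' : c ⟶ d) :
    s.post (g + g') = s.post g + s.post g' := by
  obtain ⟨i, f, rfl⟩ := germ_surj s
  rw [post_germ, post_germ, post_germ, ← germ_add, Preadditive.comp_add]

theorem post_zero {c d : A} (s : Germ X c) : s.post (0 : c ⟶ d) = 0 := by
  obtain ⟨i, f, rfl⟩ := germ_surj s
  rw [post_germ, Limits.comp_zero, germ_zero]

theorem add_pre (φ : X ⟶ Y) {c : A} (s t : Germ Y c) :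
    (s + t).pre φ = s.pre φ + t.pre φ := by
  obtain ⟨i, f, f', rfl, rfl⟩ := germ_surj₂ s t
  rw [← germ_add, pre_germ, pre_germ, pre_germ, post_add]

theorem zero_pre (φ : X ⟶ Y) {c : A} : (0 : Germ Y c).pre φ = 0 := by
  rw [← germ_zero (IsCofiltered.nonempty (C := Y.I)).some, pre_germ, post_zero]

noncomputable instance (X Y : Pro A) : AddCommGroup (X ⟶ Y) :=
  have e : Function.Injective (fun (φ : X ⟶ Y) (j : Y.I) ↦ Hom.app φ j) :=
    fun _ _ h ↦ Hom.ext h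
  let _ : Add (X ⟶ Y) := ⟨fun φ ψ ↦
    { app := fun j ↦ Hom.app φ j + Hom.app ψ j
      compat := fun u ↦ by rw [add_post, Hom.compat, Hom.compat] }⟩
  let _ : Zero (X ⟶ Y) := ⟨{ app := fun _ ↦ 0, compat := fun u ↦ zero_post _ }⟩
  let _ : Neg (X ⟶ Y) := ⟨fun φ ↦
    { app := fun j ↦ -Hom.app φ j
      compat := fun u ↦ by rw [neg_post, Hom.compat] }⟩
  { add_assoc _ _ _ := e (funext fun _ ↦ add_assoc _ _ _)
    zero_add _ := e (funext fun _ ↦ zero_add _)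
    add_zero _ := e (funext fun _ ↦ add_zero _)
    nsmul := nsmulRec
    zsmul := zsmulRec
    neg_add_cancel _ := e (funext fun _ ↦ neg_add_cancel _)
    add_comm _ _ := e (funext fun _ ↦ add_comm _ _) }

theorem add_app (φ ψ : X ⟶ Y) (j : Y.I) : Hom.app (φ + ψ) j = Hom.app φ j + Hom.app ψ j := rfl

/-- The pro-objects of a preadditive category form a preadditive category. -/
noncomputable instance : Preadditive (Pro A) where
  add_comp X Y Z φ ψ χ := hom_ext fun l ↦ by
    rw [add_app, comp_app, comp_app, comp_app]
    obtain ⟨j, g, h⟩ := germ_surj (Hom.app χ l)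
    rw [← h, pre_germ, pre_germ, pre_germ, add_app, add_post]
  comp_add X Y Z φ ψ χ := hom_ext fun l ↦ by
    rw [add_app, comp_app, comp_app, comp_app, add_app, add_pre]

/-- A morphism of pro-objects is an epimorphism when it is injective on germs. -/
theorem epi_iff {X Y : Pro A} (φ : X ⟶ Y) :
    Epi φ ↔ ∀ (c : A) (s : Germ Y c), s.pre φ = 0 → s = 0 := by
  refine ⟨fun _ c s h ↦ injective_of_epi φ c (h.trans (zero_pre φ).symm), fun h ↦
    epi_of_injective φ fun c s t hst ↦ ?_⟩
  rw [← sub_eq_zero]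
  refine h c _ ?_
  rw [sub_eq_add_neg, add_pre]
  have h1 : (-t).pre φ = -t.pre φ := by
    rw [eq_neg_iff_add_eq_zero, ← add_pre, neg_add_cancel, zero_pre]
  rw [h1, ← sub_eq_add_neg, sub_eq_zero]
  exact hst

end Preadditive

end Pro

end StratPro

/-! ### Pro-objects of an abelian category -/

namespace StratPro

namespace Pro

open Limits ZeroObject

section AbelianPro

variable {A : Type u} [Category.{v} A]

section

variable {K : Type v} [SmallCategory K] [IsCofiltered K] {F G : K ⥤ A}

theorem mono_levMap (α : F ⟶ G) [∀ k, Mono (α.app k)] : Mono (levMap α) where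
  right_cancellation _ _ h := hom_ext fun k ↦
    germ_post_injective (X := _) (α.app k)
      (congrArg (fun χ ↦ Hom.app (Y := levObj G) χ k) h)

theorem epi_levMap (α : F ⟶ G) [∀ k, Epi (α.app k)] : Epi (levMap α) :=
  epi_of_injective _ fun c s t h ↦ by
    obtain ⟨k, f, g, rfl, rfl⟩ := germ_surj₂ s t
    have h := (pre_levMap α k f).symm.trans (h.trans (pre_levMap α k g))
    obtain ⟨k', a, e⟩ := germ_eq_iff_same.1 h
    refine germ_eq_iff_same.2 ⟨k', a, ?_⟩
    refine (cancel_epi (α.app k')).1 ?_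
    exact (α.naturality_assoc a f).symm.trans (e.trans (α.naturality_assoc a g))

end

theorem isIso_reindex_fst (X Y : Pro A) : IsIso (X.reindex (CategoryTheory.Prod.fst X.I Y.I)) :=
  isIso_reindex X _ (fun i ↦ ⟨(i, (IsCofiltered.nonempty (C := Y.I)).some), ⟨𝟙 _⟩⟩)
    fun {_ k} s s' ↦ ⟨(IsCofiltered.eq s s', k.2), (IsCofiltered.eqHom s s', 𝟙 _),
      IsCofiltered.eq_condition s s'⟩

theorem isIso_reindex_snd (X Y : Pro A) : IsIso (Y.reindex (CategoryTheory.Prod.snd X.I Y.I)) :=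
  isIso_reindex Y _ (fun i ↦ ⟨((IsCofiltered.nonempty (C := X.I)).some, i), ⟨𝟙 _⟩⟩)
    fun {_ k} s s' ↦ ⟨(k.1, IsCofiltered.eq s s'), (𝟙 _, IsCofiltered.eqHom s s'),
      IsCofiltered.eq_condition s s'⟩

variable [Abelian A]

section

variable {K : Type v} [SmallCategory K] [IsCofiltered K] {F G : K ⥤ A}

instance : (lev A K).Additive where
  map_add {F _} α β := hom_ext fun k ↦ germ_add (X := levObj F) k (α.app k) (β.app k)

theorem levMap_zero : levMap (0 : F ⟶ G) = 0 := (lev A K).map_zero F G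

/-- A germ annihilated by `f` factors through a kernel of `f`. -/
theorem exists_post_eq {X : Pro A} {c d : A} (f : c ⟶ d) {s : Germ X c} (h : s.post f = 0)
    {e : A} (u : e ⟶ c) (w : u ≫ f = 0) (hu : IsLimit (KernelFork.ofι u w)) :
    ∃ t : Germ X e, t.post u = s := by
  obtain ⟨i, g, rfl⟩ := germ_surj s
  rw [post_germ, ← germ_zero i, germ_eq_iff_same] at h
  obtain ⟨z, a, h⟩ := h
  obtain ⟨l, hl⟩ := KernelFork.IsLimit.lift' hu (X.F.map a ≫ g) (by
    rw [Category.assoc, h, comp_zero])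
  exact ⟨germ X z l, by
    rw [post_germ, ← germ_map a g, ← hl]
    rfl⟩

/-- A kernel of a morphism of projective systems is a kernel of the morphism of pro-objects. -/
noncomputable def isLimitLevMap (α : F ⟶ G) :
    IsLimit (KernelFork.ofι (levMap (kernel.ι α)) (f := levMap α) (by
      exact ((lev A K).map_comp _ _).symm.trans
        ((congrArg (lev A K).map (kernel.condition α)).trans levMap_zero))) := by
  have : ∀ k, Mono ((kernel.ι α).app k) := inferInstance
  have := mono_levMap (kernel.ι α)
  refine KernelFork.IsLimit.ofι' _ _ fun {Z} φ hφ ↦ ?_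
  have h1 (k : K) : ∃ t : Germ Z ((kernel α).obj k), t.post ((kernel.ι α).app k) = Hom.app φ k := by
    have h2 := KernelFork.mapIsLimit _ (kernelIsKernel α) ((evaluation K A).obj k)
    exact exists_post_eq (α.app k) (congrArg (fun χ ↦ Hom.app (Y := levObj G) χ k) hφ) _
      (NatTrans.congr_app (kernel.condition α) k) h2
  choose t ht using h1
  refine ⟨{ app := t, compat := fun {j j'} u ↦ germ_post_injective ((kernel.ι α).app j') ?_ },
    hom_ext ht⟩
  rw [post_post, ht]
  dsimp
  rw [(kernel.ι α).naturality, ← post_post, ht]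
  exact Hom.compat φ u

/-- A levelwise cokernel of a morphism of projective systems is a cokernel of the morphism of
pro-objects. -/
noncomputable def isColimitLevMap {H : K ⥤ A} (α : F ⟶ G) (π : G ⟶ H) (w : α ≫ π = 0)
    (hπ : ∀ k, IsColimit (CokernelCofork.ofπ (π.app k) (NatTrans.congr_app w k))) :
    IsColimit (CokernelCofork.ofπ (levMap π) (f := levMap α) (by
      exact ((lev A K).map_comp _ _).symm.trans
        ((congrArg (lev A K).map w).trans levMap_zero))) := by
  have : ∀ k, Epi (π.app k) := fun k ↦ Cofork.IsColimit.epi (hπ k)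
  have := epi_levMap π
  refine CokernelCofork.IsColimit.ofπ' _ _ fun {Z} φ hφ ↦ ?_
  have h1 (j : Z.I) : ∃ t : Germ (levObj H) (Z.F.obj j), t.pre (levMap π) = Hom.app φ j := by
    obtain ⟨k, g, hg⟩ := germ_surj (Hom.app φ j)
    have h2 : germ (levObj F) k (α.app k ≫ g) = germ (levObj F) k 0 := by
      rw [germ_zero, ← pre_levMap, hg]
      exact congrArg (fun χ ↦ Hom.app χ j) hφ
    obtain ⟨z, a, h2⟩ := germ_eq_iff_same.1 h2
    obtain ⟨l, hl⟩ := CokernelCofork.IsColimit.desc' (hπ z) (G.map a ≫ g) (by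
      refine (α.naturality_assoc a g).symm.trans (h2.trans ?_)
      rw [comp_zero])
    refine ⟨germ (levObj H) z l, ?_⟩
    refine (pre_levMap π z l).trans (Eq.trans ?_ hg)
    exact (congrArg (germ (levObj G) z) hl).trans (germ_map (X := levObj G) a g)
  choose t ht using h1
  refine ⟨{ app := t, compat := fun {j j'} u ↦ injective_of_epi (levMap π) _ ?_ },
    hom_ext ht⟩
  change ((t j).post _).pre _ = (t j').pre _
  rw [pre_post, ht, ht]
  exact Hom.compat φ u

/-- A cokernel of projective systems gives a cokernel of pro-objects. -/
noncomputable def isColimitLevMapCokernel (α : F ⟶ G) :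
    IsColimit (CokernelCofork.ofπ (levMap (cokernel.π α)) (f := levMap α) (by
      exact ((lev A K).map_comp _ _).symm.trans
        ((congrArg (lev A K).map (cokernel.condition α)).trans levMap_zero))) :=
  isColimitLevMap α (cokernel.π α) (cokernel.condition α) fun k ↦
    CokernelCofork.mapIsColimit _ (cokernelIsCokernel α) ((evaluation K A).obj k)

instance (α : F ⟶ G) : PreservesLimit (parallelPair α 0) (lev A K) :=
  preservesLimit_of_preserves_limit_cone (kernelIsKernel α)
    ((KernelFork.isLimitMapConeEquiv _ _).symm (isLimitLevMap α))

instance (α : F ⟶ G) : PreservesColimit (parallelPair α 0) (lev A K) :=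
  preservesColimit_of_preserves_colimit_cocone (cokernelIsCokernel α)
    ((CokernelCofork.isColimitMapCoconeEquiv _ _).symm (isColimitLevMapCokernel α))

end

instance : HasKernels (Pro A) where
  has_limit {X Y} φ := by
    obtain ⟨K, _, _, F, G, α, ⟨e⟩⟩ := exists_arrow_iso_lev φ
    have h : HasKernel (levMap α) := ⟨⟨_, isLimitLevMap α⟩⟩
    have e' := parallelPair.ext (F := parallelPair φ 0) (G := parallelPair (levMap α) 0)
      (Arrow.leftFunc.mapIso e) (Arrow.rightFunc.mapIso e) e.hom.w.symm
      (zero_comp.trans comp_zero.symm)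
    exact hasLimit_of_iso (F := parallelPair (levMap α) 0) e'.symm

instance : HasCokernels (Pro A) where
  has_colimit {X Y} φ := by
    obtain ⟨K, _, _, F, G, α, ⟨e⟩⟩ := exists_arrow_iso_lev φ
    have h : HasCokernel (levMap α) := ⟨⟨_, isColimitLevMapCokernel α⟩⟩
    have e' := parallelPair.ext (F := parallelPair φ 0) (G := parallelPair (levMap α) 0)
      (Arrow.leftFunc.mapIso e) (Arrow.rightFunc.mapIso e) e.hom.w.symm
      (zero_comp.trans comp_zero.symm)
    exact hasColimit_of_iso (F := parallelPair (levMap α) 0) e'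

instance : HasBinaryProducts (Pro A) := by
  have (X Y : Pro A) : HasLimit (pair X Y) := by
    have := isIso_reindex_fst X Y
    have := isIso_reindex_snd X Y
    let F := CategoryTheory.Prod.fst X.I Y.I ⋙ X.F
    let G := CategoryTheory.Prod.snd X.I Y.I ⋙ Y.F
    have := preservesBinaryBiproducts_of_preservesBiproducts (lev A (X.I × Y.I))
    have : HasBinaryBiproduct ((lev A (X.I × Y.I)).obj F) ((lev A (X.I × Y.I)).obj G) :=
      Functor.hasBinaryBiproduct_of_preserves (lev A (X.I × Y.I)) F G
    exact hasLimit_of_iso (F := pair ((lev A (X.I × Y.I)).obj F) ((lev A (X.I × Y.I)).obj G))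
      (mapPairIso (asIso (X.reindex _)).symm (asIso (Y.reindex _)).symm)
  exact hasBinaryProducts_of_hasLimit_pair _

instance : HasZeroObject (Pro A) := by
  refine ⟨levObj (0 : Discrete PUnit.{v + 1} ⥤ A), ?_⟩
  rw [IsZero.iff_id_eq_zero]
  have h : 𝟙 (0 : Discrete PUnit.{v + 1} ⥤ A) = 0 := (isZero_zero _).eq_of_src _ _
  exact ((lev A _).map_id _).symm.trans ((congrArg _ h).trans levMap_zero)

instance : HasFiniteProducts (Pro A) :=
  have : HasTerminal (Pro A) := HasZeroObject.hasTerminal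
  hasFiniteProducts_of_has_binary_and_terminal

/-- A morphism of pro-objects is isomorphic to a morphism of projective systems over a common index
category, and `lev` preserves kernels and cokernels: this reduces the statement to the abelian
category of functors. -/
instance {X Y : Pro A} (f : X ⟶ Y) : IsIso (Abelian.coimageImageComparison f) := by
  obtain ⟨K, _, _, F, G, α, ⟨i⟩⟩ := exists_arrow_iso_lev f
  refine ((MorphismProperty.isomorphisms (Pro A)).arrow_mk_iso_iff
    (Abelian.coimageImageComparisonFunctor.mapIso i)).2 ?_
  refine ((MorphismProperty.isomorphisms (Pro A)).arrow_mk_iso_iff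
    (Abelian.PreservesCoimageImageComparison.iso (lev A K) α)).1 ?_
  exact (inferInstance : IsIso ((lev A K).map (Abelian.coimageImageComparison α)))

/-- The pro-objects of an abelian category form an abelian category. -/
noncomputable instance : Abelian (Pro A) :=
  .ofCoimageImageComparisonIsIso

end AbelianPro

end Pro

end StratPro

/-! ### Cofiltered limits of pro-objects -/

namespace StratPro

namespace Pro

open Limits

section CofilteredLimits

variable {A : Type u} [Category.{v} A] {J : Type v} [SmallCategory J]

/-- The index category of the limit of a projective system `D` of pro-objects: pairs of an index
`j` and an index of `D.obj j`. -/
structure Tot (D : J ⥤ Pro A) : Type v where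
  /-- The index in `J`. -/
  j : J
  /-- The index of the pro-object. -/
  i : (D.obj j).I

namespace Tot

variable {D : J ⥤ Pro A}

/-- A morphism over `u : j ⟶ j'` is a representative of the component of `D.map u`. -/
@[ext]
structure Hom' (p p' : Tot D) : Type v where
  /-- The morphism in `J`. -/
  u : p.j ⟶ p'.j
  /-- The representative. -/
  g : (D.obj p.j).F.obj p.i ⟶ (D.obj p'.j).F.obj p'.i
  germ_eq : germ (D.obj p.j) p.i g = Hom.app (D.map u) p'.i

theorem germ_comp {j j' j'' : J} {u : j ⟶ j'} {u' : j' ⟶ j''} {i : (D.obj j).I}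
    {i' : (D.obj j').I} {i'' : (D.obj j'').I} {g : (D.obj j).F.obj i ⟶ (D.obj j').F.obj i'}
    {g' : (D.obj j').F.obj i' ⟶ (D.obj j'').F.obj i''}
    (h : germ (D.obj j) i g = Hom.app (D.map u) i')
    (h' : germ (D.obj j') i' g' = Hom.app (D.map u') i'') :
    germ (D.obj j) i (g ≫ g') = Hom.app (D.map (u ≫ u')) i'' := by
  rw [← post_germ, h, D.map_comp, comp_app, ← h']
  rfl

theorem germ_id {j : J} (i : (D.obj j).I) : germ (D.obj j) i (𝟙 _) = Hom.app (D.map (𝟙 j)) i := by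
  rw [D.map_id]
  rfl

instance : SmallCategory (Tot D) where
  Hom := Hom'
  id p := ⟨𝟙 _, 𝟙 _, germ_id p.i⟩
  comp f f' := ⟨f.u ≫ f'.u, f.g ≫ f'.g, germ_comp f.germ_eq f'.germ_eq⟩
  id_comp f := Hom'.ext (Category.id_comp f.u) (Category.id_comp f.g)
  comp_id f := Hom'.ext (Category.comp_id f.u) (Category.comp_id f.g)
  assoc f g h := Hom'.ext (Category.assoc f.u g.u h.u) (Category.assoc f.g g.g h.g)

instance [IsCofiltered J] : IsCofiltered (Tot D) where
  cone_objs p p' := by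
    obtain ⟨i, g, g', h, h'⟩ := germ_surj₂ (Hom.app (D.map (IsCofiltered.minToLeft p.j p'.j)) p.i)
      (Hom.app (D.map (IsCofiltered.minToRight p.j p'.j)) p'.i)
    exact ⟨⟨_, i⟩, ⟨_, g, h⟩, ⟨_, g', h'⟩, trivial⟩
  cone_maps p p' f f' := by
    obtain ⟨i, g, h⟩ := germ_surj (Hom.app (D.map (IsCofiltered.eqHom f.u f'.u)) p.i)
    have h1 := germ_comp h f.germ_eq
    rw [IsCofiltered.eq_condition, ← germ_comp h f'.germ_eq] at h1
    obtain ⟨z, a, e⟩ := germ_eq_iff_same.1 h1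
    refine ⟨⟨_, z⟩, ⟨_, (D.obj _).F.map a ≫ g, (germ_map a g).trans h⟩, Hom'.ext ?_ ?_⟩
    · exact IsCofiltered.eq_condition _ _
    · exact (Category.assoc _ _ _).trans (e.trans (Category.assoc _ _ _).symm)
  nonempty := ⟨⟨IsCofiltered.nonempty.some, (IsCofiltered.nonempty (C := (D.obj _).I)).some⟩⟩

variable (D) in
/-- The underlying projective system in `A`. -/
def sys : Tot D ⥤ A where
  obj p := (D.obj p.j).F.obj p.i
  map f := f.g

/-- The arrow of `Tot D` given by an arrow in the index category of one of the pro-objects. -/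
def ofIndex {j : J} {i i' : (D.obj j).I} (a : i ⟶ i') : (⟨j, i⟩ : Tot D) ⟶ ⟨j, i'⟩ where
  u := 𝟙 j
  g := (D.obj j).F.map a
  germ_eq := by rw [← germ_id, ← germ_map a (𝟙 _), Category.comp_id]

end Tot

open Tot

theorem pre_π_w {D : J ⥤ Pro A} (c : Cone D) {x : A} {j j' : J} (u : j ⟶ j')
    (t : Germ (D.obj j') x) : (t.pre (D.map u)).pre (c.π.app j) = t.pre (c.π.app j') := by
  rw [← c.w u]
  exact (pre_comp _ _ t).symm

variable [IsCofiltered J] (D : J ⥤ Pro A)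

/-- The limit cone of a cofiltered system of pro-objects. -/
def limitCone : Cone D where
  pt := levObj (sys D)
  π :=
    { app := fun j ↦
        { app := fun i ↦ germ (levObj (sys D)) ⟨j, i⟩ (𝟙 ((D.obj j).F.obj i))
          compat := fun {i i'} a ↦ by
            refine Eq.trans ?_ (germ_map (X := levObj (sys D)) (ofIndex a) (𝟙 _))
            exact congrArg (germ (levObj (sys D)) ⟨j, i⟩)
              ((Category.id_comp _).trans (Category.comp_id _).symm) }
      naturality := fun j j' u ↦ by
        refine (Category.id_comp _).trans (hom_ext fun i' ↦ ?_)
        obtain ⟨i, g, h⟩ := germ_surj (Hom.app (D.map u) i')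
        rw [comp_app, ← h]
        refine (germ_map (X := levObj (sys D)) (i := ⟨j', i'⟩) (i' := ⟨j, i⟩) ⟨u, g, h⟩
          (𝟙 _)).symm.trans (congrArg (germ (levObj (sys D)) ⟨j, i⟩) ?_)
        exact (Category.comp_id g).trans (Category.id_comp g).symm }

theorem pre_limitCone (j : J) (i : (D.obj j).I) {x : A} (f : (D.obj j).F.obj i ⟶ x) :
    (germ (D.obj j) i f).pre ((limitCone D).π.app j) = germ (levObj (sys D)) ⟨j, i⟩ f :=
  congrArg (germ (levObj (sys D)) ⟨j, i⟩) (Category.id_comp f)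

/-- The cone `limitCone D` is a limit. -/
def isLimitLimitCone : IsLimit (limitCone D) where
  lift s :=
    { app := fun p ↦ Hom.app (s.π.app p.j) p.i
      compat := fun {p p'} f ↦ by
        rw [← s.w f.u, comp_app, ← f.germ_eq]
        rfl }
  fac s j := hom_ext fun i ↦ post_id (X := s.pt) (Hom.app (s.π.app j) i)
  uniq s m h := hom_ext fun p ↦ by
    refine (pre_app_id m p).symm.trans ?_
    exact congrArg (fun χ ↦ Hom.app χ p.i) (h p.j)

instance : HasLimitsOfShape J (Pro A) where
  has_limit D := ⟨⟨_, isLimitLimitCone D⟩⟩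

variable {D}

/-- The germs of the vertex of the cone are the colimit of the germs of the `D.obj j`, in elementary
terms. -/
structure IsGermLimit (c : Cone D) : Prop where
  surj {x : A} (s : Germ c.pt x) : ∃ (j : J) (t : Germ (D.obj j) x), t.pre (c.π.app j) = s
  inj {x : A} {j : J} (t t' : Germ (D.obj j) x) (h : t.pre (c.π.app j) = t'.pre (c.π.app j)) :
    ∃ (j' : J) (u : j' ⟶ j), t.pre (D.map u) = t'.pre (D.map u)

variable (D) in
theorem isGermLimit_limitCone : IsGermLimit (limitCone D) where
  surj {x} s := by
    obtain ⟨p, f, rfl⟩ := germ_surj s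
    exact ⟨p.j, germ (D.obj p.j) p.i f, pre_limitCone D p.j p.i f⟩
  inj {x j} t t' h := by
    obtain ⟨i, f, f', rfl, rfl⟩ := germ_surj₂ t t'
    have h := (pre_limitCone D j i f).symm.trans (h.trans (pre_limitCone D j i f'))
    obtain ⟨z, a, e⟩ := germ_eq_iff_same.1 h
    refine ⟨z.j, a.u, ?_⟩
    rw [pre_germ, pre_germ]
    refine (congrArg (Germ.post · f) a.germ_eq.symm).trans
      (Eq.trans ?_ (congrArg (Germ.post · f') a.germ_eq))
    exact congrArg (germ (D.obj z.j) z.i) e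

/-- A cone over a cofiltered system of pro-objects is a limit exactly when the germs of its vertex
are the colimit of the germs of the terms. -/
theorem nonempty_isLimit_iff (c : Cone D) : Nonempty (IsLimit c) ↔ IsGermLimit c := by
  have hL := isGermLimit_limitCone D
  constructor
  · rintro ⟨hc⟩
    let e := hc.conePointUniqueUpToIso (isLimitLimitCone D)
    have he (j : J) {x : A} (t : Germ (D.obj j) x) :
        (t.pre (c.π.app j)).pre e.inv = t.pre ((limitCone D).π.app j) := by
      rw [← hc.conePointUniqueUpToIso_inv_comp (isLimitLimitCone D)]
      exact (pre_comp _ _ t).symm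
    have hinj {x : A} (s s' : Germ c.pt x) (h : s.pre e.inv = s'.pre e.inv) : s = s' :=
      injective_of_epi e.inv x h
    refine ⟨fun {x} s ↦ ?_, fun {x j} t t' h ↦ ?_⟩
    · obtain ⟨j, t, ht⟩ := hL.surj (s.pre e.inv)
      exact ⟨j, t, hinj _ _ ((he j t).trans ht)⟩
    · exact hL.inj t t' (by rw [← he, h, he])
  · intro h
    have hp (j : J) {x : A} (t : Germ (D.obj j) x) :
        (t.pre ((limitCone D).π.app j)).pre ((isLimitLimitCone D).lift c) = t.pre (c.π.app j) := by
      rw [← (isLimitLimitCone D).fac c j]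
      exact (pre_comp _ _ t).symm
    have : IsIso ((isLimitLimitCone D).lift c) := isIso_of_bijective _ fun x ↦ by
      refine ⟨fun s s' hs ↦ ?_, fun s ↦ ?_⟩
      · obtain ⟨j, t, rfl⟩ := hL.surj s
        obtain ⟨j', t', rfl⟩ := hL.surj s'
        rw [← pre_π_w _ (IsCofiltered.minToLeft j j') t,
          ← pre_π_w _ (IsCofiltered.minToRight j j') t'] at hs ⊢
        obtain ⟨k, u, e⟩ := h.inj _ _ ((hp _ _).symm.trans (hs.trans (hp _ _)))
        rw [← pre_π_w _ u, e, pre_π_w _ u]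
      · obtain ⟨j, t, rfl⟩ := h.surj s
        exact ⟨_, hp j t⟩
    exact ⟨IsLimit.ofPointIso (isLimitLimitCone D)⟩

/-- Cofiltered limits of pro-objects of an abelian category are exact. -/
theorem hasExactLimitsOfShape {A : Type u} [Category.{v} A] [Abelian A] :
    HasExactLimitsOfShape J (Pro A) := by
  have : (lim (J := J) (C := Pro A)).PreservesEpimorphisms := ⟨fun {D D'} α hα ↦ by
    have hl := (nonempty_isLimit_iff _).1 ⟨limit.isLimit D⟩
    have hl' := (nonempty_isLimit_iff _).1 ⟨limit.isLimit D'⟩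
    refine (epi_iff _).2 fun x s hs ↦ ?_
    -- A germ which vanishes on the limit of `D` vanishes on some `D.obj j'`, where `α` is an
    -- epimorphism.
    obtain ⟨j, t, rfl⟩ := hl'.surj s
    have h1 : (t.pre (α.app j)).pre ((limit.cone D).π.app j) = 0 := by
      refine Eq.trans ?_ hs
      refine (pre_comp _ _ t).symm.trans (Eq.trans ?_ (pre_comp _ _ t))
      exact congrArg (Germ.pre · t) (limMap_π α j).symm
    obtain ⟨j', u, e⟩ := hl.inj _ 0 (h1.trans (zero_pre _).symm)
    have h2 : (t.pre (D'.map u)).pre (α.app j') = 0 := by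
      refine Eq.trans ?_ (e.trans (zero_pre _))
      refine (pre_comp _ _ t).symm.trans (Eq.trans ?_ (pre_comp _ _ t))
      exact congrArg (Germ.pre · t) (α.naturality u).symm
    rw [← pre_π_w _ u, (epi_iff _).1 inferInstance _ _ h2, zero_pre]⟩
  exact hasExactLimitsOfShape_of_preservesEpi ..

end CofilteredLimits

end Pro

namespace Tower

open Pro Limits

variable {A : Type u} [Category.{v} A] (t : Tower A) {J : Type v} [SmallCategory J]
  [IsCofiltered J]

theorem germ_eq_post {X : Pro A} {x : A} (p : (t.proObj X).I)
    (f : (t.T p.1.unop).obj (X.F.obj p.2) ⟶ x) :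
    Pro.germ (t.proObj X) p f = (germ (t := t) p.1.unop (Pro.germ X p.2 (𝟙 _))).post f := by
  rw [germ_germ, CategoryTheory.Functor.map_id, post_germ, Category.id_comp]

/-- The extension of a tower to pro-objects preserves limit cones: an identity between two
morphisms `Tₘ(F) ⟶ x` which holds on the limit involves a single index and a single `m`, so it
holds at some stage of the system. -/
theorem pro_isGermLimit {D : J ⥤ Pro A} {c : Cone D} (hc : IsGermLimit c) :
    IsGermLimit (t.pro.mapCone c) where
  surj {x} s := by
    obtain ⟨p, f, rfl⟩ := germ_surj s
    obtain ⟨j, r, h⟩ := hc.surj (Pro.germ c.pt p.2 (𝟙 _))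
    refine ⟨j, (germ (t := t) p.1.unop r).post f, ?_⟩
    refine Eq.trans (pre_post _ _ _) ?_
    refine Eq.trans ?_ (t.germ_eq_post p f).symm
    rw [← h]
    exact congrArg (Germ.post · f) (t.germ_pre p.1.unop (c.π.app j) r)
  inj {x j} s s' h := by
    obtain ⟨⟨m, i⟩, f, f', rfl, rfl⟩ := germ_surj₂ s s'
    induction m using Opposite.rec with | op m => ?_
    obtain ⟨k, g, hg⟩ := germ_surj (Hom.app (c.π.app j) i)
    have h1 (f : (t.T m).obj ((D.obj j).F.obj i) ⟶ x) :
        Germ.pre (t.proMap (c.π.app j)) (Pro.germ (t.proObj (D.obj j)) (op m, i) f) =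
          Pro.germ (t.proObj c.pt) (op m, k) ((t.T m).map g ≫ f) := by
      refine (pre_germ _ _ _).trans ?_
      refine (congrArg (fun s ↦ (germ (t := t) m s).post f) hg.symm)
    have h := (h1 f).symm.trans (h.trans (h1 f'))
    obtain ⟨⟨m', k'⟩, ⟨b, a⟩, e⟩ := germ_eq_iff_same.1 h
    have hm : m ≤ m'.unop := leOfHom b.unop
    let g' := c.pt.F.map a ≫ g
    have hg' : Pro.germ c.pt k' g' = Hom.app (c.π.app j) i := (germ_map a g).trans hg
    have e₁ (f : (t.T m).obj ((D.obj j).F.obj i) ⟶ x) :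
        (t.q hm).app _ ≫ (t.T m).map g' ≫ f =
          ((t.q hm).app _ ≫ (t.T m).map (c.pt.F.map a)) ≫ (t.T m).map g ≫ f := by
      rw [CategoryTheory.Functor.map_comp, Category.assoc, Category.assoc]
    have e' := (e₁ f).trans (e.trans (e₁ f').symm)
    -- The relation `e'` holds at the index `k'` of `c.pt`; `r` carries that index to a stage `j₁`,
    -- and on `j₃` the morphism `r` followed by `g'` is the transition morphism to `(j, i)`.
    obtain ⟨j₁, r, hr⟩ := hc.surj (Pro.germ c.pt k' (𝟙 _))
    let j₂ := IsCofiltered.min j j₁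
    have h2 : ((Pro.germ (D.obj j) i (𝟙 _)).pre (D.map (IsCofiltered.minToLeft j j₁))).pre
        (c.π.app j₂) = ((r.post g').pre (D.map (IsCofiltered.minToRight j j₁))).pre
        (c.π.app j₂) := by
      rw [pre_π_w, pre_π_w, pre_app_id, ← hg']
      refine Eq.trans ?_ (pre_post _ _ _).symm
      rw [hr]
      exact congrArg (Pro.germ c.pt k') (Category.id_comp g').symm
    obtain ⟨j₃, w, h3⟩ := hc.inj _ _ h2
    refine ⟨j₃, w ≫ IsCofiltered.minToLeft j j₁, ?_⟩
    let r' := (r.pre (D.map (IsCofiltered.minToRight j j₁))).pre (D.map w)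
    have h4 : Hom.app (D.map (w ≫ IsCofiltered.minToLeft j j₁)) i = r'.post g' := by
      rw [D.map_comp, comp_app, ← pre_app_id (D.map (IsCofiltered.minToLeft j j₁)) i]
      refine h3.trans ?_
      rw [pre_post, pre_post]
    have h5 (f : (t.T m).obj ((D.obj j).F.obj i) ⟶ x) :
        Germ.pre (t.proMap (D.map (w ≫ IsCofiltered.minToLeft j j₁)))
          (Pro.germ (t.proObj (D.obj j)) (op m, i) f) =
        (germ (t := t) m'.unop r').post ((t.q hm).app _ ≫ (t.T m).map g' ≫ f) := by
      refine (pre_germ _ _ _).trans ?_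
      refine (congrArg (fun s ↦ (germ (t := t) m s).post f) h4).trans ?_
      rw [← germ_post, post_post, ← germ_q hm, post_post]
    exact (h5 f).trans ((congrArg _ e').trans (h5 f').symm)

/-- The extension of a tower to pro-objects preserves cofiltered limits. -/
instance : PreservesLimitsOfShape J t.pro where
  preservesLimit {_} := ⟨fun {_} hc ↦ (nonempty_isLimit_iff _).2
    (t.pro_isGermLimit ((nonempty_isLimit_iff _).1 ⟨hc⟩))⟩

end Tower

end StratPro

/-! ### Exact towers and coalgebras over exact comonads -/

namespace StratPro

namespace Tower

open Pro Limits

section Exactness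

variable {A : Type u} [Category.{v} A] (t : Tower A)

/-- The projective system `{Tₘ(F k)}` defined by a projective system `F`. -/
abbrev sys {K : Type v} [SmallCategory K] [IsCofiltered K] (F : K ⥤ A) : ℕᵒᵖ × K ⥤ A :=
  (t.proObj (levObj F)).F

/-- The morphism of the projective systems `{Tₘ(F k)}` defined by a morphism of projective
systems. -/
def sysMap {K : Type v} [SmallCategory K] [IsCofiltered K] {F G : K ⥤ A} (α : F ⟶ G) :
    t.sys F ⟶ t.sys G where
  app p := (t.T p.1.unop).map (α.app p.2)
  naturality p p' u := by
    dsimp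
    rw [Category.assoc, ← CategoryTheory.Functor.map_comp, α.naturality, NatTrans.naturality_assoc,
      CategoryTheory.Functor.map_comp]

variable [Abelian A]

/-- The exactness properties of the tower `(𝒫ᵐ ⊗ -)ₘ`: right exactness of its terms, and a weak
form of the Artin-Rees property, which is what is left of flatness of the `𝒫ᵐ` when they are not
assumed to be locally free. -/
class IsExact : Prop where
  additive (m : ℕ) : (t.T m).Additive
  preservesFiniteColimits (m : ℕ) : PreservesFiniteColimits (t.T m)
  artinRees {F G : A} (u : F ⟶ G) (hu : Mono u) (m : ℕ) : ∃ (r : ℕ) (h : m ≤ r),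
    ∀ (Z : A) (z : Z ⟶ (t.T r).obj F), z ≫ (t.T r).map u = 0 → z ≫ (t.q h).app F = 0

attribute [instance] IsExact.additive IsExact.preservesFiniteColimits

variable [t.IsExact]

instance : t.pro.Additive where
  map_add {X Y φ ψ} := hom_ext fun p ↦ by
    obtain ⟨i, f, g, h, h'⟩ := germ_surj₂ (Hom.app φ p.2) (Hom.app ψ p.2)
    have e (χ : X ⟶ Y) : Hom.app (t.proMap χ) p = germ (t := t) p.1.unop (Hom.app χ p.2) := rfl
    refine (e (φ + ψ)).trans (Eq.trans ?_ (congrArg₂ (· + ·) (e φ) (e ψ)).symm)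
    rw [add_app, ← h, ← h', ← Pro.germ_add, germ_germ, germ_germ, germ_germ, Functor.map_add,
      Pro.germ_add]

instance : PreservesFiniteColimits t.pro := by
  refine (t.pro.preservesFiniteColimits_tfae.out 2 3).1 fun X Y φ ↦ ?_
  obtain ⟨K, _, _, F, G, α, ⟨e⟩⟩ := exists_arrow_iso_lev φ
  have e' := parallelPair.ext (F := parallelPair φ 0) (G := parallelPair (levMap α) 0)
    (Arrow.leftFunc.mapIso e) (Arrow.rightFunc.mapIso e) e.hom.w.symm
    (zero_comp.trans comp_zero.symm)
  have h : PreservesColimit (parallelPair (levMap α) 0) t.pro := by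
    refine preservesColimit_of_preserves_colimit_cocone (isColimitLevMapCokernel α)
      ((CokernelCofork.isColimitMapCoconeEquiv _ _).symm ?_)
    refine isColimitLevMap (t.sysMap α) (t.sysMap (cokernel.π α)) ?_ fun p ↦ ?_
    · ext p
      refine ((t.T p.1.unop).map_comp _ _).symm.trans ?_
      rw [← NatTrans.comp_app, cokernel.condition]
      exact (t.T _).map_zero _ _
    · exact CokernelCofork.mapIsColimit _ (CokernelCofork.mapIsColimit _ (cokernelIsCokernel α)
        ((evaluation K A).obj p.2)) (t.T p.1.unop)
  exact preservesColimit_of_iso_diagram _ e'.symm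

/-- The Artin–Rees condition makes the extension of a tower to pro-objects preserve levelwise
monomorphisms: a morphism killed at the level `r` is zero at the level `m`. -/
theorem mono_proMap_levMap {K : Type v} [SmallCategory K] [IsCofiltered K] {F G : K ⥤ A}
    (α : F ⟶ G) [∀ k, Mono (α.app k)] : Mono (t.proMap (levMap α)) := by
  refine Preadditive.mono_of_cancel_zero _ fun {Z} χ hχ ↦ hom_ext fun p ↦ ?_
  obtain ⟨m, k⟩ := p
  induction m using Opposite.rec with | op m => ?_
  obtain ⟨r, h, H⟩ := IsExact.artinRees (t := t) (α.app k) inferInstance m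
  obtain ⟨z, g, hg⟩ := germ_surj (Hom.app χ ((op r, k) : ℕᵒᵖ × K))
  have h1 : Hom.app (χ ≫ t.proMap (levMap α)) ((op r, k) : ℕᵒᵖ × K) = 0 := by rw [hχ]; rfl
  have h2 : Pro.germ Z z (g ≫ (t.T r).map (α.app k)) = Pro.germ Z z 0 := by
    rw [germ_zero, ← h1, ← post_germ, hg]
    rfl
  obtain ⟨z', a, h2⟩ := germ_eq_iff_same.1 h2
  have h3 := H _ (Z.F.map a ≫ g) (by rw [Category.assoc, h2, comp_zero])
  have h4 := Hom.compat χ (j := ((op r, k) : ℕᵒᵖ × K)) (j' := (op m, k)) ((homOfLE h).op, 𝟙 k)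
  refine h4.symm.trans ?_
  rw [← hg, ← Pro.germ_map a g]
  refine Eq.trans ?_ (germ_zero z')
  rw [post_germ]
  refine congrArg (Pro.germ Z z') ?_
  dsimp
  rw [← Category.assoc, h3, zero_comp]

instance : t.pro.PreservesMonomorphisms where
  preserves {X Y} φ hφ := by
    obtain ⟨K, _, _, F, G, α, ⟨e⟩⟩ := exists_arrow_iso_lev φ
    have h1 : Mono (levMap α) :=
      ((MorphismProperty.monomorphisms (Pro A)).arrow_mk_iso_iff e).1 hφ
    refine ((MorphismProperty.monomorphisms (Pro A)).arrow_mk_iso_iff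
      (t.pro.mapArrow.mapIso e)).2 ?_
    change Mono (t.proMap (levMap α))
    -- A monomorphism of pro-objects need not be levelwise mono, but it becomes so after replacing
    -- the source by the levelwise image, which does not change the pro-object.
    have h2 : levMap (Abelian.factorThruImage α) ≫ levMap (Abelian.image.ι α) = levMap α :=
      ((lev A K).map_comp _ _).symm.trans (congrArg levMap (Abelian.image.fac α))
    have : ∀ k, Epi ((Abelian.factorThruImage α).app k) := inferInstance
    have : ∀ k, Mono ((Abelian.image.ι α).app k) := inferInstance
    have := epi_levMap (Abelian.factorThruImage α)
    have : Mono (levMap (Abelian.factorThruImage α)) := by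
      rw [← h2] at h1
      exact mono_of_mono _ (levMap (Abelian.image.ι α))
    have : IsIso (levMap (Abelian.factorThruImage α)) := isIso_of_mono_of_epi _
    have : Mono (t.pro.map (levMap (Abelian.image.ι α))) :=
      t.mono_proMap_levMap (Abelian.image.ι α)
    rw [← h2]
    have h3 := t.pro.map_comp (levMap (Abelian.factorThruImage α)) (levMap (Abelian.image.ι α))
    refine (congrArg Mono h3).mpr ?_
    exact mono_comp _ _

instance : PreservesFiniteLimits t.pro := by
  refine (t.pro.preservesFiniteLimits_tfae.out 0 3).1 fun S hS ↦ ?_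
  have := hS.mono_f
  have h : PreservesFiniteColimits t.pro := inferInstance
  exact ⟨(t.pro.preservesFiniteColimits_iff_forall_exact_map_and_epi.1 h S hS).1,
    (inferInstance : Mono (t.pro.map S.f))⟩

end Exactness

end Tower

section Coalgebras

open Limits

variable {E : Type u} [Category.{v} E]

/-- The coalgebras over an exact additive comonad on an abelian category form an abelian
category: the forgetful functor creates finite limits and colimits, hence preserves and reflects
the comparison from the coimage to the image. -/
theorem nonempty_abelian_coalgebra [Abelian E] (G : Comonad E) [G.toFunctor.Additive]
    [PreservesFiniteLimits G.toFunctor] : Nonempty (Abelian G.Coalgebra) := by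
  have : HasFiniteLimits G.Coalgebra := ⟨fun J _ _ ↦ by
    have : PreservesLimitsOfShape J G.toFunctor := inferInstance
    exact hasLimitsOfShape_of_hasLimitsOfShape_createsLimitsOfShape G.forget⟩
  have : HasFiniteColimits G.Coalgebra := ⟨fun J _ _ ↦ by
    exact hasColimitsOfShape_of_hasColimitsOfShape_createsColimitsOfShape G.forget⟩
  have : PreservesFiniteLimits G.forget := ⟨fun J _ _ ↦ by
    have : PreservesLimitsOfShape J G.toFunctor := inferInstance
    infer_instance⟩
  have : PreservesFiniteColimits G.forget := ⟨fun J _ _ ↦ inferInstance⟩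
  have (X Y : G.Coalgebra) (f : X ⟶ Y) : IsIso (Abelian.coimageImageComparison f) := by
    have h : IsIso (G.forget.map (Abelian.coimageImageComparison f)) := by
      refine ((MorphismProperty.isomorphisms E).arrow_mk_iso_iff
        (Abelian.PreservesCoimageImageComparison.iso G.forget f)).2 ?_
      exact (inferInstance : IsIso (Abelian.coimageImageComparison (G.forget.map f)))
    exact isIso_of_reflects_iso _ G.forget
  exact ⟨.ofCoimageImageComparisonIsIso⟩

/-- The limits of shape `J` of coalgebras over a comonad preserving them exist and are exact as soon
as they are in the base category. -/
theorem coalgebra_hasExactLimits [Abelian E] (G : Comonad E)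
    [PreservesFiniteLimits G.toFunctor] (J : Type w) [Category.{w} J] [HasLimitsOfShape J E]
    [HasExactLimitsOfShape J E] [PreservesLimitsOfShape J G.toFunctor] :
    ∃ _ : HasLimitsOfShape J G.Coalgebra, HasExactLimitsOfShape J G.Coalgebra := by
  have h1 : HasLimitsOfShape J G.Coalgebra :=
    hasLimitsOfShape_of_hasLimitsOfShape_createsLimitsOfShape G.forget
  have : HasFiniteLimits G.Coalgebra := ⟨fun J _ _ ↦ by
    have : PreservesLimitsOfShape J G.toFunctor := inferInstance
    exact hasLimitsOfShape_of_hasLimitsOfShape_createsLimitsOfShape G.forget⟩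
  have : HasFiniteColimits G.Coalgebra := ⟨fun J _ _ ↦ by
    exact hasColimitsOfShape_of_hasColimitsOfShape_createsColimitsOfShape G.forget⟩
  have : PreservesFiniteColimits G.forget := ⟨fun J _ _ ↦ inferInstance⟩
  have : ReflectsFiniteColimits G.forget := inferInstance
  exact ⟨h1, HasExactLimitsOfShape.domain_of_functor J G.forget⟩

end Coalgebras

end StratPro

/-! ### Comodules over an exact tower -/

namespace StratPro

open Limits

namespace Pro

variable {C : Type u} [Category.{v} C] {D : Type u'} [Category.{v} D] (T : C ⥤ D)

theorem germ_map_bijective [T.Full] [T.Faithful] (X : Pro C) (c : C) :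
    Function.Bijective (Germ.map T : Germ X c → Germ (mapObj T X) (T.obj c)) := by
  refine ⟨fun s t h ↦ ?_, fun s ↦ ?_⟩
  · obtain ⟨i, f, g, rfl, rfl⟩ := germ_surj₂ s t
    obtain ⟨z, a, e⟩ := germ_eq_iff_same.1 h
    refine germ_eq_iff_same.2 ⟨z, a, T.map_injective ?_⟩
    rw [T.map_comp, T.map_comp]
    exact e
  · obtain ⟨i, f, rfl⟩ := germ_surj s
    exact ⟨germ X i (T.preimage f), congrArg (germ (mapObj T X) i) (T.map_preimage f)⟩

instance [T.Full] [T.Faithful] : (Pro.map T).Faithful where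
  map_injective {X Y _ _} h := hom_ext fun j ↦ (germ_map_bijective T X _).1
    (congrArg (fun χ : mapObj T X ⟶ mapObj T Y ↦ Hom.app χ j) h)

instance [T.Full] [T.Faithful] : (Pro.map T).Full where
  map_surjective {X Y} φ := by
    choose s hs using fun j : Y.I ↦ (germ_map_bijective T X _).2 (Hom.app φ j)
    refine ⟨{ app := s, compat := fun {j j'} u ↦ (germ_map_bijective T X _).1 ?_ }, hom_ext hs⟩
    refine (map_post T _ _).symm.trans ?_
    rw [hs, hs]
    exact Hom.compat φ u

end Pro

namespace Tower

variable {C : Type u} [Category.{v} C] (t : Tower C) (P : ObjectProperty C)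
  (h : ∀ m F, P F → P ((t.T m).obj F))

/-- A coalgebra over the restriction of a tower to a full subcategory is a comodule. This functor is
an equivalence, as pro-objects of the subcategory form a full subcategory of all pro-objects. -/
def toComod : (t.restrict P h).proComonad.Coalgebra ⥤ Comod t.proComonad (incl P) where
  obj M :=
    { obj := M.A
      str := (incl P).map M.a
      coid := by
        refine ((incl P).map_comp M.a ((t.restrict P h).proComonad.ε.app M.A)).symm.trans ?_
        rw [M.counit]
        exact (incl P).map_id _
      coassoc := by
        have h1 := congrArg (incl P).map M.coassoc
        rw [(incl P).map_comp, (incl P).map_comp] at h1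
        refine h1.trans ?_
        exact congrArg ((incl P).map M.a ≫ ·) (t.restrict_nat P h M.a) }
  map {M N} f :=
    { hom := f.f
      comm := by
        have h1 := congrArg (incl P).map f.h
        rw [(incl P).map_comp, (incl P).map_comp] at h1
        refine Eq.trans ?_ h1
        exact congrArg ((incl P).map M.a ≫ ·) (t.restrict_nat P h f.f).symm }

instance : (t.toComod P h).Faithful where
  map_injective e := Comonad.Coalgebra.Hom.ext (congrArg Comod.Hom.hom e)

instance : (t.toComod P h).Full where
  map_surjective {M N} f := by
    let g : M.A ⟶ N.A := f.hom
    refine ⟨⟨g, (incl P).map_injective ?_⟩, rfl⟩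
    rw [(incl P).map_comp, (incl P).map_comp]
    refine Eq.trans ?_ f.comm
    exact congrArg ((incl P).map M.a ≫ ·) (t.restrict_nat P h f.hom)

instance : (t.toComod P h).EssSurj where
  mem_essImage M := by
    let a : M.obj ⟶ (t.restrict P h).proComonad.obj M.obj :=
      (incl P).preimage (Y := (t.restrict P h).proObj M.obj) M.str
    have ha : (incl P).map a = M.str := (incl P).map_preimage _
    let N : (t.restrict P h).proComonad.Coalgebra :=
      { A := M.obj
        a := a
        counit := (incl P).map_injective (by
          rw [(incl P).map_comp, ha, (incl P).map_id]
          exact M.coid)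
        coassoc := (incl P).map_injective (by
          rw [(incl P).map_comp, (incl P).map_comp, ha]
          refine M.coassoc.trans ?_
          refine congrArg (M.str ≫ ·) (Eq.trans ?_ (t.restrict_nat P h a).symm)
          exact congrArg t.proMap ha.symm) }
    have e : (t.toComod P h).obj N = M := by
      cases M
      exact (Comod.mk.injEq ..).mpr ⟨rfl, heq_of_eq ha⟩
    exact ⟨N, ⟨eqToIso e⟩⟩

instance : (t.toComod P h).IsEquivalence where

/-- The forgetful functor from comodules is left adjoint to the cofree comodule functor. -/
noncomputable def forgetCofreeAdj : Comod.forget t.proComonad (incl P) ⊣ t.cofree P h :=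
  let e := (t.toComod P h).asEquivalence
  let G := (t.restrict P h).proComonad
  have i₁ : e.inverse ⋙ G.forget ≅ Comod.forget t.proComonad (incl P) :=
    (Functor.associator e.inverse e.functor (Comod.forget t.proComonad (incl P))).symm ≪≫
      Functor.isoWhiskerRight e.counitIso _ ≪≫ Functor.leftUnitor _
  have i₂ : G.cofree ⋙ e.functor ≅ t.cofree P h :=
    NatIso.ofComponents (fun _ ↦ Iso.refl _) fun _ ↦
      (Category.comp_id _).trans (Category.id_comp _).symm
  ((e.symm.toAdjunction.comp G.adj).ofNatIsoLeft i₁).ofNatIsoRight i₂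

theorem isInduced_cofree (F : Pro P.FullSubcategory) :
    Comod.IsInduced ((t.cofree P h).obj F) := by
  refine ⟨F, Iso.refl _, ?_⟩
  refine Eq.trans (congrArg (t.proComul ((incl P).obj F) ≫ ·)
    (t.proComonad.toFunctor.map_id _)) ?_
  exact (Category.comp_id _).trans (Category.id_comp _).symm

/-- The comodules over an exact tower on an abelian category form an abelian category. -/
theorem nonempty_abelian_comod [Abelian P.FullSubcategory] [(t.restrict P h).IsExact] :
    Nonempty (Abelian (Comod t.proComonad (incl P))) := by
  have : (t.restrict P h).proComonad.toFunctor.Additive :=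
    inferInstanceAs (t.restrict P h).pro.Additive
  have : PreservesFiniteLimits (t.restrict P h).proComonad.toFunctor :=
    inferInstanceAs (PreservesFiniteLimits (t.restrict P h).pro)
  obtain ⟨_⟩ := nonempty_abelian_coalgebra (t.restrict P h).proComonad
  let F := (t.toComod P h).inv
  let _ : Preadditive (Comod t.proComonad (incl P)) :=
    Preadditive.ofFullyFaithful (Functor.FullyFaithful.ofFullyFaithful F)
  have : F.Additive := Functor.FullyFaithful.additive_ofFullyFaithful _
  have : HasFiniteProducts (Comod t.proComonad (incl P)) :=
    ⟨fun n ↦ Adjunction.hasLimitsOfShape_of_equivalence F⟩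
  exact ⟨abelianOfEquivalence F⟩

/-- Cofiltered limits of comodules over an exact tower on an abelian category exist and are
exact. -/
theorem comod_hasExactLimits [Abelian P.FullSubcategory] [(t.restrict P h).IsExact] (J : Type v)
    [SmallCategory J] [IsCofiltered J] :
    ∃ _ : HasLimitsOfShape J (Comod t.proComonad (incl P)),
      HasExactLimitsOfShape J (Comod t.proComonad (incl P)) := by
  have : PreservesFiniteLimits (t.restrict P h).proComonad.toFunctor :=
    inferInstanceAs (PreservesFiniteLimits (t.restrict P h).pro)
  have : PreservesLimitsOfShape J (t.restrict P h).proComonad.toFunctor :=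
    inferInstanceAs (PreservesLimitsOfShape J (t.restrict P h).pro)
  have : HasExactLimitsOfShape J (Pro P.FullSubcategory) := Pro.hasExactLimitsOfShape
  obtain ⟨h1, h2⟩ := coalgebra_hasExactLimits (t.restrict P h).proComonad J
  have h3 : HasLimitsOfShape J (Comod t.proComonad (incl P)) :=
    Adjunction.hasLimitsOfShape_of_equivalence (t.toComod P h).inv
  exact ⟨h3, HasExactLimitsOfShape.of_codomain_equivalence J (t.toComod P h).asEquivalence⟩

end Tower

end StratPro

/-! ### Principal parts and localization -/

namespace StratPro

namespace PrincipalParts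

variable (k : Type u) {A B : Type u} [CommRing k] [CommRing A] [CommRing B] [Algebra k A]
  [Algebra k B]

theorem d₁_sub_d₀_pow (m : ℕ) (a : A) : (d₁ k m a - d₀ k m a) ^ (m + 1) = 0 := by
  have h := Ideal.pow_mem_pow (Ideal.subset_span ⟨a, rfl⟩ : d₁ k m a - d₀ k m a ∈
    Ideal.span (Set.range fun a : A ↦ d₁ k m a - d₀ k m a)) (m + 1)
  rwa [span_pow_eq_bot] at h

/-- As `d₁ a - d₀ a` is nilpotent, inverting `d₀ a` also inverts `d₁ a`. -/
theorem d₁_dvd_d₀_pow (m : ℕ) (a : A) : d₁ k m a ∣ d₀ k m a ^ (m + 1) := by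
  have h := sub_dvd_pow_sub_pow (d₀ k m a) (d₀ k m a - d₁ k m a) (m + 1)
  rwa [sub_sub_cancel, ← neg_sub (d₁ k m a), neg_pow, d₁_sub_d₀_pow, mul_zero, sub_zero] at h

end PrincipalParts

section Localization

variable {A B : Type u} [CommRing A] [CommRing B] {M M' : Type u} [AddCommGroup M] [Module A M]
  [AddCommGroup M'] [Module B M']

/-- A semilinear map `M → M'` which exhibits `M'` as the localization of `M` away from `f`
(when `φ f` is invertible). -/
structure IsAway {φ : A →+* B} (f : A) (ρ : M →ₛₗ[φ] M') : Prop where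
  exists_lift (y : M') : ∃ (n : ℕ) (x : M), ρ x = φ f ^ n • y
  exists_pow_smul (x : M) (h : ρ x = 0) : ∃ n : ℕ, f ^ n • x = 0

/-- A semilinear map on `M` along a ring homomorphism which inverts `f` extends to a localization
of `M` away from `f`. -/
theorem IsAway.exists_extend {φ : A →+* B} {f : A} (hf : IsUnit (φ f)) {ρ : M →ₛₗ[φ] M'}
    (hρ : IsAway f ρ) {S W : Type u} [CommRing S] [AddCommGroup W] [Module S W] {g : A →+* S}
    (hg : IsUnit (g f)) (h : M →ₛₗ[g] W) :
    ∃ h' : M' →+ W, (∀ x, h' (ρ x) = h x) ∧ ∀ (a : A) (y : M'), h' (φ a • y) = g a • h' y := by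
  let _ : Module A M' := Module.compHom M' φ
  let _ : Module A W := Module.compHom W g
  let ρ' : M →ₗ[A] M' := { ρ with map_smul' := fun a x ↦ map_smulₛₗ ρ a x }
  let h₀ : M →ₗ[A] W := { h with map_smul' := fun a x ↦ map_smulₛₗ h a x }
  have unit {C V : Type u} [CommRing C] [AddCommGroup V] [Module C V] (c : C) (hc : IsUnit c) :
      Function.Bijective fun v : V ↦ c • v := by
    obtain ⟨c, rfl⟩ := hc
    exact (MulAction.toPerm c).bijective
  have : IsLocalizedModule (.powers f) ρ' := by
    refine ⟨?_, fun y ↦ ?_, fun {x x'} e ↦ ?_⟩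
    · rintro ⟨_, n, rfl⟩
      rw [map_pow]
      exact ((Module.End.isUnit_iff _).2 (unit (φ f) hf)).pow n
    · obtain ⟨n, x, e⟩ := hρ.exists_lift y
      refine ⟨(x, ⟨f ^ n, n, rfl⟩), ?_⟩
      refine Eq.trans ?_ e.symm
      rw [← map_pow]
      rfl
    · obtain ⟨n, e'⟩ := hρ.exists_pow_smul (x - x') ((map_sub ρ x x').trans (sub_eq_zero.2 e))
      exact ⟨⟨f ^ n, n, rfl⟩, sub_eq_zero.1 ((smul_sub _ _ _).symm.trans e')⟩
  have hu (x : Submonoid.powers f) : IsUnit ((algebraMap A (Module.End A W)) x) := by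
    obtain ⟨_, n, rfl⟩ := x
    rw [map_pow]
    exact ((Module.End.isUnit_iff _).2 (unit (g f) hg)).pow n
  exact ⟨(IsLocalizedModule.lift (.powers f) ρ' h₀ hu).toAddMonoidHom,
    fun x ↦ IsLocalizedModule.lift_apply (.powers f) ρ' h₀ hu x,
    fun a y ↦ (IsLocalizedModule.lift (.powers f) ρ' h₀ hu).map_smul a y⟩

end Localization

namespace PPTensor

open PrincipalParts

variable {k A B : Type u} [CommRing k] [CommRing A] [CommRing B] [Algebra k A] [Algebra k B]
  {m : ℕ} {M M' N W : Type u} [AddCommGroup M] [Module A M] [AddCommGroup N] [Module A N]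
  [AddCommGroup M'] [Module B M'] [AddCommGroup W]

theorem lift_smul' {S : Type u} [CommRing S] [Module S W]
    (g : PrincipalParts k A m →+* S) (h : M →+ W)
    (hh : ∀ (a : A) (x : M), h (a • x) = g (d₁ k m a) • h x) (p : PrincipalParts k A m)
    (t : PPTensor k A m M) : lift g h hh (p • t) = g p • lift g h hh t := by
  induction t using tmul_induction with
  | zero => rw [smul_zero, map_zero, smul_zero]
  | tmul q x => rw [smul_tmul, lift_tmul, lift_tmul, map_mul, mul_smul]
  | add s t hs ht => rw [smul_add, map_add, map_add, smul_add, hs, ht]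

variable {φ : A →+* B} (hφ : ∀ c : k, φ (algebraMap k A c) = algebraMap k B c)

theorem res_smul' (ρ : M →ₛₗ[φ] M') (p : PrincipalParts k A m)
    (t : PPTensor k A m M) :
    res m φ hφ ρ (p • t) = PrincipalParts.map m φ hφ p • res m φ hφ ρ t :=
  lift_smul' _ _ (res_aux φ hφ ρ) p t

theorem pow_smul_eq (n : ℕ) (f : A) (t : PPTensor k A m M) : f ^ n • t = d₀ k m f ^ n • t := by
  rw [smul_def, map_pow]

/-- The image of `𝒫ᵐ_A ⊗ M → 𝒫ᵐ_B ⊗ M'` generates the target after inverting `f`: denominators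
`d₁ f` in the second factor are turned into denominators `d₀ f`. -/
theorem exists_res_eq {f : A} {ρ : M →ₛₗ[φ] M'}
    (hφl : ∀ b : B, ∃ (n : ℕ) (a : A), φ a = φ f ^ n * b) (hρ : IsAway f ρ)
    (s : PPTensor k B m M') :
    ∃ (n : ℕ) (t : PPTensor k A m M), res m φ hφ ρ t = φ f ^ n • s := by
  induction s using induction_on with
  | smul b y =>
    obtain ⟨n, a, ha⟩ := hφl b
    obtain ⟨n', x, hx⟩ := hρ.exists_lift y
    obtain ⟨p, hp⟩ := pow_dvd_pow_of_dvd (d₁_dvd_d₀_pow k m f) n'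
    have key : PrincipalParts.map m φ hφ p • j k B m (φ f ^ n' • y) =
        φ f ^ ((m + 1) * n') • j k B m y := by
      rw [← map_pow φ, j_smul, smul_smul, ← PrincipalParts.map_d₁ k m φ hφ, ← map_mul, map_pow,
        mul_comm p, ← hp, ← pow_mul, map_pow, PrincipalParts.map_d₀, ← map_pow]
      rfl
    refine ⟨(m + 1) * n' + n, a • p • j k A m x, ?_⟩
    rw [map_smulₛₗ, res_smul', res_j, hx, key, ha, smul_smul, smul_smul]
    congr 1
    ring
  | add s s' h h' =>
    obtain ⟨n, t, e⟩ := h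
    obtain ⟨n', t', e'⟩ := h'
    refine ⟨n + n', f ^ n' • t + f ^ n • t', ?_⟩
    rw [map_add, map_smulₛₗ, map_smulₛₗ, e, e', map_pow, map_pow, smul_add, smul_smul, smul_smul,
      ← pow_add, ← pow_add, add_comm n']

/-- The kernel of the restriction map `𝒫ᵐ_A ⊗ M → 𝒫ᵐ_B ⊗ M'` is `f`-torsion, when `B` and `M'`
are the localizations of `A` and `M`: there is a map in the other direction after inverting
`d₀ f`. -/
theorem exists_pow_smul_eq_zero {f : A} {ρ : M →ₛₗ[φ] M'} (hB : @IsLocalization.Away _ _ f B _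
    φ.toAlgebra) (hρ : IsAway f ρ) (t : PPTensor k A m M) (ht : res m φ hφ ρ t = 0) :
    ∃ n : ℕ, f ^ n • t = 0 := by
  let _ : Algebra A B := φ.toAlgebra
  let P := PrincipalParts k A m
  let S := Localization.Away (d₀ k m f)
  let L := LocalizedModule (.powers (d₀ k m f)) (PPTensor k A m M)
  have hf : IsUnit (φ f) := IsLocalization.Away.algebraMap_isUnit (S := B) f
  have h0 : IsUnit (((algebraMap P S).comp (d₀ k m)) f) :=
    IsLocalization.Away.algebraMap_isUnit (S := S) (d₀ k m f)
  have h1 : IsUnit (((algebraMap P S).comp (d₁ k m)) f) := by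
    refine isUnit_of_dvd_unit (map_dvd (algebraMap P S) (d₁_dvd_d₀_pow k m f)) ?_
    rw [map_pow]
    exact h0.pow _
  let f₀ : B →+* S := IsLocalization.Away.lift f h0
  let f₁ : B →+* S := IsLocalization.Away.lift f h1
  have hf₀ (a : A) : f₀ (φ a) = algebraMap P S (d₀ k m a) := IsLocalization.Away.lift_eq f h0 a
  have hf₁ (a : A) : f₁ (φ a) = algebraMap P S (d₁ k m a) := IsLocalization.Away.lift_eq f h1 a
  have hφl (b : B) : ∃ (n : ℕ) (a : A), φ a = φ f ^ n * b := by
    obtain ⟨n, a, e⟩ := IsLocalization.Away.surj f b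
    exact ⟨n, a, e.symm.trans (mul_comm _ _)⟩
  -- The differences `f₁ b - f₀ b` generate the same ideal as those of the `b = φ a`, by the rule
  -- for the difference of two fractions.
  have hI : Ideal.span (Set.range fun b : B ↦ f₁ b - f₀ b) ^ (m + 1) = ⊥ := by
    rw [eq_bot_iff, ← span_pow_le k le_rfl (algebraMap P S)]
    refine Ideal.pow_right_mono (Ideal.span_le.2 ?_) _
    rintro _ ⟨b, rfl⟩
    obtain ⟨n, a, ha⟩ := hφl b
    have e0 := congrArg f₀ ha
    have e1 := congrArg f₁ ha
    rw [map_mul, map_pow, hf₀, hf₀, ← map_pow, ← map_pow] at e0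
    rw [map_mul, map_pow, hf₁, hf₁, ← map_pow, ← map_pow] at e1
    have hu : IsUnit (algebraMap P S (d₀ k m (f ^ n)) * algebraMap P S (d₁ k m (f ^ n))) := by
      rw [map_pow, map_pow, map_pow, map_pow]
      exact (h0.pow n).mul (h1.pow n)
    rw [SetLike.mem_coe, ← Ideal.unit_mul_mem_iff_mem _ hu]
    have e : algebraMap P S (d₀ k m (f ^ n)) * algebraMap P S (d₁ k m (f ^ n)) * (f₁ b - f₀ b) =
        algebraMap P S (d₀ k m (f ^ n)) * (algebraMap P S (d₁ k m a) - algebraMap P S (d₀ k m a)) -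
        algebraMap P S (d₀ k m a) *
          (algebraMap P S (d₁ k m (f ^ n)) - algebraMap P S (d₀ k m (f ^ n))) := by
      rw [e0, e1]
      ring
    rw [e]
    exact Ideal.sub_mem _ (Ideal.mul_mem_left _ _ (Ideal.subset_span ⟨a, rfl⟩))
      (Ideal.mul_mem_left _ _ (Ideal.subset_span ⟨f ^ n, rfl⟩))
  have hσ (c : k) : f₀ (algebraMap k B c) = f₁ (algebraMap k B c) := by
    rw [← hφ, hf₀, hf₁, d₀_algebraMap]
  let g := PrincipalParts.lift k m f₀ f₁ hσ hI
  let ι : PPTensor k A m M →ₗ[P] L := LocalizedModule.mkLinearMap _ _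
  have hι (p : P) (t : PPTensor k A m M) : ι (p • t) = algebraMap P S p • ι t := by
    rw [map_smul, algebraMap_smul]
  let h : M →ₛₗ[(algebraMap P S).comp (d₁ k m)] L :=
    { toFun := fun x ↦ ι (j k A m x)
      map_add' := fun x y ↦ by rw [map_add, map_add]
      map_smul' := fun a x ↦ by rw [j_smul, hι]; rfl }
  obtain ⟨h', hh', hs⟩ := hρ.exists_extend hf h1 h
  have hs' (b : B) (y : M') : h' (b • y) = g (d₁ k m b) • h' y := by
    obtain ⟨n, a, ha⟩ := hφl b
    refine (IsUnit.smul_left_cancel (h1.pow n)).1 ?_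
    rw [← map_pow, ← hs, smul_smul, map_pow, ← ha, hs, smul_smul]
    congr 1
    rw [lift_d₁]
    refine (hf₁ a).symm.trans ?_
    rw [ha, map_mul, ← map_pow, hf₁]
    rfl
  let Ψ : PPTensor k B m M' →+ L := lift g h' hs'
  have hΨ (t : PPTensor k A m M) : Ψ (res m φ hφ ρ t) = ι t := by
    induction t using induction_on with
    | smul a x =>
      rw [map_smulₛₗ, res_j, lift_smul, lift_j, hh', smul_def, hι, lift_d₀, hf₀]
      rfl
    | add s t hs ht => rw [map_add, map_add, map_add, hs, ht]
  have h2 : ι t = 0 := by rw [← hΨ, ht, map_zero]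
  obtain ⟨⟨_, n, rfl⟩, e⟩ := (IsLocalizedModule.eq_zero_iff (.powers (d₀ k m f)) ι).1 h2
  exact ⟨n, (pow_smul_eq n f t).trans e⟩

/-- Principal parts commute with localization. -/
theorem isAway_res {f : A} {ρ : M →ₛₗ[φ] M'} (hB : @IsLocalization.Away _ _ f B _ φ.toAlgebra)
    (hρ : IsAway f ρ) : IsAway f (res m φ hφ ρ) := by
  refine ⟨exists_res_eq hφ (fun b ↦ ?_) hρ, exists_pow_smul_eq_zero hφ hB hρ⟩
  let _ : Algebra A B := φ.toAlgebra
  obtain ⟨n, a, e⟩ := IsLocalization.Away.surj f b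
  exact ⟨n, a, e.symm.trans (mul_comm _ _)⟩

end PPTensor

end StratPro

/-! ### Finiteness, exactness and the Artin–Rees property of principal parts -/

namespace StratPro

open scoped TensorProduct

namespace PPTensor

open PrincipalParts

section Finite

variable (k A : Type u) [CommRing k] [CommRing A] [Algebra k A]

theorem exists_leftPP_algHom (m : ℕ) :
    ∃ π : A ⊗[k] A →ₐ[A] LeftPP k A m, Function.Surjective π :=
  ⟨{ mk k A m with commutes' := fun _ ↦ rfl }, mk_surjective k m⟩

/-- The algebra of principal parts is generated by the `d₁ b`, which are integral over `A` as they
differ from `d₀ b` by a nilpotent element. -/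
instance [Algebra.FiniteType k A] (m : ℕ) : Module.Finite A (LeftPP k A m) := by
  obtain ⟨π, hπ⟩ := exists_leftPP_algHom k A m
  have : Algebra.FiniteType A (LeftPP k A m) := .of_surjective π hπ
  have : Algebra.IsIntegral A (LeftPP k A m) := by
    refine ⟨fun p ↦ ?_⟩
    induction p using PrincipalParts.induction_on with
    | zero => exact isIntegral_zero
    | mul a b =>
      have h (c : A) : IsIntegral A (show LeftPP k A m from d₀ k m c) := isIntegral_algebraMap
      have h1 : IsIntegral A (show LeftPP k A m from d₁ k m b - d₀ k m b) := by
        refine IsIntegral.of_pow m.succ_pos ?_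
        have e : (show LeftPP k A m from d₁ k m b - d₀ k m b) ^ (m + 1) = 0 := d₁_sub_d₀_pow k m b
        rw [Nat.succ_eq_add_one, e]
        exact isIntegral_zero
      have h2 := (h a).mul ((h b).add h1)
      have e : (show LeftPP k A m from d₀ k m b) + (show LeftPP k A m from d₁ k m b - d₀ k m b) =
          (show LeftPP k A m from d₁ k m b) := add_sub_cancel (d₀ k m b) (d₁ k m b)
      rw [e] at h2
      exact h2
    | add p q hp hq => exact IsIntegral.add hp hq
  exact Algebra.IsIntegral.finite

end Finite

variable (k : Type u) {A : Type u} [CommRing k] [CommRing A] [Algebra k A] {m : ℕ}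
  {M M' M'' : Type u} [AddCommGroup M] [Module A M] [AddCommGroup M'] [Module A M']
  [AddCommGroup M''] [Module A M'']

theorem finite [Algebra.FiniteType k A] [Module.Finite A M] (m : ℕ) :
    Module.Finite A (PPTensor k A m M) := by
  have : Module.Finite (LeftPP k A m) (PPTensor k A m M) :=
    Module.Finite.base_change A (PrincipalParts k A m) M
  exact Module.Finite.trans (LeftPP k A m) _

theorem map_eq_lTensor (u : M →ₗ[A] M') (t : PPTensor k A m M) :
    map k m u t = LinearMap.lTensor (PrincipalParts k A m) u t := by
  induction t using induction_on with
  | smul a x =>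
    rw [map_smul, map_j]
    exact congrArg (fun p ↦ tmul p (u x)) (mul_one (d₀ k m a)) |>.trans
      (congrArg (fun p ↦ tmul p (u x)) (mul_one (d₀ k m a)).symm)
  | add s t hs ht =>
    rw [map_add, hs, ht]
    exact (map_add (LinearMap.lTensor (PrincipalParts k A m) u) s t).symm

theorem map_surjective {u : M →ₗ[A] M'} (hu : Function.Surjective u) (m : ℕ) :
    Function.Surjective (map k m u) := by
  intro t
  obtain ⟨s, hs⟩ := LinearMap.lTensor_surjective (PrincipalParts k A m) hu t
  exact ⟨s, (map_eq_lTensor k u s).trans hs⟩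

theorem map_exact {u : M →ₗ[A] M'} {v : M' →ₗ[A] M''} (h : Function.Exact u v)
    (hv : Function.Surjective v) (m : ℕ) : Function.Exact (map k m u) (map k m v) := by
  intro t
  refine (Eq.congr_left (map_eq_lTensor k v t)).trans
    ((lTensor_exact (PrincipalParts k A m) h hv t).trans ?_)
  exact exists_congr fun s ↦ (Eq.congr_left (map_eq_lTensor k u s)).symm

theorem map_add_left (u v : M →ₗ[A] M') (t : PPTensor k A m M) :
    map k m (u + v) t = map k m u t + map k m v t := by
  induction t using induction_on with
  | smul a x => rw [map_smul, map_smul, map_smul, map_j, map_j, map_j, LinearMap.add_apply,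
      map_add, smul_add]
  | add s t hs ht => rw [map_add, map_add, map_add, hs, ht, add_add_add_comm]

section ArtinRees

/-- The projection from `A ⊗[k] A` to the principal parts which exchanges the factors: it is
linear for the left structure of the source and the right structure `d₁` of the target. -/
noncomputable def proj (A : Type u) [CommRing A] [Algebra k A] (m : ℕ) :
    A ⊗[k] A →ₐ[A] PrincipalParts k A m :=
  { (mk k A m).comp (Algebra.TensorProduct.comm k A A).toAlgHom.toRingHom with
    commutes' := fun _ ↦ rfl }

theorem proj_surjective (m : ℕ) : Function.Surjective (proj k A m) :=
  (mk_surjective k m).comp (Algebra.TensorProduct.comm k A A).surjective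

/-- The ideal of the diagonal, after exchange of the two factors of `A ⊗[k] A`. -/
noncomputable def swapIdeal (A : Type u) [CommRing A] [Algebra k A] : Ideal (A ⊗[k] A) :=
  (KaehlerDifferential.ideal k A).comap (Algebra.TensorProduct.comm k A A).toRingEquiv

theorem proj_eq_zero_iff (m : ℕ) (r : A ⊗[k] A) :
    proj k A m r = 0 ↔ r ∈ swapIdeal k A ^ (m + 1) := by
  have h : swapIdeal k A ^ (m + 1) = (KaehlerDifferential.ideal k A ^ (m + 1)).comap
      (Algebra.TensorProduct.comm k A A).toRingEquiv := by
    rw [swapIdeal, ← Ideal.map_symm, ← Ideal.map_symm, Ideal.map_pow]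
  rw [h, Ideal.mem_comap]
  exact Ideal.Quotient.eq_zero_iff_mem

/-- The projection from `(A ⊗[k] A) ⊗ M` to `𝒫ᵐ ⊗ M`. -/
noncomputable def projTensor (m : ℕ) (M : Type u) [AddCommGroup M] [Module A M] :
    (A ⊗[k] A) ⊗[A] M →+ PPTensor k A m M :=
  (LinearMap.rTensor M (proj k A m).toLinearMap).toAddMonoidHom

theorem projTensor_tmul (r : A ⊗[k] A) (x : M) :
    projTensor k m M (r ⊗ₜ[A] x) = tmul (proj k A m r) x := rfl

theorem projTensor_surjective : Function.Surjective (projTensor k (A := A) m M) :=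
  LinearMap.rTensor_surjective M (proj_surjective k m)

theorem map_projTensor (u : M →ₗ[A] M') (t : (A ⊗[k] A) ⊗[A] M) :
    map k m u (projTensor k m M t) = projTensor k m M' (u.baseChange (A ⊗[k] A) t) := by
  induction t using TensorProduct.induction_on with
  | zero => simp only [map_zero]
  | tmul r x => exact map_eq_lTensor k u _
  | add s t hs ht => simp only [map_add, hs, ht]

theorem trans_projTensor {r : ℕ} (h : m ≤ r) (t : (A ⊗[k] A) ⊗[A] M) :
    trans k M h (projTensor k r M t) = projTensor k m M t := by
  induction t using TensorProduct.induction_on with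
  | zero => simp only [map_zero]
  | tmul r x =>
    refine (lift_tmul _ _ (trans_aux h) _ x).trans ?_
    exact congrArg (fun p ↦ tmul p x) (mul_one (proj k A m r))
  | add s t hs ht => simp only [map_add, hs, ht]

theorem projTensor_smul (r : A ⊗[k] A) (t : (A ⊗[k] A) ⊗[A] M) :
    projTensor k m M (r • t) = proj k A m r • projTensor k m M t := by
  induction t using TensorProduct.induction_on with
  | zero => simp only [map_zero, smul_zero]
  | tmul r' x =>
    rw [TensorProduct.smul_tmul', projTensor_tmul, projTensor_tmul, smul_tmul, smul_eq_mul, map_mul]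
  | add s t hs ht => simp only [map_add, smul_add, hs, ht]

/-- `𝒫ᵐ ⊗ M` is the quotient of `(A ⊗ A) ⊗ M` by the submodule generated by the power of the ideal
of the diagonal. -/
theorem projTensor_eq_zero_iff (t : (A ⊗[k] A) ⊗[A] M) :
    projTensor k m M t = 0 ↔
      t ∈ (swapIdeal k A ^ (m + 1) • ⊤ : Submodule (A ⊗[k] A) ((A ⊗[k] A) ⊗[A] M)) := by
  constructor
  · intro h
    let π := (proj k A m).toLinearMap
    have h1 := rTensor_exact M (f := (LinearMap.ker π).subtype) (g := π)
      (LinearMap.exact_subtype_ker_map π) (proj_surjective k m)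
    obtain ⟨s, rfl⟩ := (h1 t).1 h
    induction s using TensorProduct.induction_on with
    | zero => simp only [map_zero, zero_mem]
    | tmul c x =>
      have e : (LinearMap.rTensor M (LinearMap.ker π).subtype) (c ⊗ₜ x) =
          (c : A ⊗[k] A) • ((1 : A ⊗[k] A) ⊗ₜ[A] x) := by
        rw [TensorProduct.smul_tmul', smul_eq_mul, mul_one]
        rfl
      rw [e]
      exact Submodule.smul_mem_smul ((proj_eq_zero_iff k m _).1 c.2) trivial
    | add s s' hs hs' =>
      rw [map_add]
      exact add_mem (hs ((h1 _).2 ⟨s, rfl⟩)) (hs' ((h1 _).2 ⟨s', rfl⟩))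
  · intro h
    refine Submodule.smul_induction_on h (fun r hr n _ ↦ ?_) fun x y hx hy ↦ ?_
    · rw [projTensor_smul, (proj_eq_zero_iff k m r).2 hr, zero_smul]
    · rw [map_add, hx, hy, add_zero]

end ArtinRees

/-- The Artin–Rees lemma for the ideal of the diagonal, in terms of principal parts: for an
injective linear map `u` the kernels of the maps `𝒫ʳ ⊗ u` form a null system. This rests on the
flatness of `A ⊗[k] A` over `A`. -/
theorem artinRees (k : Type u) {A : Type u} [Field k] [CommRing A] [Algebra k A]
    [Algebra.FiniteType k A] {M M' : Type u} [AddCommGroup M] [Module A M] [AddCommGroup M']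
    [Module A M'] [Module.Finite A M] (u : M' →ₗ[A] M) (hu : Function.Injective u) :
    ∃ c : ℕ, ∀ (m r : ℕ) (h : m ≤ r), m + c ≤ r → ∀ t : PPTensor k A r M',
      map k r u t = 0 → trans k M' h t = 0 := by
  have : Algebra.FiniteType k (A ⊗[k] A) := .trans (S := A) inferInstance inferInstance
  have : IsNoetherianRing (A ⊗[k] A) := Algebra.FiniteType.isNoetherianRing k _
  let U := u.baseChange (A ⊗[k] A)
  have hU : Function.Injective U := Module.Flat.lTensor_preserves_injective_linearMap u hu
  obtain ⟨c, hc⟩ := Ideal.exists_pow_inf_eq_pow_smul (swapIdeal k A) (LinearMap.range U)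
  refine ⟨c, fun m r h hr t ht ↦ ?_⟩
  obtain ⟨y, rfl⟩ := projTensor_surjective k t
  rw [map_projTensor, projTensor_eq_zero_iff] at ht
  have h1 : U y ∈ swapIdeal k A ^ (r + 1) • ⊤ ⊓ LinearMap.range U := ⟨ht, y, rfl⟩
  rw [hc (r + 1) (by omega)] at h1
  have h2 : swapIdeal k A ^ (r + 1 - c) • (swapIdeal k A ^ c • ⊤ ⊓ LinearMap.range U) ≤
      (swapIdeal k A ^ (r + 1 - c) • ⊤ : Submodule _ _).map U := by
    rw [Submodule.map_smul'', Submodule.map_top]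
    exact Submodule.smul_mono le_rfl inf_le_right
  obtain ⟨z, hz, e⟩ := h2 h1
  obtain rfl := hU e
  rw [trans_projTensor, projTensor_eq_zero_iff]
  exact Submodule.smul_mono_left (Ideal.pow_le_pow_right (by omega)) hz

end PPTensor

end StratPro

/-! ### Quasi-coherent modules and localization of sections -/

namespace StratPro

open Limits AlgebraicGeometry TopologicalSpace PMod

section QuasiCoherent

variable {X : Scheme.{u}}

/-- The inclusion of a basic open subset, as a morphism of the opposite category. -/
abbrev basicHom {U : X.Opens} (f : Γ(X, U)) : op U ⟶ op (X.basicOpen f) :=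
  (homOfLE (X.basicOpen_le f)).op

/-- A presheaf of modules on a scheme whose sections on the affine open subsets `U` satisfy
`P(D(f)) = P(U)_f` for `f ∈ 𝒪(U)`. -/
def IsAffineLocalizing (P : PMod X.presheaf) : Prop :=
  ∀ ⦃U : X.Opens⦄, IsAffineOpen U → ∀ f : Γ(X, U), IsAway f (rho P (basicHom f))

variable (X) in
/-- The inclusion of modules into presheaves of modules, with target the category `PMod`. -/
noncomputable def pmod : X.Modules ⥤ PMod X.presheaf := Scheme.Modules.toPresheafOfModules X

instance : (pmod X).Full := inferInstanceAs (Scheme.Modules.toPresheafOfModules X).Full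

instance : (pmod X).Faithful := inferInstanceAs (Scheme.Modules.toPresheafOfModules X).Faithful

variable (X) in
/-- Sheafification of presheaves of modules, with source the category `PMod`. -/
noncomputable def pmodSheafify : PMod X.presheaf ⥤ X.Modules :=
  (PresheafOfModules.sheafification.{u} (𝟙 X.ringCatSheaf.obj) :)

variable (X) in
/-- The adjunction between sheafification and inclusion. -/
noncomputable def pmodAdj : pmodSheafify X ⊣ pmod X := sheafificationAdj X

/-- The presheaf of modules underlying a module. -/
noncomputable abbrev toPMod (M : X.Modules) : PMod X.presheaf := (pmod X).obj M

variable {U : X.Opens} (hU : IsAffineOpen U)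

/-- The action of `Γ(X, U)` on the sections of the structure sheaf of `Spec Γ(X, U)`, transported
along `hU.fromSpec`, is the restriction of functions. -/
theorem fromSpec_appIso_inv (V : (Spec Γ(X, U)).Opens) (h : hU.fromSpec ''ᵁ V ≤ U) :
    (Scheme.ΓSpecIso Γ(X, U)).inv ≫ (Spec Γ(X, U)).presheaf.map V.leTop.op ≫
      (hU.fromSpec.appIso V).inv = X.presheaf.map (homOfLE h).op := by
  rw [← Category.assoc, Iso.comp_inv_eq, Scheme.Hom.appIso_hom']
  rw [Scheme.Hom.map_appLE, Scheme.Hom.appLE, hU.fromSpec_app_self, Category.assoc,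
    ← Functor.map_comp]
  rfl

theorem smul_restrict_fromSpec (M : X.Modules) (V : (Spec Γ(X, U)).Opens)
    (h : hU.fromSpec ''ᵁ V ≤ U) (r : Γ(X, U)) (x : Γ(M, hU.fromSpec ''ᵁ V)) :
    (show Γ(M.restrict hU.fromSpec, V) from (r • (show Γ(M.restrict hU.fromSpec, V) from x))) =
      (show Γ(M.restrict hU.fromSpec, V) from (X.presheaf.map (homOfLE h).op r • x)) := by
  rw [← fromSpec_appIso_inv hU V h]
  rfl

/-- `Γ(M, W) → Γ(M, V)` is a localization with respect to `f`, in elementary terms. The open subset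
`W` is allowed to differ from `U` since the image of the top open subset of `Spec Γ(X, U)` in `X` is
only propositionally equal to `U`. -/
structure IsLocAt (M : X.Modules) {U W V : X.Opens} (hW : W ≤ U) (hV : V ≤ W) (f : Γ(X, U)) :
    Prop where
  exists_lift (s : Γ(M, V)) : ∃ (n : ℕ) (t : Γ(M, W)), M.presheaf.map (homOfLE hV).op t =
    (X.presheaf.map (homOfLE (hV.trans hW)).op f) ^ n • s
  exists_pow_smul (t : Γ(M, W)) (h : M.presheaf.map (homOfLE hV).op t = 0) :
    ∃ n : ℕ, (X.presheaf.map (homOfLE hW).op f) ^ n • t = 0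

theorem fromSpec_image_le (V : (Spec Γ(X, U)).Opens) : hU.fromSpec ''ᵁ V ≤ U :=
  (Scheme.Hom.image_le_opensRange _ _).trans hU.opensRange_fromSpec.le

theorem isLocAt_congr {M : X.Modules} {W V W' V' : X.Opens} {hW : W ≤ U} {hV : V ≤ W}
    {hW' : W' ≤ U} {hV' : V' ≤ W'} {f : Γ(X, U)} (eW : W = W') (eV : V = V') :
    IsLocAt M hW hV f ↔ IsLocAt M hW' hV' f := by
  subst eW eV
  rfl

theorem isLocAt_iff (M : X.Modules) (f : Γ(X, U))
    (hle : hU.fromSpec ''ᵁ (PrimeSpectrum.basicOpen f) ≤ hU.fromSpec ''ᵁ ⊤) :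
    IsLocAt M (fromSpec_image_le hU ⊤) hle f ↔
      IsLocalizedModule (.powers f) ((modulesSpecToSheaf.obj (M.restrict hU.fromSpec)).obj.map
        (PrimeSpectrum.basicOpen f).leTop.op).hom := by
  have h1 (V : (Spec Γ(X, U)).Opens) (n : ℕ) (x : Γ(M.restrict hU.fromSpec, V)) : f ^ n • x =
      (show Γ(M.restrict hU.fromSpec, V) from ((X.presheaf.map
        (homOfLE (fromSpec_image_le hU V)).op f) ^ n • (show Γ(M, hU.fromSpec ''ᵁ V) from x))) := by
    rw [← map_pow]
    exact smul_restrict_fromSpec hU M V _ _ x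
  constructor
  · intro h
    refine ⟨?_, fun s ↦ ?_, fun {t t'} e ↦ ?_⟩
    · rintro ⟨_, n, rfl⟩
      rw [map_pow]
      exact (Scheme.Modules.isUnit_algebraMap_end_of_le_basicOpen f le_rfl).pow n
    · obtain ⟨n, t, e⟩ := h.exists_lift s
      refine ⟨(t, ⟨f ^ n, n, rfl⟩), ?_⟩
      exact (h1 _ n s).trans e.symm
    · let t₁ : Γ(M, hU.fromSpec ''ᵁ ⊤) := t
      let t₁' : Γ(M, hU.fromSpec ''ᵁ ⊤) := t'
      obtain ⟨n, e'⟩ := h.exists_pow_smul (t₁ - t₁')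
        ((map_sub (M.presheaf.map (homOfLE hle).op).hom t₁ t₁').trans (sub_eq_zero.2 e))
      refine ⟨⟨f ^ n, n, rfl⟩, ?_⟩
      exact (h1 _ n t).trans ((sub_eq_zero.1 ((smul_sub _ t₁ t₁').symm.trans e')).trans
        (h1 _ n t').symm)
  · intro h
    constructor
    · intro s
      obtain ⟨⟨t, ⟨_, n, rfl⟩⟩, e⟩ := h.surj s
      exact ⟨n, t, e.symm.trans (h1 _ n s)⟩
    · intro t ht
      obtain ⟨⟨_, n, rfl⟩, e⟩ := h.exists_of_eq (x₁ := t) (x₂ := 0) (ht.trans (map_zero _).symm)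
      refine ⟨n, (h1 _ n t).symm.trans (e.trans ?_)⟩
      exact smul_zero _

theorem isLocalizing_restrict_fromSpec_iff (M : X.Modules) :
    IsLocalizing (modulesSpecToSheaf.obj (M.restrict hU.fromSpec)) ↔
      ∀ f : Γ(X, U), IsLocAt M (le_refl U) (X.basicOpen_le f) f := by
  refine forall_congr' fun f ↦ ?_
  rw [← isLocAt_iff hU M f (Scheme.Hom.image_mono _ le_top)]
  refine isLocAt_congr ?_ (hU.fromSpec_image_basicOpen f)
  rw [Scheme.Hom.image_top_eq_opensRange, hU.opensRange_fromSpec]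

theorem isAffineLocalizing_iff (M : X.Modules) : IsAffineLocalizing (toPMod M) ↔
    ∀ {U : X.Opens}, IsAffineOpen U → ∀ f : Γ(X, U),
      IsLocAt M (le_refl U) (X.basicOpen_le f) f := by
  have h1 {U : X.Opens} (f : Γ(X, U)) (h : U ≤ U) : X.presheaf.map (homOfLE h).op f = f := by
    refine congrArg (fun φ ↦ CommRingCat.Hom.hom φ f) (X.presheaf.map_id (op U))
  constructor
  · intro h U hU f
    refine ⟨(h hU f).exists_lift, fun t ht ↦ ?_⟩
    rw [h1]
    exact (h hU f).exists_pow_smul t ht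
  · intro h U hU f
    refine ⟨(h hU f).exists_lift, fun t ht ↦ ?_⟩
    obtain ⟨n, e⟩ := (h hU f).exists_pow_smul t ht
    rw [h1] at e
    exact ⟨n, e⟩

theorem IsAffineLocalizing.of_isQuasicoherent {M : X.Modules}
    (h : SheafOfModules.IsQuasicoherent.{u} M) : IsAffineLocalizing (toPMod M) := by
  rw [isAffineLocalizing_iff]
  intro U hU
  rw [← isLocalizing_restrict_fromSpec_iff hU, ← isIso_fromTildeΓ_iff_isLocalizing]
  infer_instance

/-- Transport of a presentation of a module on a scheme along an isomorphism. -/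
noncomputable def presentationOfIso {M N : X.Modules} (e : M ≅ N)
    (p : SheafOfModules.Presentation.{u} M) : SheafOfModules.Presentation.{u} N :=
  have : @IsIso (SheafOfModules.{u} X.ringCatSheaf) _ M N e.hom :=
    ⟨e.inv, e.hom_inv_id, e.inv_hom_id⟩
  SheafOfModules.Presentation.ofIsIso.{u} (R := X.ringCatSheaf) (M := M) (N := N) e.hom p

/-- A presentation of the restriction of a module to an open subscheme gives a presentation of
its restriction to the corresponding slice of the site. -/
noncomputable def presentationOver {M : X.Modules} (U : X.Opens)
    (p : SheafOfModules.Presentation.{u} (M.restrict U.ι)) :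
    SheafOfModules.Presentation.{u} (SheafOfModules.over (R := X.ringCatSheaf) M U) :=
  let F : SheafOfModules.{u} (U : Scheme.{u}).ringCatSheaf ⥤
      SheafOfModules.{u} (X.ringCatSheaf.over U) := (Scheme.Modules.overEquiv U).inverse
  have : PreservesColimitsOfSize.{u, u} F :=
    (Scheme.Modules.overEquiv U).symm.toAdjunction.leftAdjoint_preservesColimits
  let e : F.obj (M.restrict U.ι) ≅ SheafOfModules.over (R := X.ringCatSheaf) M U :=
    (Scheme.Modules.overEquiv U).inverse.mapIso ((Scheme.Modules.overFunctorEquiv U).app M).symm ≪≫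
          ((Scheme.Modules.overEquiv U).unitIso.app _).symm
  SheafOfModules.Presentation.ofIsIso.{u} e.hom
    (SheafOfModules.Presentation.map.{u} (R := (U : Scheme.{u}).ringCatSheaf) p F
      ((Scheme.Modules.overEquiv U).unitIso.app _))

/-- A module whose sections over the affine open subsets are compatible with localization is
quasi-coherent: over such an open subset it is the module associated with its sections, and a
presentation of the module of sections gives one of the sheaf. -/
theorem IsAffineLocalizing.isQuasicoherent {M : X.Modules} (h : IsAffineLocalizing (toPMod M)) :
    SheafOfModules.IsQuasicoherent.{u} M := by
  rw [isAffineLocalizing_iff] at h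
  have pres (U : X.Opens) (hU : IsAffineOpen U) :
      Nonempty (SheafOfModules.Presentation.{u} (M.restrict U.ι)) := by
    have h1 := (isLocalizing_restrict_fromSpec_iff hU M).2 (h hU)
    have := (isIso_fromTildeΓ_iff_isLocalizing _).2 h1
    let p₀ := presentationTilde.{u} ((modulesSpecToSheaf.obj (M.restrict hU.fromSpec)).presheaf.obj
      (.op ⊤)) .univ (by simp) _ (Submodule.span_eq _)
    let p := presentationOfIso (asIso (M.restrict hU.fromSpec).fromTildeΓ) p₀
    let q := Scheme.Modules.presentationRestrict hU.isoSpec.hom p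
    let i : Scheme.Modules.restrictFunctor hU.fromSpec ⋙
        Scheme.Modules.restrictFunctor hU.isoSpec.hom ≅ Scheme.Modules.restrictFunctor U.ι :=
      (Scheme.Modules.restrictFunctorComp _ _).symm ≪≫
        Scheme.Modules.restrictFunctorCongr hU.isoSpec_hom_fromSpec
    exact ⟨presentationOfIso (i.app M) q⟩
  let q : SheafOfModules.QuasicoherentData.{u} (R := X.ringCatSheaf) M :=
    { I := X.affineOpens
      X := fun U ↦ U.1
      coversTop := by
        refine (Opens.coversTop_iff X _).2 ?_
        exact iSup_affineOpens_eq_top X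
      presentation := fun U ↦ presentationOver U.1 (pres U.1 U.2).some }
  exact q.isQuasicoherent

end QuasiCoherent

end StratPro

/-! ### Locally bijective morphisms of presheaves of modules -/

namespace StratPro

open Limits AlgebraicGeometry TopologicalSpace PMod

section LocallyBijective

variable {X : Scheme.{u}}

theorem rho_rho (P : PMod X.presheaf) {U V W : X.Opensᵒᵖ} (i : U ⟶ V) (j : V ⟶ W) (l : U ⟶ W)
    (s : P.obj U) : rho P j (rho P i s) = rho P l s := by
  rw [← rho_comp]
  rfl

/-- The separation axiom for the sheaf underlying a module. -/
theorem eq_zero_of_locally (M : X.Modules) {U : X.Opens} (s : (toPMod M).obj (op U))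
    (h : ∀ x ∈ U, ∃ (V : X.Opens) (i : V ≤ U), x ∈ V ∧ rho (toPMod M) (homOfLE i).op s = 0) :
    s = 0 := by
  refine TopCat.Presheaf.IsSheaf.section_ext (F := M.presheaf) M.isSheaf (U := op U) (s := s)
    (t := (0 : (toPMod M).obj (op U))) fun x hx ↦ ?_
  obtain ⟨V, i, hV, e⟩ := h x hx
  exact ⟨V, i, hV, e.trans (map_zero (rho (toPMod M) (homOfLE i).op)).symm⟩

/-- A morphism of presheaves of modules which is bijective locally on the scheme. -/
structure IsLocallyBijective {P Q : PMod X.presheaf} (η : P ⟶ Q) : Prop where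
  exists_rho_eq_zero {U : X.Opens} (s : P.obj (op U)) (h : lin η (op U) s = 0) (x : X)
    (hx : x ∈ U) : ∃ (V : X.Opens) (i : V ≤ U), x ∈ V ∧ rho P (homOfLE i).op s = 0
  exists_lin_eq {U : X.Opens} (q : Q.obj (op U)) (x : X) (hx : x ∈ U) :
    ∃ (V : X.Opens) (i : V ≤ U), x ∈ V ∧ ∃ s : P.obj (op V),
      lin η (op V) s = rho Q (homOfLE i).op q

variable {U : X.Opens} (hU : IsAffineOpen U)

include hU in
theorem exists_mem_basicOpen {V : X.Opens} (x : X) (hx : x ∈ U) (hxV : x ∈ V) :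
    ∃ f : Γ(X, U), X.basicOpen f ≤ V ∧ x ∈ X.basicOpen f :=
  hU.exists_basicOpen_le ⟨x, hxV⟩ hx

include hU in
/-- An ideal of `Γ(X, U)` whose basic open subsets cover the affine open subset `U` is trivial. -/
theorem eq_top_of_cover (𝔞 : Ideal Γ(X, U)) (h : ∀ x ∈ U, ∃ f ∈ 𝔞, x ∈ X.basicOpen f) :
    𝔞 = ⊤ := by
  rw [← Ideal.span_eq 𝔞, ← hU.iSup_basicOpen_eq_self_iff]
  refine le_antisymm (iSup_le fun f ↦ X.basicOpen_le _) fun x hx ↦ ?_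
  obtain ⟨f, hf, hxf⟩ := h x hx
  exact Opens.mem_iSup.2 ⟨⟨f, hf⟩, hxf⟩

namespace IsLocallyBijective

variable {P : PMod X.presheaf} (hP : IsAffineLocalizing P)

include hU hP in
/-- A locally bijective morphism is injective on the sections of an affine-localizing presheaf over
an affine open subset: the annihilator of a section in the kernel is not contained in any prime
ideal. -/
theorem lin_injective {Q : PMod X.presheaf} {η : P ⟶ Q} (h : IsLocallyBijective η) :
    Function.Injective (lin η (op U)) := by
  rw [injective_iff_map_eq_zero]
  intro s hs
  have key : LinearMap.ker (LinearMap.toSpanSingleton Γ(X, U) (P.obj (op U)) s) = ⊤ := by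
    refine eq_top_of_cover hU _ fun x hx ↦ ?_
    obtain ⟨V, i, hxV, e⟩ := h.exists_rho_eq_zero s hs x hx
    obtain ⟨f, hf, hxf⟩ := exists_mem_basicOpen hU x hx hxV
    obtain ⟨n, en⟩ := (hP hU f).exists_pow_smul s (by
      rw [← rho_rho P (homOfLE i).op (homOfLE hf).op, e, map_zero])
    refine ⟨f ^ (n + 1), ?_, ?_⟩
    · rw [LinearMap.mem_ker, LinearMap.toSpanSingleton_apply, pow_succ', mul_smul]
      refine (congrArg (f • ·) en).trans (smul_zero f)
    · rwa [X.basicOpen_pow _ n.succ_pos]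
  have h1 : (1 : Γ(X, U)) ∈ LinearMap.ker
    (LinearMap.toSpanSingleton Γ(X, U) (P.obj (op U)) s) := key ▸ trivial
  rwa [LinearMap.mem_ker, LinearMap.toSpanSingleton_apply, one_smul] at h1

variable {M : X.Modules} {η : P ⟶ toPMod M} (h : IsLocallyBijective η)

include hU hP h in
/-- A section of `M` over `U` which vanishes on `D(f)` is killed by a power of `f`. Locally on `U`
it comes from `P`, where the statement holds; `U` is quasi-compact. -/
theorem exists_pow_smul (f : Γ(X, U)) (d : (toPMod M).obj (op U))
    (hd : rho (toPMod M) (basicHom f) d = 0) : ∃ n : ℕ, f ^ n • d = 0 := by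
  have key : ∃ (V : X.Opens) (_ : U ≤ V) (i : V ≤ U) (n : ℕ),
      rho (toPMod M) (homOfLE i).op (f ^ n • d) = 0 := by
    refine hU.isCompact.induction_on (p := fun s ↦ ∃ (V : X.Opens) (_ : s ⊆ V) (i : V ≤ U) (n : ℕ),
      rho (toPMod M) (homOfLE i).op (f ^ n • d) = 0) ?_ ?_ ?_ ?_
    · refine ⟨⊥, Set.empty_subset _, bot_le, 0, ?_⟩
      exact eq_zero_of_locally M _ fun x hx ↦ hx.elim
    · rintro s t hst ⟨V, hV, i, n, e⟩
      exact ⟨V, hst.trans hV, i, n, e⟩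
    · rintro s t ⟨V, hV, i, n, e⟩ ⟨V', hV', i', n', e'⟩
      refine ⟨V ⊔ V', Set.union_subset_union hV hV', sup_le i i', n + n', ?_⟩
      refine eq_zero_of_locally M _ fun x hx ↦ ?_
      obtain hx | hx := hx
      · refine ⟨V, le_sup_left, hx, ?_⟩
        rw [rho_rho (toPMod M) _ _ (homOfLE i).op, add_comm, pow_add, mul_smul, map_smulₛₗ, e,
          smul_zero]
      · refine ⟨V', le_sup_right, hx, ?_⟩
        rw [rho_rho (toPMod M) _ _ (homOfLE i').op, pow_add, mul_smul, map_smulₛₗ, e', smul_zero]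
    · intro x hx
      -- On `D(g)` the section `d` is the image of `s'`, which vanishes on `D(fg)` by injectivity.
      obtain ⟨V, i, hxV, s, e⟩ := h.exists_lin_eq d x hx
      obtain ⟨g, hg, hxg⟩ := exists_mem_basicOpen hU x hx hxV
      refine ⟨X.basicOpen g, mem_nhdsWithin_of_mem_nhds ((X.basicOpen g).isOpen.mem_nhds hxg),
        X.basicOpen g, subset_rfl, X.basicOpen_le g, ?_⟩
      let f' : Γ(X, X.basicOpen g) := (X.presheaf.map (basicHom g)).hom f
      let s' := rho P (homOfLE hg).op s
      have e' : lin η _ s' = rho (toPMod M) (basicHom g) d := by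
        rw [lin_rho, e, rho_rho]
      have hf' : X.basicOpen f' ≤ X.basicOpen f := by
        refine (X.basicOpen_res f (basicHom g)).le.trans inf_le_right
      obtain ⟨n, en⟩ := (hP (hU.basicOpen g) f').exists_pow_smul s' (by
        refine h.lin_injective ((hU.basicOpen g).basicOpen f') hP ?_
        rw [lin_rho, e', rho_rho (toPMod M) _ _ (basicHom f ≫ (homOfLE hf').op), rho_comp, hd,
          map_zero, map_zero])
      refine ⟨n, ?_⟩
      rw [map_smulₛₗ, map_pow]
      refine (congrArg _ e'.symm).trans ((map_smul (lin η _) (f' ^ n) s').symm.trans ?_)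
      rw [en, map_zero]
  obtain ⟨V, hV, i, n, e⟩ := key
  obtain rfl := le_antisymm i hV
  exact ⟨n, (rho_id _ _ _).symm.trans e⟩

include hU hP h in
/-- A locally bijective morphism from an affine-localizing presheaf to a sheaf is surjective on the
sections over an affine open subset `U`: the `f` such that `f • q` is in the image generate the unit
ideal. -/
theorem lin_surjective : Function.Surjective (lin η (op U)) := by
  intro q
  have key : (LinearMap.range (lin η (op U))).comap
      (LinearMap.toSpanSingleton Γ(X, U) ((toPMod M).obj (op U)) q) = ⊤ := by
    refine eq_top_of_cover hU _ fun x hx ↦ ?_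
    obtain ⟨V, i, hxV, s, e⟩ := h.exists_lin_eq q x hx
    obtain ⟨f, hf, hxf⟩ := exists_mem_basicOpen hU x hx hxV
    obtain ⟨n, t, et⟩ := (hP hU f).exists_lift (rho P (homOfLE hf).op s)
    obtain ⟨n', en'⟩ := h.exists_pow_smul hU hP f (f ^ n • q - lin η (op U) t) (by
      rw [map_sub, ← lin_rho, et, map_smulₛₗ, map_smul, lin_rho, e, rho_rho (toPMod M) _ _
        (basicHom f), map_pow, sub_self])
    refine ⟨f ^ (n' + n + 1), ⟨f • f ^ n' • t, ?_⟩, ?_⟩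
    · rw [LinearMap.toSpanSingleton_apply, pow_succ', pow_add, mul_smul, mul_smul, map_smul,
        map_smul]
      rw [smul_sub, sub_eq_zero] at en'
      exact congrArg (f • ·) en'.symm
    · rwa [X.basicOpen_pow _ (Nat.succ_pos _)]
  have h1 : (1 : Γ(X, U)) ∈ (LinearMap.range (lin η (op U))).comap
      (LinearMap.toSpanSingleton Γ(X, U) ((toPMod M).obj (op U)) q) := key ▸ trivial
  rwa [Submodule.mem_comap, LinearMap.toSpanSingleton_apply, one_smul] at h1

include hP h in
/-- The sheaf associated with an affine-localizing presheaf is affine-localizing, with the same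
sections over the affine open subsets. -/
theorem isAffineLocalizing : IsAffineLocalizing (toPMod M) := by
  intro U hU f
  refine ⟨fun q ↦ ?_, h.exists_pow_smul hU hP f⟩
  obtain ⟨s, rfl⟩ := h.lin_surjective (hU.basicOpen f) hP q
  obtain ⟨n, t, e⟩ := (hP hU f).exists_lift s
  exact ⟨n, lin η (op U) t, by rw [← lin_rho, e, map_smul]⟩

end IsLocallyBijective

end LocallyBijective

end StratPro

/-! ### Sections of kernels and cokernels of quasi-coherent modules -/

namespace StratPro

open Limits AlgebraicGeometry TopologicalSpace PMod

section Sections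

variable {X : Scheme.{u}}

/-- A presheaf of modules is locally isomorphic to its associated sheaf. -/
theorem isLocallyBijective_unit (P : PMod X.presheaf) :
    IsLocallyBijective ((pmodAdj X).unit.app P) := by
  let J := Opens.grothendieckTopology X
  have e := PresheafOfModules.toPresheaf_map_sheafificationAdjunction_unit_app
    (𝟙 X.ringCatSheaf.obj) P
  have h1 : Presheaf.IsLocallyInjective J (toSheafify J P.presheaf) := inferInstance
  have h2 : Presheaf.IsLocallySurjective J (toSheafify J P.presheaf) := inferInstance
  have e' (U : X.Opens) (s : P.obj (op U)) : lin ((pmodAdj X).unit.app P) (op U) s =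
      (toSheafify J P.presheaf).app (op U) s :=
    congrArg (fun φ : P.presheaf ⟶ _ ↦ ConcreteCategory.hom (NatTrans.app φ (op U)) s) e
  constructor
  · intro U s hs x hx
    obtain ⟨V, i, hV, hxV⟩ := h1.equalizerSieve_mem (X := op U) s (0 : P.obj (op U))
      (((e' U s).symm.trans hs).trans (map_zero ((toSheafify J P.presheaf).app (op U)).hom).symm)
      x hx
    exact ⟨V, i.le, hxV, Eq.trans hV (map_zero (rho P i.op))⟩
  · intro U q x hx
    obtain ⟨V, i, ⟨s, hs⟩, hxV⟩ := h2.imageSieve_mem (U := U) q x hx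
    exact ⟨V, i.le, hxV, s, (e' V s).trans hs⟩

theorem IsLocallyBijective.comp {P Q Q' : PMod X.presheaf} {η : P ⟶ Q}
    (h : IsLocallyBijective η) (ψ : Q ⟶ Q') (hψ : ∀ U, Function.Bijective (lin ψ U)) :
    IsLocallyBijective (η ≫ ψ) := by
  constructor
  · intro U s hs x hx
    refine h.exists_rho_eq_zero s ((hψ _).1 ?_) x hx
    rw [map_zero]
    exact hs
  · intro U q' x hx
    obtain ⟨q, rfl⟩ := (hψ _).2 q'
    obtain ⟨V, i, hxV, s, hs⟩ := h.exists_lin_eq q x hx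
    refine ⟨V, i, hxV, s, ?_⟩
    rw [← lin_rho, ← hs]
    rfl

/-- The map on sections of a morphism of modules. -/
noncomputable abbrev sec {M N : X.Modules} (φ : M ⟶ N) (U : X.Opens) :
    (toPMod M).obj (op U) →ₗ[X.presheaf.obj (op U)] (toPMod N).obj (op U) :=
  lin ((pmod X).map φ) (op U)

theorem sec_rho {M N : X.Modules} (φ : M ⟶ N) {U V : X.Opens} (i : op U ⟶ op V)
    (x : (toPMod M).obj (op U)) : sec φ V (rho (toPMod M) i x) = rho (toPMod N) i (sec φ U x) :=
  lin_rho _ i x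

theorem sec_sec_eq_zero {M N K : X.Modules} {φ : M ⟶ N} {ψ : N ⟶ K} (h : φ ≫ ψ = 0)
    (U : X.Opens) (x : (toPMod M).obj (op U)) : sec ψ U (sec φ U x) = 0 := by
  have h1 : sec (φ ≫ ψ) U x = (0 : (toPMod K).obj (op U)) := by
    rw [h]
    rfl
  exact h1

theorem sec_bijective_of_iso {M N : X.Modules} (e : M ≅ N) (U : X.Opens) :
    Function.Bijective (sec e.hom U) := by
  refine Function.bijective_iff_has_inverse.2 ⟨sec e.inv U, fun x ↦ ?_, fun x ↦ ?_⟩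
  · have h : sec (e.hom ≫ e.inv) U x = x := by
      rw [e.hom_inv_id]
      rfl
    exact h
  · have h : sec (e.inv ≫ e.hom) U x = x := by
      rw [e.inv_hom_id]
      rfl
    exact h

/-- A morphism of modules with affine-localizing source vanishes when it vanishes on the sections
over the members of an affine open covering. -/
theorem eq_zero_of_sec {M N : X.Modules} (hM : IsAffineLocalizing (toPMod M)) (φ : M ⟶ N)
    (h : ∀ x : X, ∃ U : X.Opens, IsAffineOpen U ∧ x ∈ U ∧ ∀ s, sec φ U s = 0) : φ = 0 := by
  refine Scheme.Modules.hom_ext _ _ fun V ↦ ?_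
  ext s₀
  let s : (toPMod M).obj (op V) := s₀
  refine eq_zero_of_locally N (sec φ V s) fun x hx ↦ ?_
  obtain ⟨U, hU, hxU, hs⟩ := h x
  obtain ⟨f, hf, hxf⟩ := exists_mem_basicOpen hU x hxU hx
  refine ⟨X.basicOpen f, hf, hxf, ?_⟩
  rw [← sec_rho]
  obtain ⟨n, t, e⟩ := (hM hU f).exists_lift (rho (toPMod M) (homOfLE hf).op s)
  have hu : IsUnit ((X.presheaf.map (basicHom f)).hom f) :=
    RingedSpace.isUnit_res_basicOpen _ f
  refine (IsUnit.smul_eq_zero (hu.pow n)).1 ?_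
  rw [← map_smul, ← e, sec_rho, hs, map_zero]

theorem eq_zero_of_sec_affine {M N : X.Modules} (hM : IsAffineLocalizing (toPMod M)) (φ : M ⟶ N)
    (h : ∀ U : X.Opens, IsAffineOpen U → ∀ s, sec φ U s = 0) : φ = 0 :=
  eq_zero_of_sec hM φ fun x ↦ by
    obtain ⟨U, hU, hx, -⟩ := X.isBasis_affineOpens.exists_subset_of_mem_open
      (Set.mem_univ x) isOpen_univ
    obtain ⟨U, hU, rfl⟩ := hU
    exact ⟨U, hU, hx, h U hU⟩

section Quotient

variable {P Q : PMod X.presheaf} (φ : P ⟶ Q)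

/-- The presheaf cokernel of a morphism. -/
noncomputable def quot : PMod X.presheaf :=
  ofRho (fun U ↦ Q.obj U ⧸ LinearMap.range (lin φ U))
    (fun {U V} i ↦ Submodule.mapQ _ _ (rho Q i) (by
      rintro _ ⟨x, rfl⟩
      exact ⟨rho P i x, lin_rho φ i x⟩))
    (fun U x ↦ by
      obtain ⟨x, rfl⟩ := Submodule.Quotient.mk_surjective _ x
      exact congrArg (Submodule.Quotient.mk (p := LinearMap.range (lin φ U))) (rho_id Q U x))
    (fun {U V W} i j x ↦ by
      obtain ⟨x, rfl⟩ := Submodule.Quotient.mk_surjective _ x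
      exact congrArg (Submodule.Quotient.mk (p := LinearMap.range (lin φ W))) (rho_comp Q i j x))

/-- The projection to the presheaf cokernel. -/
noncomputable def quotMk : Q ⟶ quot φ :=
  homOfLin (N := quot φ) (fun U ↦ Submodule.mkQ (LinearMap.range (lin φ U))) fun _ _ ↦ rfl

theorem quotMk_surjective (U : X.Opensᵒᵖ) : Function.Surjective (lin (quotMk φ) U) :=
  Submodule.mkQ_surjective _

theorem quotMk_exact (U : X.Opensᵒᵖ) : Function.Exact (lin φ U) (lin (quotMk φ) U) := fun x ↦
  Submodule.Quotient.mk_eq_zero (LinearMap.range (lin φ U)) (x := x)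

variable {φ}

theorem isAffineLocalizing_quot (hP : IsAffineLocalizing P) (hQ : IsAffineLocalizing Q) :
    IsAffineLocalizing (quot φ) := by
  intro U hU f
  constructor
  · intro y
    obtain ⟨y, rfl⟩ := quotMk_surjective φ _ y
    obtain ⟨n, x, e⟩ := (hQ hU f).exists_lift y
    exact ⟨n, lin (quotMk φ) _ x, by rw [← lin_rho, e, map_smul]⟩
  · intro x h
    obtain ⟨x, rfl⟩ := quotMk_surjective φ _ x
    rw [← lin_rho] at h
    obtain ⟨s, e⟩ := (quotMk_exact φ _ _).1 h
    obtain ⟨n, t, et⟩ := (hP hU f).exists_lift s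
    obtain ⟨n', en⟩ := (hQ hU f).exists_pow_smul (f ^ n • x - lin φ _ t) (by
      rw [map_sub, map_smulₛₗ, ← lin_rho, et, map_smul, e, map_pow, sub_self])
    refine ⟨n' + n, ?_⟩
    rw [smul_sub, sub_eq_zero, ← map_smul] at en
    rw [pow_add, mul_smul, ← map_smul, ← map_smul, en]
    exact (quotMk_exact φ _ _).2 ⟨_, rfl⟩

/-- The universal property of the presheaf cokernel. -/
noncomputable def quotDesc {W : PMod X.presheaf} (w : Q ⟶ W)
    (h : ∀ U x, lin w U (lin φ U x) = 0) : quot φ ⟶ W :=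
  homOfLin (M := quot φ) (fun U ↦ Submodule.liftQ (LinearMap.range (lin φ U)) (lin w U) (by
    rintro _ ⟨x, rfl⟩
    exact h U x)) (fun {U V} i x ↦ by
      obtain ⟨x, rfl⟩ := Submodule.Quotient.mk_surjective _ x
      exact lin_rho w i x)

theorem quotMk_desc {W : PMod X.presheaf} (w : Q ⟶ W)
    (h : ∀ U x, lin w U (lin φ U x) = 0) : quotMk φ ≫ quotDesc w h = w :=
  PMod.hom_ext fun _ ↦ rfl

theorem quot_hom_ext {W : PMod X.presheaf} {w w' : quot φ ⟶ W}
    (h : quotMk φ ≫ w = quotMk φ ≫ w') : w = w' :=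
  PMod.hom_ext fun U ↦ LinearMap.ext fun x ↦ by
    obtain ⟨x, rfl⟩ := quotMk_surjective φ _ x
    exact congrArg (fun ψ ↦ lin ψ U x) h

end Quotient

section Cokernel

variable {F G : X.Modules} (u : F ⟶ G)

/-- The presheaf cokernel of a morphism of sheaves of modules. -/
noncomputable abbrev preCoker : PMod X.presheaf :=
  quot ((pmod X).map u)

/-- The sheaf associated with the presheaf cokernel. -/
noncomputable def coker : X.Modules :=
  (pmodSheafify X).obj (preCoker u)

/-- The canonical morphism from the presheaf cokernel to the cokernel. -/
noncomputable def cokerUnit : preCoker u ⟶ toPMod (coker u) :=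
  (pmodAdj X).unit.app (preCoker u)

/-- The morphisms out of the cokernel are those out of the presheaf cokernel. -/
noncomputable def cokerEquiv (W : X.Modules) : (coker u ⟶ W) ≃ (preCoker u ⟶ toPMod W) :=
  (pmodAdj X).homEquiv (preCoker u) W

theorem cokerEquiv_apply {W : X.Modules} (v : coker u ⟶ W) :
    cokerEquiv u W v = cokerUnit u ≫ (pmod X).map v :=
  (pmodAdj X).homEquiv_unit (preCoker u) W v

/-- The projection from the target of `u` to the sheaf associated with the presheaf cokernel. -/
noncomputable def cokerπ : G ⟶ coker u :=
  (pmod X).preimage (quotMk _ ≫ cokerUnit u)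

theorem map_cokerπ : (pmod X).map (cokerπ u) =
    quotMk _ ≫ cokerUnit u :=
  Functor.map_preimage _ _

theorem comp_cokerπ : u ≫ cokerπ u = 0 := by
  refine Scheme.Modules.hom_ext _ _ fun V ↦ ?_
  ext s₀
  let s : (toPMod F).obj (op V) := s₀
  have h : lin ((pmod X).map (cokerπ u)) (op V) (sec u V s) = 0 := by
    rw [map_cokerπ, lin_comp, (quotMk_exact _ _ _).2 ⟨s, rfl⟩, map_zero]
  exact h

/-- The sheaf associated with the presheaf cokernel is a cokernel. -/
noncomputable def isColimitCokerπ : IsColimit (CokernelCofork.ofπ (cokerπ u) (comp_cokerπ u)) :=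
  CokernelCofork.IsColimit.ofπ _ _
    (fun {W} w hw ↦ (cokerEquiv u W).symm
      (quotDesc ((pmod X).map w) fun U x ↦ sec_sec_eq_zero hw U.unop x))
    (fun {W} w hw ↦ (pmod X).map_injective (by
      rw [Functor.map_comp, map_cokerπ, Category.assoc, ← cokerEquiv_apply,
        Equiv.apply_symm_apply, quotMk_desc]))
    (fun {W} w hw v hv ↦ by
      refine (cokerEquiv u W).injective (quot_hom_ext ?_)
      rw [Equiv.apply_symm_apply, quotMk_desc, ← hv, Functor.map_comp, map_cokerπ,
        cokerEquiv_apply, Category.assoc])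

variable {u}

theorem exists_isLocallyBijective_cokernel {k : CokernelCofork u} (hk : IsColimit k) :
    ∃ η : preCoker u ⟶ toPMod k.pt, IsLocallyBijective η ∧
      quotMk _ ≫ η = (pmod X).map k.π := by
  let e := (isColimitCokerπ u).coconePointUniqueUpToIso hk
  refine ⟨cokerUnit u ≫ (pmod X).map e.hom,
    (isLocallyBijective_unit _).comp _ fun U ↦ sec_bijective_of_iso e U.unop, ?_⟩
  have h : cokerπ u ≫ e.hom = k.π :=
    (isColimitCokerπ u).comp_coconePointUniqueUpToIso_hom hk .one
  rw [← h, Functor.map_comp, map_cokerπ, Category.assoc]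

variable (hF : IsAffineLocalizing (toPMod F)) (hG : IsAffineLocalizing (toPMod G))
  {k : CokernelCofork u} (hk : IsColimit k)

include hF hG hk

theorem isAffineLocalizing_cokernel : IsAffineLocalizing (toPMod k.pt) := by
  obtain ⟨η, h, -⟩ := exists_isLocallyBijective_cokernel hk
  exact h.isAffineLocalizing (isAffineLocalizing_quot hF hG)

theorem sec_cokernel_surjective {U : X.Opens} (hU : IsAffineOpen U) :
    Function.Surjective (sec k.π U) := by
  obtain ⟨η, h, e⟩ := exists_isLocallyBijective_cokernel hk
  rw [sec, ← e]
  exact (h.lin_surjective hU (isAffineLocalizing_quot hF hG)).comp (quotMk_surjective _ _)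

theorem sec_cokernel_exact {U : X.Opens} (hU : IsAffineOpen U) :
    Function.Exact (sec u U) (sec k.π U) := by
  obtain ⟨η, h, e⟩ := exists_isLocallyBijective_cokernel hk
  intro x
  refine Iff.trans ?_ (quotMk_exact ((pmod X).map u) (op U) x)
  rw [sec, ← e, lin_comp]
  exact map_eq_zero_iff (lin η (op U)) (h.lin_injective hU (isAffineLocalizing_quot hF hG))

end Cokernel

section Kernel

variable {F G : X.Modules} {u : F ⟶ G}

/-- The sections over an open subset, as a functor. -/
noncomputable def secFunctor (U : X.Opens) : X.Modules ⥤ Ab.{u} :=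
  Scheme.Modules.toPresheaf X ⋙ (evaluation (Opens X)ᵒᵖ Ab.{u}).obj (op U)

instance (U : X.Opens) : PreservesLimits (secFunctor U) :=
  have : PreservesLimits ((evaluation (Opens X)ᵒᵖ Ab.{u}).obj (op U)) :=
    evaluationPreservesLimits (op U)
  comp_preservesLimits (Scheme.Modules.toPresheaf X) ((evaluation (Opens X)ᵒᵖ Ab.{u}).obj (op U))

instance (U : X.Opens) : (secFunctor U).PreservesZeroMorphisms := ⟨fun _ _ ↦ rfl⟩

theorem sec_injective_of_mono [Mono u] (U : X.Opens) : Function.Injective (sec u U) :=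
  (AddCommGrpCat.mono_iff_injective ((secFunctor U).map u)).1 inferInstance

theorem sec_kernel_exact {k : KernelFork u} (hk : IsLimit k) (U : X.Opens) :
    Function.Exact (sec k.ι U) (sec u U) := by
  have : Mono k.ι := mono_of_isLimit_fork hk
  let S := ShortComplex.mk k.ι u k.condition
  have hS : S.Exact := S.exact_of_f_is_kernel (IsLimit.ofIsoLimit hk (Fork.ext (Iso.refl _)))
  have h := hS.map_of_mono_of_preservesKernel (secFunctor U) this inferInstance
  intro x
  constructor
  · exact (ShortComplex.ab_exact_iff _).1 h x
  · rintro ⟨y, rfl⟩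
    exact sec_sec_eq_zero k.condition U y

theorem isAffineLocalizing_kernel (hF : IsAffineLocalizing (toPMod F))
    (hG : IsAffineLocalizing (toPMod G)) {k : KernelFork u} (hk : IsLimit k) :
    IsAffineLocalizing (toPMod k.pt) := by
  have : Mono k.ι := mono_of_isLimit_fork hk
  intro U hU f
  constructor
  · intro y
    obtain ⟨n, x, e⟩ := (hF hU f).exists_lift (sec k.ι _ y)
    obtain ⟨n', e'⟩ := (hG hU f).exists_pow_smul (sec u U x) (by
      rw [← sec_rho, e, map_smul, (sec_kernel_exact hk _ _).2 ⟨y, rfl⟩, smul_zero])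
    rw [← map_smul] at e'
    obtain ⟨t, et⟩ := (sec_kernel_exact hk U _).1 e'
    refine ⟨n' + n, t, sec_injective_of_mono (u := k.ι) _ ?_⟩
    rw [sec_rho, et, map_smulₛₗ, e, map_smul, pow_add, mul_smul, map_pow]
  · intro x h
    obtain ⟨n, e⟩ := (hF hU f).exists_pow_smul (sec k.ι U x) (by rw [← sec_rho, h, map_zero])
    refine ⟨n, sec_injective_of_mono (u := k.ι) _ ?_⟩
    rw [map_smul, e, map_zero]

end Kernel

end Sections

end StratPro

/-! ### Coherent modules and their principal parts -/

namespace StratPro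

open Limits AlgebraicGeometry TopologicalSpace PMod

section Coherent

variable {X : Scheme.{u}}

/-- Coherent modules in terms of sections over affine open subsets. -/
theorem isCoherent_iff {M : X.Modules} : IsCoherent X M ↔ IsAffineLocalizing (toPMod M) ∧
    ∀ U : X.Opens, IsAffineOpen U →
      Module.Finite (X.presheaf.obj (op U)) ((toPMod M).obj (op U)) :=
  and_congr ⟨IsAffineLocalizing.of_isQuasicoherent, IsAffineLocalizing.isQuasicoherent⟩ Iff.rfl

instance : (IsCoherent X).ContainsZero where
  exists_zero := by
    obtain ⟨Z, hZ⟩ := HasZeroObject.zero (C := X.Modules)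
    refine ⟨Z, hZ, isCoherent_iff.2 ?_⟩
    have h (U : X.Opens) (x : (toPMod Z).obj (op U)) : x = 0 := by
      have h1 : sec (𝟙 Z) U x = (0 : (toPMod Z).obj (op U)) := by
        rw [hZ.eq_of_src (𝟙 _) 0]
        rfl
      exact h1
    refine ⟨fun U hU f ↦ ⟨fun y ↦ ⟨0, 0, ?_⟩, fun x _ ↦ ⟨0, h _ _⟩⟩, fun U _ ↦ ?_⟩
    · exact (h _ _).trans (h _ _).symm
    · exact ⟨⟨∅, eq_top_iff.2 fun x _ ↦ by rw [h U x]; exact zero_mem _⟩⟩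

instance : (IsCoherent X).IsClosedUnderCokernels where
  cokernels_le := by
    rintro _ ⟨u, k, hk, hF, hG⟩
    rw [isCoherent_iff] at hF hG ⊢
    refine ⟨isAffineLocalizing_cokernel hF.1 hG.1 hk, fun U hU ↦ ?_⟩
    have := hG.2 U hU
    exact Module.Finite.of_surjective _ (sec_cokernel_surjective hF.1 hG.1 hk hU)

instance [IsLocallyNoetherian X] : (IsCoherent X).IsClosedUnderKernels where
  kernels_le := by
    rintro _ ⟨u, k, hk, hF, hG⟩
    rw [isCoherent_iff] at hF hG ⊢
    refine ⟨isAffineLocalizing_kernel hF.1 hG.1 hk, fun U hU ↦ ?_⟩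
    have := hF.2 U hU
    have : IsNoetherianRing (X.presheaf.obj (op U)) :=
      IsLocallyNoetherian.component_noetherian ⟨U, hU⟩
    have : Mono k.ι := mono_of_isLimit_fork hk
    exact Module.Finite.of_injective _ (sec_injective_of_mono (u := k.ι) U)

/-- A module which splits as `M ⊕ N`, with `M` and `N` coherent, is coherent. This covers finite
products as well as isomorphic copies of a coherent module. -/
theorem isCoherent_of_total {M N B : X.Modules} (fst : B ⟶ M) (snd : B ⟶ N) (inl : M ⟶ B)
    (inr : N ⟶ B) (h : fst ≫ inl + snd ≫ inr = 𝟙 B) (hM : IsCoherent X M) (hN : IsCoherent X N) :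
    IsCoherent X B := by
  rw [isCoherent_iff] at hM hN ⊢
  have e (U : X.Opens) (x : (toPMod B).obj (op U)) :
      sec inl U (sec fst U x) + sec inr U (sec snd U x) = x := by
    have h1 : sec (fst ≫ inl + snd ≫ inr) U x = x := by
      rw [h]
      rfl
    exact h1
  refine ⟨fun U hU f ↦ ⟨fun y ↦ ?_, fun x hx ↦ ?_⟩, fun U hU ↦ ?_⟩
  · obtain ⟨n, s, hs⟩ := (hM.1 hU f).exists_lift (sec fst _ y)
    obtain ⟨n', s', hs'⟩ := (hN.1 hU f).exists_lift (sec snd _ y)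
    refine ⟨n' + n, f ^ n' • sec inl U s + f ^ n • sec inr U s', ?_⟩
    rw [map_add, map_smulₛₗ, map_smulₛₗ, ← sec_rho, ← sec_rho, hs, hs', map_smul, map_smul, map_pow,
      map_pow, smul_smul, smul_smul, ← pow_add, ← pow_add, add_comm n, ← smul_add, e]
  · obtain ⟨n, hn⟩ := (hM.1 hU f).exists_pow_smul (sec fst U x) (by rw [← sec_rho, hx, map_zero])
    obtain ⟨n', hn'⟩ := (hN.1 hU f).exists_pow_smul (sec snd U x) (by rw [← sec_rho, hx, map_zero])
    refine ⟨n + n', ?_⟩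
    have h1 : sec inl U (sec fst U (f ^ (n + n') • x)) = 0 := by
      rw [map_smul, add_comm n, pow_add, mul_smul, hn, smul_zero, map_zero]
    have h2 : sec inr U (sec snd U (f ^ (n + n') • x)) = 0 := by
      rw [map_smul, pow_add, mul_smul, hn', smul_zero, map_zero]
    rw [← e U (f ^ (n + n') • x), h1, h2, add_zero]
  · have := hM.2 U hU
    have := hN.2 U hU
    refine Module.Finite.of_surjective ((sec inl U).coprod (sec inr U)) fun x ↦
      ⟨(sec fst U x, sec snd U x), ?_⟩
    exact e U x

instance : (IsCoherent X).IsClosedUnderBinaryProducts where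
  limitsOfShape_le := by
    rintro B ⟨p⟩
    let t : BinaryFan (p.diag.obj ⟨.left⟩) (p.diag.obj ⟨.right⟩) :=
      (Cone.postcompose (diagramIsoPair p.diag).hom).obj (Cone.mk B p.π)
    let ht : IsLimit t := (IsLimit.postcomposeHomEquiv (diagramIsoPair p.diag) _).2 p.isLimit
    let b := BinaryBicone.ofLimitCone ht
    exact isCoherent_of_total b.fst b.snd b.inl b.inr
      (IsBilimit.binary_total (binaryBiconeIsBilimitOfLimitConeOfIsLimit ht))
      (p.prop_diag_obj (.mk .left)) (p.prop_diag_obj (.mk .right))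

instance : (IsCoherent X).IsClosedUnderIsomorphisms :=
  ⟨fun {M N} e hM ↦ isCoherent_of_total e.inv (0 : N ⟶ M) e.hom 0 (by simp) hM hM⟩

instance : (IsCoherent X).IsClosedUnderFiniteProducts := .mk'

end Coherent

section PrincipalParts

variable (k : Type u) [CommRing k] {X : Scheme.{u}} [∀ U, Algebra k (X.presheaf.obj U)]
  [AlgPresheaf k X.presheaf]

theorem isAffineLocalizing_ppObj (m : ℕ) {P : PMod X.presheaf} (hP : IsAffineLocalizing P) :
    IsAffineLocalizing (ppObj k m P) := fun _ hU f ↦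
  PPTensor.isAway_res _ (hU.isLocalization_basicOpen f) (hP hU f)

variable (X) in
/-- The tower of the functors `𝒫ᵐ ⊗ -` on the category of modules. -/
noncomputable def ppModTower : Tower X.Modules :=
  Tower.transport (ppTower k X.presheaf) (pmodAdj X)

/-- The canonical map from `𝒫ᵐ ⊗ F(U)` to the sections of the sheaf `𝒫ᵐ ⊗ F` on `U`. -/
noncomputable def ppUnit (m : ℕ) (F : X.Modules) (U : X.Opens) :
    PPTensor k (X.presheaf.obj (op U)) m ((toPMod F).obj (op U)) →ₗ[X.presheaf.obj (op U)]
      (toPMod (((ppModTower k X).T m).obj F)).obj (op U) :=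
  lin ((pmodAdj X).unit.app (ppObj k m (toPMod F))) (op U)

/-- The presheaf `U ↦ 𝒫ᵐ ⊗ F(U)` has the same sections over the affine open subsets as the sheaf
`𝒫ᵐ ⊗ F` associated with it. -/
theorem ppUnit_bijective (m : ℕ) {F : X.Modules} (hF : IsAffineLocalizing (toPMod F)) {U : X.Opens}
    (hU : IsAffineOpen U) : Function.Bijective (ppUnit k m F U) :=
  ⟨(isLocallyBijective_unit _).lin_injective hU (isAffineLocalizing_ppObj k m hF),
    (isLocallyBijective_unit _).lin_surjective hU (isAffineLocalizing_ppObj k m hF)⟩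

theorem isAffineLocalizing_ppModTower (m : ℕ) {F : X.Modules}
    (hF : IsAffineLocalizing (toPMod F)) :
    IsAffineLocalizing (toPMod (((ppModTower k X).T m).obj F)) :=
  (isLocallyBijective_unit _).isAffineLocalizing (isAffineLocalizing_ppObj k m hF)

theorem sec_unit {P Q : PMod X.presheaf} (φ : P ⟶ Q) (U : X.Opens) (t : P.obj (op U)) :
    sec ((pmodSheafify X).map φ) U (lin ((pmodAdj X).unit.app P) (op U) t) =
      lin ((pmodAdj X).unit.app Q) (op U) (lin φ (op U) t) :=
  congrArg (fun ψ ↦ lin ψ (op U) t) ((pmodAdj X).unit_naturality φ)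

theorem sec_map_ppUnit (m : ℕ) {F G : X.Modules} (u : F ⟶ G) (U : X.Opens)
    (t : PPTensor k (X.presheaf.obj (op U)) m ((toPMod F).obj (op U))) :
    sec (((ppModTower k X).T m).map u) U (ppUnit k m F U t) =
      ppUnit k m G U (PPTensor.map k m (sec u U) t) :=
  sec_unit (ppMap k m ((pmod X).map u)) U t

theorem sec_q_ppUnit {m r : ℕ} (h : m ≤ r) (F : X.Modules) (U : X.Opens)
    (t : PPTensor k (X.presheaf.obj (op U)) r ((toPMod F).obj (op U))) :
    sec (((ppModTower k X).q h).app F) U (ppUnit k r F U t) =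
      ppUnit k m F U (PPTensor.trans k _ h t) :=
  sec_unit (ppTrans k h (toPMod F)) U t

theorem isCoherent_ppModTower
    (hft : ∀ U : X.Opens, IsAffineOpen U → Algebra.FiniteType k (X.presheaf.obj (op U)))
    (m : ℕ) (F : X.Modules) (hF : IsCoherent X F) :
    IsCoherent X (((ppModTower k X).T m).obj F) := by
  rw [isCoherent_iff] at hF ⊢
  refine ⟨isAffineLocalizing_ppModTower k m hF.1, fun U hU ↦ ?_⟩
  have := hft U hU
  have := hF.2 U hU
  have := PPTensor.finite k (A := X.presheaf.obj (op U)) (M := (toPMod F).obj (op U)) m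
  exact Module.Finite.of_surjective _ (ppUnit_bijective k m hF.1 hU).2

section Exact

variable {k} (h : ∀ m F, IsCoherent X F → IsCoherent X (((ppModTower k X).T m).obj F))

theorem isAffineLocalizing_obj (F : (IsCoherent X).FullSubcategory) :
    IsAffineLocalizing (toPMod F.obj) :=
  (isCoherent_iff.1 F.property).1

theorem restrict_additive [IsLocallyNoetherian X] (m : ℕ) :
    (((ppModTower k X).restrict (IsCoherent X) h).T m).Additive where
  map_add {F G φ ψ} := by
    refine ObjectProperty.hom_ext _ (sub_eq_zero.1 ?_)
    refine eq_zero_of_sec_affine (isAffineLocalizing_ppModTower k m (isAffineLocalizing_obj F)) _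
      fun U hU s ↦ ?_
    obtain ⟨t, rfl⟩ := (ppUnit_bijective k m (isAffineLocalizing_obj F) hU).2 s
    refine sub_eq_zero.2 ((sec_map_ppUnit k m (φ.hom + ψ.hom) U t).trans ?_)
    refine Eq.trans ?_ (congrArg₂ (· + ·) (sec_map_ppUnit k m φ.hom U t)
      (sec_map_ppUnit k m ψ.hom U t)).symm
    exact (congrArg (ppUnit k m G.obj U) (PPTensor.map_add_left k (sec φ.hom U) (sec ψ.hom U)
      t)).trans (map_add (ppUnit k m G.obj U) _ _)

theorem sec_exact_of_exact [IsLocallyNoetherian X] {S : ShortComplex (IsCoherent X).FullSubcategory}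
    (hS : S.Exact) [Epi S.g] {U : X.Opens} (hU : IsAffineOpen U) :
    Function.Exact (sec S.f.hom U) (sec S.g.hom U) ∧ Function.Surjective (sec S.g.hom U) := by
  have := (IsCoherent X).preservesCokernels_ι S.f
  have h1 := CokernelCofork.mapIsColimit _ hS.gIsCokernel (IsCoherent X).ι
  exact ⟨sec_cokernel_exact (isAffineLocalizing_obj _) (isAffineLocalizing_obj _) h1 hU,
    sec_cokernel_surjective (isAffineLocalizing_obj _) (isAffineLocalizing_obj _) h1 hU⟩

theorem exact_of_sec_exact [IsLocallyNoetherian X] {S : ShortComplex (IsCoherent X).FullSubcategory}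
    (hS : ∀ U : X.Opens, IsAffineOpen U → Function.Exact (sec S.f.hom U) (sec S.g.hom U)) :
    S.Exact := by
  rw [ShortComplex.exact_iff_kernel_ι_comp_cokernel_π_zero]
  refine ObjectProperty.hom_ext _ (eq_zero_of_sec_affine (isAffineLocalizing_obj _) _
    fun U hU s ↦ ?_)
  obtain ⟨t, ht⟩ := (hS U hU (sec (kernel.ι S.g).hom U s)).1
    (sec_sec_eq_zero (congrArg (·.hom) (kernel.condition S.g)) U s)
  change sec (cokernel.π S.f).hom U (sec (kernel.ι S.g).hom U s) = 0
  rw [← ht]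
  exact sec_sec_eq_zero (congrArg (·.hom) (cokernel.condition S.f)) U t

theorem epi_of_sec_surjective [IsLocallyNoetherian X] {F G : (IsCoherent X).FullSubcategory}
    {φ : F ⟶ G} (hφ : ∀ U : X.Opens, IsAffineOpen U → Function.Surjective (sec φ.hom U)) :
    Epi φ := by
  refine Preadditive.epi_of_cancel_zero _ fun {W} w hw ↦ ?_
  refine ObjectProperty.hom_ext _ (eq_zero_of_sec_affine (isAffineLocalizing_obj _) _
    fun U hU s ↦ ?_)
  obtain ⟨t, rfl⟩ := hφ U hU s
  exact sec_sec_eq_zero (congrArg (·.hom) hw) U t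

theorem restrict_preservesFiniteColimits [IsLocallyNoetherian X] (m : ℕ) :
    PreservesFiniteColimits (((ppModTower k X).restrict (IsCoherent X) h).T m) := by
  have := restrict_additive h m
  refine ((((ppModTower k X).restrict (IsCoherent X) h).T m).preservesFiniteColimits_tfae.out
    1 3).1 ?_
  rintro S ⟨hS, hg⟩
  constructor
  · refine exact_of_sec_exact fun U hU s ↦ ?_
    obtain ⟨h1, h2⟩ := sec_exact_of_exact hS hU
    obtain ⟨t, rfl⟩ := (ppUnit_bijective k m (isAffineLocalizing_obj S.X₂) hU).2 s
    have hb := ppUnit_bijective k m (isAffineLocalizing_obj S.X₃) hU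
    refine (Eq.congr_left (sec_map_ppUnit k m S.g.hom U t)).trans
      ((map_eq_zero_iff _ hb.1).trans ((PPTensor.map_exact k h1 h2 m t).trans ?_))
    constructor
    · rintro ⟨y, rfl⟩
      exact ⟨_, sec_map_ppUnit k m S.f.hom U y⟩
    · rintro ⟨y, hy⟩
      obtain ⟨y, rfl⟩ := (ppUnit_bijective k m (isAffineLocalizing_obj S.X₁) hU).2 y
      exact ⟨y, (ppUnit_bijective k m (isAffineLocalizing_obj S.X₂) hU).1
        ((sec_map_ppUnit k m S.f.hom U y).symm.trans hy)⟩
  · refine epi_of_sec_surjective fun U hU s ↦ ?_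
    obtain ⟨t, rfl⟩ := (ppUnit_bijective k m (isAffineLocalizing_obj S.X₃) hU).2 s
    obtain ⟨y, rfl⟩ := PPTensor.map_surjective k (sec_exact_of_exact hS hU).2 m t
    exact ⟨_, sec_map_ppUnit k m S.g.hom U y⟩

end Exact

end PrincipalParts

section Field

variable {k : Type u} [Field k] {X : Scheme.{u}} [∀ U, Algebra k (X.presheaf.obj U)]
  [AlgPresheaf k X.presheaf]

/-- The principal parts form an exact tower on the coherent modules. -/
theorem restrict_isExact [IsLocallyNoetherian X] [CompactSpace X]
    (h : ∀ m F, IsCoherent X F → IsCoherent X (((ppModTower k X).T m).obj F))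
    (hft : ∀ U : X.Opens, IsAffineOpen U → Algebra.FiniteType k (X.presheaf.obj (op U))) :
    ((ppModTower k X).restrict (IsCoherent X) h).IsExact where
  additive := restrict_additive h
  preservesFiniteColimits := restrict_preservesFiniteColimits h
  artinRees {F G} u hu m := by
    have := (IsCoherent X).preservesMonomorphisms_ι_of_isNormalEpiCategory
    have : Mono u.hom := inferInstanceAs (Mono ((IsCoherent X).ι.map u))
    have h1 (U : X.affineOpens) := by
      have := hft U.1 U.2
      have := (isCoherent_iff.1 G.property).2 U.1 U.2
      exact PPTensor.artinRees k (sec u.hom U.1) (sec_injective_of_mono U.1)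
    choose c hc using h1
    obtain ⟨t, ht⟩ := isCompact_univ.elim_finite_subcover (fun U : X.affineOpens ↦ (U.1 : Set X))
      (fun U ↦ U.1.isOpen) fun x _ ↦ by
        obtain ⟨_, ⟨U, hU, rfl⟩, hx, -⟩ := X.isBasis_affineOpens.exists_subset_of_mem_open
          (Set.mem_univ x) isOpen_univ
        exact Set.mem_iUnion.2 ⟨⟨U, hU⟩, hx⟩
    -- `t` indexes a finite affine covering, and `c` gives the Artin–Rees constants of its members.
    refine ⟨m + t.sup c, Nat.le_add_right _ _, fun Z z hz ↦ ?_⟩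
    refine ObjectProperty.hom_ext _ (eq_zero_of_sec (isAffineLocalizing_obj Z) _ fun x ↦ ?_)
    obtain ⟨U, hU, hx⟩ := Set.mem_iUnion₂.1 (ht (Set.mem_univ x))
    refine ⟨U.1, U.2, hx, fun s ↦ ?_⟩
    obtain ⟨y, hy⟩ := (ppUnit_bijective k _ (isAffineLocalizing_obj F) U.2).2 (sec z.hom U.1 s)
    have e := sec_sec_eq_zero (congrArg (·.hom) hz) U.1 s
    have e1 : PPTensor.map k (m + t.sup c) (sec u.hom U.1) y = 0 := by
      refine (ppUnit_bijective k _ (isAffineLocalizing_obj G) U.2).1 ?_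
      refine ((sec_map_ppUnit k _ u.hom U.1 y).symm.trans ?_).trans (map_zero _).symm
      rw [hy]
      exact e
    have e2 := hc U m _ (Nat.le_add_right _ _) (Nat.add_le_add_left (Finset.le_sup hU) m) y e1
    change sec (((ppModTower k X).q (Nat.le_add_right _ _)).app F.obj) U.1 (sec z.hom U.1 s) = 0
    rw [← hy]
    exact (sec_q_ppUnit k _ F.obj U.1 y).trans ((congrArg _ e2).trans (map_zero _))

end Field

section Scheme

variable {k : Type u} [Field k] {X : Scheme.{u}} (f : X ⟶ Spec (CommRingCat.of k))

theorem finiteType_of_isAffineOpen [LocallyOfFiniteType f] (U : X.Opens) (hU : IsAffineOpen U) :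
    @Algebra.FiniteType k (X.presheaf.obj (op U)) _ _ (structAlgebra f (op U)) := by
  have h1 := f.finiteType_appLE (isAffineOpen_top _) hU le_top
  have h2 : (Scheme.ΓSpecIso (CommRingCat.of k)).inv.hom.FiniteType :=
    .of_surjective _ (Scheme.ΓSpecIso (CommRingCat.of k)).symm.commRingCatIsoToRingEquiv.surjective
  exact h1.comp h2

theorem preservesCoherent [LocallyOfFiniteType f] : PreservesCoherent f :=
  @isCoherent_ppModTower k _ X (structAlgebra f) (algPresheaf f) (finiteType_of_isAffineOpen f)

theorem modTower_isExact [LocallyOfFiniteType f] [QuasiCompact f] [IsLocallyNoetherian X] :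
    ((modTower f).restrict (IsCoherent X) (preservesCoherent f)).IsExact :=
  have : CompactSpace X := QuasiCompact.compactSpace_of_compactSpace f
  @restrict_isExact k _ X (structAlgebra f) (algPresheaf f) _ _ (preservesCoherent f)
    (finiteType_of_isAffineOpen f)

end Scheme

end StratPro

theorem proposition2p6 (X : Scheme.{0}) (f : X ⟶ Spec (CommRingCat.of ℂ)) [Smooth f]
    [IsSeparated f] [LocallyOfFiniteType f] [QuasiCompact f] :
    Nonempty (Abelian (NuP f)) ∧
    (∀ (J : Type) [SmallCategory J] [IsCofiltered J],
      ∃ _ : HasLimitsOfShape J (NuP f), HasExactLimitsOfShape J (NuP f)) ∧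
    ∃ h : PreservesCoherent f,
      Nonempty (forgetStrat f ⊣ coextension f h) ∧
      ∀ F : NuO X, Comod.IsInduced ((coextension f h).obj F) := by
  have : IsLocallyNoetherian X := LocallyOfFiniteType.isLocallyNoetherian f
  have h := preservesCoherent f
  have := modTower_isExact f
  exact ⟨(modTower f).nonempty_abelian_comod (IsCoherent X) h,
    fun J _ _ ↦ (modTower f).comod_hasExactLimits (IsCoherent X) h J,
    h, ⟨(modTower f).forgetCofreeAdj (IsCoherent X) h⟩,
    (modTower f).isInduced_cofree (IsCoherent X) h⟩
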